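/- For an orthogonal matrix $B\in O(n)$ and $b\in\mathbb R^n$ let $BL_b$ denote the isometry $x\mapsto B(x+b)$ of $\mathbb R^n$. A Bieberbach group is a discrete, cocompact, torsion-free subgroup $\Gamma$ of the isometry group $I(\mathbb R^n)$; then $M_\Gamma=\Gamma\backslash\mathbb R^n$ is a compact flat Riemannian manifold with the metric induced from $\mathbb R^n$. Two compact Riemannian manifolds are called $p$-isospectral if their Hodge–Laplace operators $d\delta+\delta d$ on smooth $p$-forms have the same eigenvalues with the same multiplicities ($p=0$: isospectral on functions). $\beta_h$ denotes the $h$-th real Betti number and $T^k=\mathbb Z^k\backslash\mathbb R^k$ the standard flat torus (a point if $k=0$). Let $\widetilde J=\begin{pmatrix}0&1\\-1&0\end{pmatrix}$, let $I_2$ be the $2\times2$ identity matrix, let $e_1,\dots,e_6$ be the canonical basis of $\mathbb R^6$, and put $$B_1=\mathrm{diag}(\widetilde J,\widetilde J,1,1),\quad B_2=\mathrm{diag}(-I_2,I_2,1,1),\quad b_1=\tfrac{e_5}4,\quad b_2=\tfrac{e_6}2,$$ $$B_1'=\mathrm{diag}(\widetilde J,1,-1,-1,1),\quad B_2'=\mathrm{diag}(-I_2,-1,1,-1,1),\quad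 b_1'=\tfrac{e_6}4,\quad b_2'=\tfrac{e_4+e_5}2,$$ $$\Gamma=\langle B_1L_{b_1},\,B_2L_{b_2},\,L_\lambda:\lambda\in\mathbb Z^6\rangle,\qquad \Gamma'=\langle B_1'L_{b_1'},\,B_2'L_{b_2'},\,L_\lambda:\lambda\in\mathbb Z^6\rangle .$$ Then $\Gamma$ and $\Gamma'$ are Bieberbach groups. Moreover, for every $n\ge 6$, with $k=n-6$, the Riemannian products $M_\Gamma\times T^k$ and $M_{\Gamma'}\times T^k$ are $n$-dimensional compact flat manifolds (the quotients of $\mathbb R^n=\mathbb R^6\times\mathbb R^k$ by the Bieberbach groups $\Gamma\times\mathbb Z^k$ and $\Gamma'\times\mathbb Z^k$) with the following properties. 1. $M_\Gamma\times T^k$ and $M_{\Gamma'}\times T^k$ are isospectral on functions. 2. Their real cohomology is finite-dimensional, and for all $h\ge0$ $$\beta_h(M_\Gamma\times T^k)=\sum_{i=0}^{\min(h,6)}\beta_i(M_\Gamma)\binom k{h-i},\qquad \beta_h(M_{\Gamma'}\times T^k)=\sum_{i=0}^{\min(h,6)}\beta_i(M_{\Gamma'})\binom k{h-i},$$ where $\binom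 km=0$ for $m>k$. 3. $\beta_h(M_\Gamma\times T^k)>\beta_h(M_{\Gamma'}\times T^k)$ for all $0<h<n$. 4. $M_\Gamma\times T^k$ and $M_{\Gamma'}\times T^k$ are not $p$-isospectral for any $0<p<n$. -/

import Mathlib

noncomputable section

namespace FlatManifold

/-- Euclidean space `ℝ^ι` with its standard inner product. -/
abbrev Euc (ι : Type) [Fintype ι] : Type := EuclideanSpace ℝ ι

/-- The isometry group `I(ℝ^ι)` of Euclidean space. -/
abbrev Iso (ι : Type) [Fintype ι] : Type := Euc ι ≃ᵃⁱ[ℝ] Euc ι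

section Groups

variable {ι κ : Type} [Fintype ι] [Fintype κ]

/-- The equivalence relation on `ℝ^ι` of lying in the same `Γ`-orbit. -/
def orbitSetoid (Γ : Subgroup (Iso ι)) : Setoid (Euc ι) where
  r x y := ∃ g ∈ Γ, g x = y
  iseqv :=
    { refl := fun x => ⟨1, Γ.one_mem, rfl⟩
      symm := by
        rintro x y ⟨g, hg, rfl⟩
        exact ⟨g⁻¹, Γ.inv_mem hg, g.symm_apply_apply x⟩
      trans := by
        rintro x y z ⟨g, hg, rfl⟩ ⟨h, hh, rfl⟩
        exact ⟨h * g, Γ.mul_mem hh hg, rfl⟩ }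

/-- The orbit space `M_Γ = Γ \ ℝ^ι`. -/
def OrbitSpace (Γ : Subgroup (Iso ι)) : Type := Quotient (orbitSetoid Γ)

instance (Γ : Subgroup (Iso ι)) : TopologicalSpace (OrbitSpace Γ) :=
  inferInstanceAs (TopologicalSpace (Quotient (orbitSetoid Γ)))

/-- A Bieberbach group: a discrete, cocompact, torsion-free subgroup of `I(ℝ^ι)`.
The topology on `I(ℝ^ι)` is that of pointwise convergence (which, on isometries, is also the
compact-open topology and the Lie group topology). For such `Γ` the quotient `M_Γ` is a compact
flat Riemannian manifold with the metric induced from `ℝ^ι`. -/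
structure IsBieberbach (Γ : Subgroup (Iso ι)) : Prop where
  discrete : IsDiscrete ((fun g : Iso ι => (g : Euc ι → Euc ι)) '' (Γ : Set (Iso ι)))
  cocompact : CompactSpace (OrbitSpace Γ)
  torsionFree : ∀ g ∈ Γ, IsOfFinOrder g → g = 1

/-- The element `B L_b` of `I(ℝ^ι)`, that is `x ↦ B (x + b)`, for `B` orthogonal and `b ∈ ℝ^ι`. -/
def rigid [DecidableEq ι] (B : Matrix.orthogonalGroup ι ℝ) (b : Euc ι) : Iso ι :=
  (AffineIsometryEquiv.constVAdd ℝ (Euc ι) b).trans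
    (Unitary.linearIsometryEquiv
      (Unitary.map (StarMulEquiv.toStarMonoidHom
        (StarMulEquiv.ofClass (Matrix.toEuclideanCLM (n := ι) (𝕜 := ℝ)))) B)).toAffineIsometryEquiv

theorem rigid_apply [DecidableEq ι] (B : Matrix.orthogonalGroup ι ℝ) (b x : Euc ι) (i : ι) :
    rigid B b x i = ∑ j, (B : Matrix ι ι ℝ) i j * (x j + b j) := by
  have h : rigid B b x = Matrix.toEuclideanCLM (n := ι) (𝕜 := ℝ) (B : Matrix ι ι ℝ) (b + x) := rfl
  rw [h, add_comm b x, Matrix.ofLp_toEuclideanCLM]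
  simp [Matrix.mulVec, dotProduct]

/-- The translations by the vectors of the canonical lattice `ℤ^ι`. The quotient of `ℝ^ι` by
this group is the standard flat torus `T^ι = ℤ^ι \ ℝ^ι`. -/
def latticeTranslations (ι : Type) [Fintype ι] : Subgroup (Iso ι) where
  carrier := {g | ∃ m : ι → ℤ, ∀ x i, g x i = x i + m i}
  one_mem' := ⟨0, fun x i => by simp⟩
  mul_mem' := by
    rintro g h ⟨m, hm⟩ ⟨l, hl⟩
    refine ⟨l + m, fun x i => ?_⟩
    rw [AffineIsometryEquiv.coe_mul, Function.comp_apply, hm, hl]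
    simp [add_assoc]
  inv_mem' := by
    rintro g ⟨m, hm⟩
    refine ⟨-m, fun x i => ?_⟩
    have h := hm (g⁻¹ x) i
    rw [show g (g⁻¹ x) = x from g.apply_symm_apply x] at h
    simp [h]

/-- The group `Γ × Δ` acting on `ℝ^ι × ℝ^κ = ℝ^(ι ⊕ κ)` by `(x, y) ↦ (γ x, δ y)`. The quotient is
the Riemannian product `M_Γ × M_Δ`. -/
def prodGroup (Γ : Subgroup (Iso ι)) (Δ : Subgroup (Iso κ)) : Subgroup (Iso (ι ⊕ κ)) where
  carrier := {g | ∃ γ ∈ Γ, ∃ δ ∈ Δ, ∀ (x : Euc ι) (y : Euc κ),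
    g (WithLp.toLp 2 (Sum.elim x y)) = WithLp.toLp 2 (Sum.elim (γ x) (δ y))}
  one_mem' := ⟨1, Γ.one_mem, 1, Δ.one_mem, fun _ _ => rfl⟩
  mul_mem' := by
    rintro g h ⟨γ, hγ, δ, hδ, hg⟩ ⟨γ', hγ', δ', hδ', hh⟩
    refine ⟨γ * γ', Γ.mul_mem hγ hγ', δ * δ', Δ.mul_mem hδ hδ', fun x y => ?_⟩
    rw [AffineIsometryEquiv.coe_mul, Function.comp_apply, hh, hg]
    rfl
  inv_mem' := by
    rintro g ⟨γ, hγ, δ, hδ, hg⟩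
    refine ⟨γ⁻¹, Γ.inv_mem hγ, δ⁻¹, Δ.inv_mem hδ, fun x y => ?_⟩
    have h := hg (γ⁻¹ x) (δ⁻¹ y)
    rw [show γ (γ⁻¹ x) = x from γ.apply_symm_apply x,
      show δ (δ⁻¹ y) = y from δ.apply_symm_apply y] at h
    rw [← h]
    exact g.symm_apply_apply _

end Groups

section Forms

variable {ι : Type} [Fintype ι] (Γ : Subgroup (Iso ι))

/-- Pull-back `g^* ω` of a differential form on `ℝ^ι` under an isometry. -/
def pullback {𝕜 : Type} [NormedField 𝕜] [NormedAlgebra ℝ 𝕜] {p : ℕ} (g : Iso ι)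
    (ω : Euc ι → Euc ι [⋀^Fin p]→L[ℝ] 𝕜) (x : Euc ι) : Euc ι [⋀^Fin p]→L[ℝ] 𝕜 :=
  (ω (g x)).compContinuousLinearMap (g.linearIsometryEquiv : Euc ι →L[ℝ] Euc ι)

/-- The space of all (not necessarily smooth) `𝕜`-valued `p`-forms on `ℝ^ι`, with the pointwise
vector space structure. -/
def Forms (ι : Type) [Fintype ι] (𝕜 : Type) [NormedField 𝕜] [NormedAlgebra ℝ 𝕜] (p : ℕ) : Type :=
  Euc ι → Euc ι [⋀^Fin p]→L[ℝ] 𝕜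

instance (𝕜 : Type) [NormedField 𝕜] [NormedAlgebra ℝ 𝕜] (p : ℕ) : AddCommGroup (Forms ι 𝕜 p) :=
  inferInstanceAs (AddCommGroup (Euc ι → Euc ι [⋀^Fin p]→L[ℝ] 𝕜))

instance (𝕜 : Type) [NormedField 𝕜] [NormedAlgebra ℝ 𝕜] (p : ℕ) : Module 𝕜 (Forms ι 𝕜 p) :=
  inferInstanceAs (Module 𝕜 (Euc ι → Euc ι [⋀^Fin p]→L[ℝ] 𝕜))

/-- The space `Ω^p(M_Γ; 𝕜)` of smooth `𝕜`-valued differential `p`-forms on `M_Γ = Γ \ ℝ^ι`: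
the smooth `p`-forms `ω` on `ℝ^ι` with `γ^* ω = ω` for all `γ ∈ Γ`. -/
def smoothForms (𝕜 : Type) [NormedField 𝕜] [NormedAlgebra ℝ 𝕜] (p : ℕ) :
    Submodule 𝕜 (Forms ι 𝕜 p) where
  carrier := {ω | ContDiff ℝ (⊤ : ℕ∞) ω ∧ ∀ g ∈ Γ, pullback g ω = ω}
  zero_mem' := ⟨contDiff_const, fun g _ => rfl⟩
  add_mem' := by
    rintro ω η ⟨hω, hω'⟩ ⟨hη, hη'⟩
    refine ⟨hω.add hη, fun g hg => ?_⟩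
    conv_rhs => rw [← hω' g hg, ← hη' g hg]
    rfl
  smul_mem' := by
    rintro c ω ⟨hω, hω'⟩
    refine ⟨hω.const_smul c, fun g hg => ?_⟩
    conv_rhs => rw [← hω' g hg]
    rfl

theorem extDeriv_const_smul {𝕜 : Type} [NormedField 𝕜] [NormedAlgebra ℝ 𝕜] {p : ℕ}
    {ω : Euc ι → Euc ι [⋀^Fin p]→L[ℝ] 𝕜} (h : ContDiff ℝ (⊤ : ℕ∞) ω) (c : 𝕜) :
    extDeriv (c • ω) = c • extDeriv ω := by
  funext x
  have hx : DifferentiableAt ℝ ω x := h.differentiable (by simp) x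
  ext v
  simp only [extDeriv, Pi.smul_apply, fderiv_const_smul hx,
    ContinuousAlternatingMap.alternatizeUncurryFin_apply, ContinuousAlternatingMap.smul_apply,
    smul_apply, Finset.smul_sum]
  exact Finset.sum_congr rfl fun i _ => smul_comm _ _ _

theorem extDeriv_smooth_add {𝕜 : Type} [NormedField 𝕜] [NormedAlgebra ℝ 𝕜] {p : ℕ}
    {ω η : Euc ι → Euc ι [⋀^Fin p]→L[ℝ] 𝕜}
    (h : ContDiff ℝ (⊤ : ℕ∞) ω) (h' : ContDiff ℝ (⊤ : ℕ∞) η) :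
    extDeriv (ω + η) = extDeriv ω + extDeriv η :=
  funext fun x => extDeriv_add (h.differentiable (by simp) x) (h'.differentiable (by simp) x)

theorem extDeriv_zero_form {𝕜 : Type} [NormedField 𝕜] [NormedAlgebra ℝ 𝕜] {p : ℕ} :
    extDeriv (0 : Euc ι → Euc ι [⋀^Fin p]→L[ℝ] 𝕜) = 0 := by
  funext x
  ext v
  simp [extDeriv, ContinuousAlternatingMap.alternatizeUncurryFin_apply]

/-- The closed forms in `Ω^p(M_Γ; 𝕜)`. -/
def closedForms (𝕜 : Type) [NormedField 𝕜] [NormedAlgebra ℝ 𝕜] (p : ℕ) :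
    Submodule 𝕜 (Forms ι 𝕜 p) where
  carrier := {ω | ω ∈ smoothForms Γ 𝕜 p ∧ extDeriv ω = 0}
  zero_mem' := ⟨zero_mem _, extDeriv_zero_form⟩
  add_mem' := by
    rintro ω η ⟨hω, hω'⟩ ⟨hη, hη'⟩
    exact ⟨add_mem hω hη, by
      rw [show extDeriv (ω + η) = extDeriv ω + extDeriv η from extDeriv_smooth_add hω.1 hη.1,
        hω', hη', add_zero]⟩
  smul_mem' := by
    rintro c ω ⟨hω, hω'⟩
    exact ⟨Submodule.smul_mem _ c hω, by
      rw [show extDeriv (c • ω) = c • extDeriv ω from extDeriv_const_smul hω.1 c,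
        hω', smul_zero]⟩

/-- The exact forms `d Ω^(p-1)(M_Γ; 𝕜)` (zero if `p = 0`). -/
def exactForms (𝕜 : Type) [NormedField 𝕜] [NormedAlgebra ℝ 𝕜] :
    (p : ℕ) → Submodule 𝕜 (Forms ι 𝕜 p)
  | 0 => ⊥
  | p + 1 =>
    { carrier := {ω | ∃ η ∈ smoothForms Γ 𝕜 p, extDeriv η = ω}
      zero_mem' := ⟨0, zero_mem _, extDeriv_zero_form⟩
      add_mem' := by
        rintro _ _ ⟨ω, hω, rfl⟩ ⟨η, hη, rfl⟩
        exact ⟨ω + η, add_mem hω hη, extDeriv_smooth_add hω.1 hη.1⟩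
      smul_mem' := by
        rintro c _ ⟨ω, hω, rfl⟩
        exact ⟨c • ω, Submodule.smul_mem _ c hω, extDeriv_const_smul hω.1 c⟩ }

/-- The de Rham cohomology `H^p(M_Γ; 𝕜)`: closed forms modulo exact forms. -/
def DeRham (𝕜 : Type) [NormedField 𝕜] [NormedAlgebra ℝ 𝕜] (p : ℕ) : Type :=
  closedForms Γ 𝕜 p ⧸ (exactForms Γ 𝕜 p).submoduleOf (closedForms Γ 𝕜 p)

instance (𝕜 : Type) [NormedField 𝕜] [NormedAlgebra ℝ 𝕜] (p : ℕ) : AddCommGroup (DeRham Γ 𝕜 p) :=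
  inferInstanceAs (AddCommGroup
    (closedForms Γ 𝕜 p ⧸ (exactForms Γ 𝕜 p).submoduleOf (closedForms Γ 𝕜 p)))

instance (𝕜 : Type) [NormedField 𝕜] [NormedAlgebra ℝ 𝕜] (p : ℕ) : Module 𝕜 (DeRham Γ 𝕜 p) :=
  inferInstanceAs (Module 𝕜
    (closedForms Γ 𝕜 p ⧸ (exactForms Γ 𝕜 p).submoduleOf (closedForms Γ 𝕜 p)))

/-- The `p`-th Betti number `β_p(M_Γ) = dim H^p(M_Γ; ℝ)`. -/
def betti (p : ℕ) : ℕ := Module.finrank ℝ (DeRham Γ ℝ p)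

/-- The codifferential `δ` of the flat metric, on forms of positive degree:
`(δ ω)(v₁, …, v_p) = - ∑ i, (∂ω/∂x_i)(e_i, v₁, …, v_p)`, the formal adjoint of `d`. -/
def codiff [DecidableEq ι] {p : ℕ} (ω : Euc ι → Euc ι [⋀^Fin (p + 1)]→L[ℝ] ℂ) (x : Euc ι) :
    Euc ι [⋀^Fin p]→L[ℝ] ℂ :=
  -∑ i, (fderiv ℝ ω x (EuclideanSpace.single i 1)).curryLeft (EuclideanSpace.single i 1)

/-- The Hodge-Laplace operator `d δ + δ d` on `p`-forms (which is `δ d` on functions). It is a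
local operator commuting with pull-back under isometries, so it acts on the forms on `M_Γ`. With
this sign its eigenvalues are non-negative. -/
def hodgeLaplacian [DecidableEq ι] : {p : ℕ} → (Euc ι → Euc ι [⋀^Fin p]→L[ℝ] ℂ) →
    Euc ι → Euc ι [⋀^Fin p]→L[ℝ] ℂ
  | 0, ω, x => codiff (extDeriv ω) x
  | _ + 1, ω, x => extDeriv (codiff ω) x + codiff (extDeriv ω) x

theorem contDiff_extDeriv {p : ℕ} {ω : Euc ι → Euc ι [⋀^Fin p]→L[ℝ] ℂ}
    (h : ContDiff ℝ (⊤ : ℕ∞) ω) : ContDiff ℝ (⊤ : ℕ∞) (extDeriv ω) := by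
  have h1 : ContDiff ℝ (⊤ : ℕ∞) (fderiv ℝ ω) := h.fderiv_right (by simp)
  exact (ContinuousAlternatingMap.alternatizeUncurryFinCLM ℝ (Euc ι) ℂ (n := p)).contDiff.comp h1

theorem contDiff_codiff [DecidableEq ι] {p : ℕ} {ω : Euc ι → Euc ι [⋀^Fin (p + 1)]→L[ℝ] ℂ}
    (h : ContDiff ℝ (⊤ : ℕ∞) ω) : ContDiff ℝ (⊤ : ℕ∞) (codiff ω) := by
  refine ContDiff.neg (ContDiff.sum fun i _ => ?_)
  have h1 : ContDiff ℝ (⊤ : ℕ∞) (fun x => fderiv ℝ ω x (EuclideanSpace.single i 1)) :=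
    (h.fderiv_right (m := (⊤ : ℕ∞)) (by simp)).clm_apply contDiff_const
  have h2 : IsBoundedLinearMap ℝ (fun f : Euc ι [⋀^Fin (p + 1)]→L[ℝ] ℂ =>
      f.curryLeft (EuclideanSpace.single i (1 : ℝ))) :=
    { map_add := fun _ _ => rfl
      map_smul := fun _ _ => rfl
      bound := ⟨1, one_pos, fun f => by
        have h3 := f.curryLeft.le_opNorm (EuclideanSpace.single i (1 : ℝ))
        rwa [ContinuousAlternatingMap.norm_curryLeft, PiLp.norm_single, norm_one,
          mul_one, ← one_mul ‖f‖] at h3⟩ }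
  exact h2.contDiff.comp h1

theorem codiff_smooth_add [DecidableEq ι] {p : ℕ} {ω η : Euc ι → Euc ι [⋀^Fin (p + 1)]→L[ℝ] ℂ}
    (h : ContDiff ℝ (⊤ : ℕ∞) ω) (h' : ContDiff ℝ (⊤ : ℕ∞) η) :
    codiff (ω + η) = codiff ω + codiff η := by
  funext x
  have hx : DifferentiableAt ℝ ω x := h.differentiable (by simp) x
  have hx' : DifferentiableAt ℝ η x := h'.differentiable (by simp) x
  simp only [codiff, fderiv_add hx hx', Pi.add_apply, add_apply,
    ContinuousAlternatingMap.curryLeft_add, Finset.sum_add_distrib, neg_add]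

theorem codiff_complex_smul [DecidableEq ι] {p : ℕ} {ω : Euc ι → Euc ι [⋀^Fin (p + 1)]→L[ℝ] ℂ}
    (h : ContDiff ℝ (⊤ : ℕ∞) ω) (c : ℂ) : codiff (c • ω) = c • codiff ω := by
  funext x
  have hx : DifferentiableAt ℝ ω x := h.differentiable (by simp) x
  simp only [codiff, fderiv_const_smul hx, Pi.smul_apply, smul_neg, Finset.smul_sum]
  rfl

theorem hodgeLaplacian_add [DecidableEq ι] {p : ℕ} {ω η : Euc ι → Euc ι [⋀^Fin p]→L[ℝ] ℂ}
    (h : ContDiff ℝ (⊤ : ℕ∞) ω) (h' : ContDiff ℝ (⊤ : ℕ∞) η) (x : Euc ι) :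
    hodgeLaplacian (ω + η) x = hodgeLaplacian ω x + hodgeLaplacian η x := by
  cases p with
  | zero =>
    simp only [hodgeLaplacian, extDeriv_smooth_add h h',
      codiff_smooth_add (contDiff_extDeriv h) (contDiff_extDeriv h'), Pi.add_apply]
  | succ p =>
    simp only [hodgeLaplacian, extDeriv_smooth_add h h', codiff_smooth_add h h',
      extDeriv_smooth_add (contDiff_codiff h) (contDiff_codiff h'),
      codiff_smooth_add (contDiff_extDeriv h) (contDiff_extDeriv h'), Pi.add_apply]
    abel

theorem hodgeLaplacian_smul [DecidableEq ι] {p : ℕ} {ω : Euc ι → Euc ι [⋀^Fin p]→L[ℝ] ℂ}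
    (h : ContDiff ℝ (⊤ : ℕ∞) ω) (c : ℂ) (x : Euc ι) :
    hodgeLaplacian (c • ω) x = c • hodgeLaplacian ω x := by
  cases p with
  | zero =>
    simp only [hodgeLaplacian, extDeriv_const_smul h,
      codiff_complex_smul (contDiff_extDeriv h), Pi.smul_apply]
  | succ p =>
    simp only [hodgeLaplacian, extDeriv_const_smul h, codiff_complex_smul h,
      extDeriv_const_smul (contDiff_codiff h), codiff_complex_smul (contDiff_extDeriv h),
      Pi.smul_apply, smul_add]

/-- The eigenspace of the Hodge-Laplace operator on smooth complex `p`-forms on `M_Γ`, for the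
real number `lam`. -/
def eigenforms [DecidableEq ι] (p : ℕ) (lam : ℝ) :
    Submodule ℂ (Forms ι ℂ p) where
  carrier := {ω | ω ∈ smoothForms Γ ℂ p ∧ ∀ x, hodgeLaplacian ω x = (lam : ℂ) • ω x}
  zero_mem' := by
    refine ⟨zero_mem _, fun x => ?_⟩
    have h := hodgeLaplacian_add (p := p) (ω := fun _ : Euc ι => 0) (η := fun _ => 0)
      contDiff_const contDiff_const x
    rw [show (fun _ : Euc ι => (0 : Euc ι [⋀^Fin p]→L[ℝ] ℂ)) + (fun _ => 0) = fun _ => 0 from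
      funext fun _ => add_zero _] at h
    exact (left_eq_add.mp h).trans (smul_zero (lam : ℂ)).symm
  add_mem' := by
    rintro ω η ⟨hω, hω'⟩ ⟨hη, hη'⟩
    refine ⟨add_mem hω hη, fun x => ?_⟩
    refine (hodgeLaplacian_add hω.1 hη.1 x).trans ?_
    rw [hω', hη']
    exact (smul_add (lam : ℂ) (ω x) (η x)).symm
  smul_mem' := by
    rintro c ω ⟨hω, hω'⟩
    refine ⟨Submodule.smul_mem _ c hω, fun x => ?_⟩
    refine (hodgeLaplacian_smul hω.1 c x).trans ?_
    rw [hω']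
    exact smul_comm c (lam : ℂ) (ω x)

/-- The multiplicity of `lam` in `spec^p(M_Γ)` (it is `0` if `lam` is not an eigenvalue). -/
def multiplicity [DecidableEq ι] (p : ℕ) (lam : ℝ) : Cardinal :=
  Module.rank ℂ (eigenforms Γ p lam)

end Forms

/-- `M_Γ` and `M_Γ'` are `p`-isospectral: `spec^p(M_Γ) = spec^p(M_Γ')`, that is, the
Hodge-Laplace operators on `p`-forms have the same eigenvalues with the same multiplicities. -/
def IsIsospectral {ι κ : Type} [Fintype ι] [Fintype κ] [DecidableEq ι] [DecidableEq κ] (p : ℕ)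
    (Γ : Subgroup (Iso ι)) (Γ' : Subgroup (Iso κ)) : Prop :=
  ∀ lam : ℝ, multiplicity Γ p lam = multiplicity Γ' p lam

section Example

/-- `B₁ = diag(J, J, 1, 1)` with `J = (0 1; -1 0)`. -/
def B₁ : Matrix.orthogonalGroup (Fin 6) ℝ :=
  ⟨!![ 0, 1,  0, 0, 0, 0;
      -1, 0,  0, 0, 0, 0;
       0, 0,  0, 1, 0, 0;
       0, 0, -1, 0, 0, 0;
       0, 0,  0, 0, 1, 0;
       0, 0,  0, 0, 0, 1], by
    rw [Matrix.mem_orthogonalGroup_iff]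
    ext i j
    fin_cases i <;> fin_cases j <;>
      simp [Matrix.mul_apply, Fin.sum_univ_six]⟩

/-- `B₂ = diag(-1, -1, 1, 1, 1, 1)`. -/
def B₂ : Matrix.orthogonalGroup (Fin 6) ℝ :=
  ⟨Matrix.diagonal ![-1, -1, 1, 1, 1, 1], by
    rw [Matrix.mem_orthogonalGroup_iff]
    ext i j
    fin_cases i <;> fin_cases j <;>
      simp [Matrix.mul_apply, Matrix.diagonal_apply]⟩

/-- `B₁' = diag(J, 1, -1, -1, 1)` with `J = (0 1; -1 0)`. -/
def B₁' : Matrix.orthogonalGroup (Fin 6) ℝ :=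
  ⟨!![ 0, 1, 0,  0,  0, 0;
      -1, 0, 0,  0,  0, 0;
       0, 0, 1,  0,  0, 0;
       0, 0, 0, -1,  0, 0;
       0, 0, 0,  0, -1, 0;
       0, 0, 0,  0,  0, 1], by
    rw [Matrix.mem_orthogonalGroup_iff]
    ext i j
    fin_cases i <;> fin_cases j <;>
      simp [Matrix.mul_apply, Fin.sum_univ_six]⟩

/-- `B₂' = diag(-1, -1, -1, 1, -1, 1)`. -/
def B₂' : Matrix.orthogonalGroup (Fin 6) ℝ :=
  ⟨Matrix.diagonal ![-1, -1, -1, 1, -1, 1], by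
    rw [Matrix.mem_orthogonalGroup_iff]
    ext i j
    fin_cases i <;> fin_cases j <;>
      simp [Matrix.mul_apply, Matrix.diagonal_apply]⟩

/-- `Γ = ⟨B₁ L_{e₅/4}, B₂ L_{e₆/2}, L_λ : λ ∈ ℤ⁶⟩`. -/
def Γ₀ : Subgroup (Iso (Fin 6)) :=
  Subgroup.closure {rigid B₁ !₂[0, 0, 0, 0, 1 / 4, 0], rigid B₂ !₂[0, 0, 0, 0, 0, 1 / 2]} ⊔
    latticeTranslations (Fin 6)

/-- `Γ' = ⟨B₁' L_{e₆/4}, B₂' L_{(e₄+e₅)/2}, L_λ : λ ∈ ℤ⁶⟩`. -/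
def Γ₀' : Subgroup (Iso (Fin 6)) :=
  Subgroup.closure
    {rigid B₁' !₂[0, 0, 0, 0, 0, 1 / 4], rigid B₂' !₂[0, 0, 0, 1 / 2, 1 / 2, 0]} ⊔
    latticeTranslations (Fin 6)

/-- The group `Γ × ℤ^k` acting on `ℝ^6 × ℝ^k`, whose quotient is `M_Γ × T^k`. -/
abbrev timesTorus (Γ : Subgroup (Iso (Fin 6))) (k : ℕ) : Subgroup (Iso (Fin 6 ⊕ Fin k)) :=
  prodGroup Γ (latticeTranslations (Fin k))

end Example

end FlatManifold

end

/-! Write `a`, `b` for the two non-lattice generators of either group. Modulo the lattice they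
commute and satisfy `a ^ 4 = b ^ 2 = 1`, so every element is `a ^ i * b ^ j * l` with `i < 4`, `j <
2` and `l` a lattice translation. Each group has a coordinate which `a` translates by 1/4 and `b`
fixes, and a coordinate which `b` translates by 1/2; reading these off an element of finite order
gives `i = 0`, then `j = 0`, so there is no torsion. Discreteness holds because all elements
preserve the points with coordinates in (1/4)ℤ. The product of such a group with ℤ^k is again
generated by two isometries and the full lattice, so all further results are proved for groups of
that shape and apply for every `k`.

Cohomology. Averaging over the torus and then over the finite holonomy shows that each de Rham class
contains exactly one constant form invariant under the linear parts (`deRhamEquiv`). After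
complexification the linear parts of `a` and `b` are simultaneously diagonal, and the dimension of
the invariant `p`-forms is the number of `p`-element sets of eigenvectors on which both products of
eigenvalues are 1 (`finrank_invForms_eq_card`). The factor T^k adds eigenvectors with trivial
eigenvalues, which gives the binomial formula (`goodCard_sum`). In dimension 6 the Poincaré
polynomials are (1+t)²(1+t²)² and (1+t)(1+t²)(1+t³), with coefficients 1,2,3,4,3,2,1 and
1,1,1,2,1,1,1, and the strict inequality in degrees 1 to 5 is inherited by the products.

Spectra. By the Weitzenböck formula of a flat metric (`hodgeLaplacian_eq`) the Hodge-Laplace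
operator acts on each coefficient separately, so by Fourier series the harmonic forms are the
invariant constant forms. Hence the multiplicity of 0 on `p`-forms is the `p`-th Betti number, and
for `0 < p < n` the spectra already differ at 0. On functions, the eigenspace for `lam` is the space
of fixed points of ℤ/4 × ℤ/2 on the span of the characters `expChar m` with 4π²|m|² = `lam`. Its
dimension is one eighth of a sum of eight traces, each a sum of phases over the vectors fixed by one
holonomy element (`multiplicity_zeroForms`). The eight traces of the two groups agree in pairs up to
a permutation of the coordinates (`sum_traceTerm_eq`), where `b` of the first group is matched with
`a ^ 2` of the second and conversely. -/

noncomputable section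
namespace FlatManifold

/-! ### Normal forms in a group generated by two elements and a lattice. -/

section Group

variable {G : Type*} [Group G]

theorem exists_mul_pow_eq_pow_mul {L : Subgroup G} {a : G}
    (ha : ∀ l ∈ L, ∃ l' ∈ L, l * a = a * l') (n : ℕ) :
    ∀ l ∈ L, ∃ l' ∈ L, l * a ^ n = a ^ n * l' := by
  induction n with
  | zero => exact fun l hl => ⟨l, hl, by simp⟩
  | succ n ih =>
    intro l hl
    obtain ⟨l', hl', h⟩ := ih l hl
    obtain ⟨l'', hl'', h'⟩ := ha l' hl'
    exact ⟨l'', hl'', by rw [pow_succ, ← mul_assoc, h, mul_assoc, h', mul_assoc]⟩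

/-- Normal form of the elements of a group generated by `a`, `b` and a subgroup `L` normalized by
`a` and `b`, when `a` and `b` commute modulo `L` and `a ^ 4`, `b ^ 2` lie in `L`. -/
theorem exists_normal_form {L : Subgroup G} {a b : G}
    (ha : ∀ l ∈ L, ∃ l' ∈ L, l * a = a * l') (hb : ∀ l ∈ L, ∃ l' ∈ L, l * b = b * l')
    (hab : ∃ l ∈ L, b * a = a * b * l) (ha4 : a ^ 4 ∈ L) (hb2 : b ^ 2 ∈ L)
    {g : G} (hg : g ∈ Subgroup.closure {a, b} ⊔ L) :
    ∃ i < 4, ∃ j < 2, ∃ l ∈ L, g = a ^ i * b ^ j * l := by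
  have hLab : ∀ i j : ℕ, ∀ l ∈ L, ∃ l' ∈ L, l * (a ^ i * b ^ j) = a ^ i * b ^ j * l' := by
    intro i j l hl
    obtain ⟨l', hl', h⟩ := exists_mul_pow_eq_pow_mul ha i l hl
    obtain ⟨l'', hl'', h'⟩ := exists_mul_pow_eq_pow_mul hb j l' hl'
    exact ⟨l'', hl'', by rw [← mul_assoc, h, mul_assoc, h', mul_assoc]⟩
  have hbai : ∀ i : ℕ, ∃ l ∈ L, b * a ^ i = a ^ i * b * l := by
    intro i
    induction i with
    | zero => exact ⟨1, L.one_mem, by simp⟩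
    | succ i ih =>
      obtain ⟨l, hl, h⟩ := ih
      obtain ⟨l', hl', h'⟩ := ha l hl
      obtain ⟨k, hk, h''⟩ := hab
      refine ⟨k * l', L.mul_mem hk hl', ?_⟩
      rw [pow_succ, ← mul_assoc, h, mul_assoc, h', ← mul_assoc, mul_assoc (a ^ i), h'']
      simp only [mul_assoc]
  -- The exponents are left unbounded here, which makes `P` stable under left multiplication by
  -- generators; they are reduced at the end.
  let P : G → Prop := fun g => ∃ i j : ℕ, ∃ l ∈ L, g = a ^ i * b ^ j * l
  have hPL : ∀ k ∈ L, ∀ g, P g → P (k * g) := by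
    rintro k hk _ ⟨i, j, l, hl, rfl⟩
    obtain ⟨l', hl', h⟩ := hLab i j k hk
    exact ⟨i, j, l' * l, L.mul_mem hl' hl, by rw [← mul_assoc, h, mul_assoc]⟩
  have hPa : ∀ g, P g → P (a * g) := by
    rintro _ ⟨i, j, l, hl, rfl⟩
    exact ⟨i + 1, j, l, hl, by rw [pow_succ']; simp only [mul_assoc]⟩
  have hPb : ∀ g, P g → P (b * g) := by
    rintro _ ⟨i, j, l, hl, rfl⟩
    obtain ⟨k, hk, h⟩ := hbai i
    obtain ⟨k', hk', h'⟩ := exists_mul_pow_eq_pow_mul hb j k hk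
    refine ⟨i, j + 1, k' * l, L.mul_mem hk' hl, ?_⟩
    calc b * (a ^ i * b ^ j * l) = b * a ^ i * b ^ j * l := by simp only [mul_assoc]
      _ = a ^ i * b * (k * b ^ j) * l := by rw [h]; simp only [mul_assoc]
      _ = a ^ i * b ^ (j + 1) * (k' * l) := by rw [h', pow_succ']; simp only [mul_assoc]
  have hP : P g := by
    rw [← Subgroup.closure_eq L, ← Subgroup.closure_union] at hg
    induction hg using Subgroup.closure_induction_left with
    | one => exact ⟨0, 0, 1, L.one_mem, by simp⟩
    | mul_left x hx y hy ih =>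
      rcases hx with (rfl | rfl) | hx
      exacts [hPa _ ih, hPb _ ih, hPL _ hx _ ih]
    | inv_mul_cancel x hx y hy ih =>
      rcases hx with (rfl | rfl) | hx
      -- The inverse of `a` is `a ^ 3 * (a ^ 4)⁻¹`, whose last factor lies in `L`; the same is done
      -- below for `b`.
      · have := hPa _ (hPa _ (hPa _ (hPL _ (L.inv_mem ha4) _ ih)))
        convert this using 1
        group
      · have := hPb _ (hPL _ (L.inv_mem hb2) _ ih)
        convert this using 1
        group
      · exact hPL _ (L.inv_mem hx) _ ih
  obtain ⟨i, j, l, hl, rfl⟩ := hP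
  -- Reducing `i` modulo 4 leaves a power of `a ^ 4`, an element of `L` that has to be moved to the
  -- right past `b ^ j`.
  obtain ⟨l', hl', h'⟩ := exists_mul_pow_eq_pow_mul hb j _ (L.pow_mem ha4 (i / 4))
  obtain ⟨k, hk, h⟩ : ∃ k ∈ L, b ^ j = b ^ (j % 2) * k :=
    ⟨_, L.pow_mem hb2 (j / 2), by rw [← pow_mul, ← pow_add, Nat.mod_add_div]⟩
  refine ⟨i % 4, Nat.mod_lt _ (by norm_num), j % 2, Nat.mod_lt _ (by norm_num), k * l' * l,
    L.mul_mem (L.mul_mem hk hl') hl, ?_⟩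
  calc a ^ i * b ^ j * l = a ^ (i % 4) * ((a ^ 4) ^ (i / 4) * b ^ j) * l := by
        rw [← mul_assoc, ← pow_mul, ← pow_add, Nat.mod_add_div]
    _ = a ^ (i % 4) * (b ^ (j % 2) * k * l') * l := by rw [h', ← h]
    _ = a ^ (i % 4) * b ^ (j % 2) * (k * l' * l) := by simp only [mul_assoc]

end Group

/-! ### Lattice translations, and a criterion for being a Bieberbach group. -/

section Translations

variable {ι κ : Type} [Fintype ι] [Fintype κ]

/-- The translation by an integral vector. -/
def latticeShift (m : ι → ℤ) : Iso ι :=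
  AffineIsometryEquiv.constVAdd ℝ (Euc ι) (WithLp.toLp 2 fun i => (m i : ℝ))

@[simp] theorem latticeShift_apply (m : ι → ℤ) (x : Euc ι) (i : ι) :
    latticeShift m x i = x i + m i := by
  rw [add_comm]; rfl

theorem latticeShift_mem (m : ι → ℤ) : latticeShift m ∈ latticeTranslations ι :=
  ⟨m, fun x i => latticeShift_apply m x i⟩

theorem iso_ext {g h : Iso ι} (H : ∀ x i, g x i = h x i) : g = h :=
  AffineIsometryEquiv.ext fun x => by ext i; exact H x i

theorem eq_latticeShift_of_mem {g : Iso ι} (hg : g ∈ latticeTranslations ι) :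
    ∃ m, g = latticeShift m := by
  obtain ⟨m, hm⟩ := hg
  exact ⟨m, iso_ext fun x i => by rw [hm, latticeShift_apply]⟩

theorem iso_mul_apply (g h : Iso ι) (x : Euc ι) : (g * h) x = g (h x) := rfl

theorem pow_apply_coord {g : Iso ι} {i : ι} {c : ℝ} (h : ∀ x, g x i = x i + c) (n : ℕ)
    (x : Euc ι) : (g ^ n) x i = x i + n * c := by
  induction n generalizing x with
  | zero => simp
  | succ n ih =>
    rw [pow_succ, iso_mul_apply, ih, h]
    push_cast
    ring

/-- The `n`-th power translates this coordinate by `n * c`, which is 0 only if `c` is. This single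
fact yields all the torsion-freeness below. -/
theorem coord_translation_eq_zero {g : Iso ι} (hg : IsOfFinOrder g) {i : ι} {c : ℝ}
    (h : ∀ x, g x i = x i + c) : c = 0 := by
  obtain ⟨n, hn, h1⟩ := isOfFinOrder_iff_pow_eq_one.mp hg
  have h2 := pow_apply_coord h n 0
  rw [h1] at h2
  have h3 : (n : ℝ) * c = 0 := by simpa using h2.symm
  exact (mul_eq_zero.mp h3).resolve_left (by exact_mod_cast hn.ne')

theorem lattice_torsionFree {g : Iso ι} (hg : g ∈ latticeTranslations ι) (h : IsOfFinOrder g) :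
    g = 1 := by
  obtain ⟨m, hm⟩ := hg
  refine iso_ext fun x i => ?_
  rw [hm, coord_translation_eq_zero h (hm · i), add_zero]
  rfl

end Translations

section Criterion

variable {ι κ : Type} [Fintype ι] [Fintype κ]

/-- The isometry maps points with coordinates in `ℤ/4` to such points. -/
def PreservesQuarter (g : Iso ι) : Prop :=
  ∀ x : Euc ι, (∀ i, ∃ m : ℤ, 4 * x i = m) → ∀ i, ∃ m : ℤ, 4 * g x i = m

theorem PreservesQuarter.mul {g h : Iso ι} (hg : PreservesQuarter g) (hh : PreservesQuarter h) :
    PreservesQuarter (g * h) := fun x hx => hg _ (hh x hx)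

theorem PreservesQuarter.one : PreservesQuarter (1 : Iso ι) := fun _ hx => hx

theorem PreservesQuarter.pow {g : Iso ι} (hg : PreservesQuarter g) (n : ℕ) :
    PreservesQuarter (g ^ n) := by
  induction n with
  | zero => exact .one
  | succ n ih => rw [pow_succ]; exact ih.mul hg

theorem preservesQuarter_of_mem_lattice {g : Iso ι} (hg : g ∈ latticeTranslations ι) :
    PreservesQuarter g := by
  intro x hx i
  obtain ⟨m, hm⟩ := hg
  obtain ⟨k, hk⟩ := hx i
  exact ⟨k + 4 * m i, by rw [hm, mul_add, hk]; push_cast; ring⟩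

theorem iso_eq_of_basis [DecidableEq ι] {g h : Iso ι} (h0 : g 0 = h 0)
    (h1 : ∀ i, g (EuclideanSpace.single i 1) = h (EuclideanSpace.single i 1)) : g = h := by
  have hlin : ∀ (f : Iso ι) x, f x = f.linearIsometryEquiv x + f 0 := fun f x => by
    simpa using f.map_vadd 0 x
  have h2 : g.linearIsometryEquiv.toLinearEquiv.toLinearMap =
      h.linearIsometryEquiv.toLinearEquiv.toLinearMap := by
    refine (EuclideanSpace.basisFun ι ℝ).toBasis.ext fun i => ?_
    have := h1 i
    rw [hlin g, hlin h, h0] at this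
    simpa using this
  refine AffineIsometryEquiv.ext fun x => ?_
  rw [hlin g, hlin h, h0]
  congr 1
  exact LinearMap.congr_fun h2 x

/-- A torsion-free group of isometries containing `ℤ^ι` and preserving `(ℤ/4)^ι` is a
Bieberbach group. -/
theorem isBieberbach_of_preservesQuarter {Γ : Subgroup (Iso ι)} (hL : latticeTranslations ι ≤ Γ)
    (hQ : ∀ g ∈ Γ, PreservesQuarter g) (ht : ∀ g ∈ Γ, IsOfFinOrder g → g = 1) :
    IsBieberbach Γ := by
  classical
  refine ⟨⟨?_⟩, ?_, ht⟩
  · rw [discreteTopology_subtype_iff']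
    rintro _ ⟨g, hg, rfl⟩
    let T : Finset (Euc ι) := insert 0 (Finset.univ.image fun i => EuclideanSpace.single i 1)
    have hT : ∀ x ∈ T, ∀ i, ∃ m : ℤ, 4 * x i = m := by
      intro x hx i
      rcases Finset.mem_insert.mp hx with rfl | hx
      · exact ⟨0, by simp⟩
      · obtain ⟨j, -, rfl⟩ := Finset.mem_image.mp hx
        by_cases h : i = j
        · exact ⟨4, by simp [h]⟩
        · exact ⟨0, by simp [h]⟩
    -- An affine map is determined by its values at 0 and at the basis vectors. For group elements
    -- these values have coordinates in (1/4)ℤ, so two elements whose values there differ by less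
    -- than 1/4 in each coordinate are equal.
    refine ⟨⋂ x ∈ T, {f | ∀ i, |f x i - g x i| < 1 / 4}, ?_, ?_⟩
    · refine T.finite_toSet.isOpen_biInter fun x _ => ?_
      rw [Set.ofPred_forall]
      refine isOpen_iInter_of_finite fun i => isOpen_lt ?_ continuous_const
      exact (((EuclideanSpace.proj (𝕜 := ℝ) i).continuous.comp (continuous_apply x)).sub
        continuous_const).abs
    · ext f
      simp only [Set.mem_inter_iff, Set.mem_iInter, Set.mem_ofPred_eq, Set.mem_image,
        Set.mem_singleton_iff]
      constructor
      · rintro ⟨h1, h, hh, rfl⟩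
        have key : ∀ x ∈ T, h x = g x := by
          intro x hx
          ext i
          obtain ⟨m, hm⟩ := hQ h hh x (hT x hx) i
          obtain ⟨k, hk⟩ := hQ g hg x (hT x hx) i
          have h2 := h1 x hx i
          have h3 : |((m - k : ℤ) : ℝ)| < 1 := by
            push_cast
            rw [← hm, ← hk, ← mul_sub, abs_mul]
            norm_num
            linarith
          have h4 : m - k = 0 := by
            rw [← Int.cast_abs] at h3
            exact Int.abs_lt_one_iff.mp (by exact_mod_cast h3)
          have : m = k := by omega
          subst this
          linarith
        rw [iso_eq_of_basis (key 0 (by simp [T])) fun i => key _ (by simp [T])]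
      · rintro rfl
        exact ⟨fun x _ i => by norm_num, g, hg, rfl⟩
  -- The compact unit cube meets every orbit, since the lattice lies in the group.
  · have hK : IsCompact (WithLp.toLp 2 '' (Set.univ.pi fun _ : ι => Set.Icc (0 : ℝ) 1)) :=
      (isCompact_univ_pi fun _ => isCompact_Icc).image (PiLp.continuous_toLp 2 _)
    have hmk : Continuous (Quotient.mk (orbitSetoid Γ)) := continuous_quot_mk
    refine ⟨(hK.image hmk).of_isClosed_subset isClosed_univ ?_⟩
    rintro q -
    induction q using Quotient.inductionOn with | h x => ?_
    refine ⟨latticeShift (fun i => -⌊x i⌋) x, ⟨fun i => Int.fract (x i), ?_, ?_⟩, ?_⟩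
    · exact fun i _ => ⟨Int.fract_nonneg _, (Int.fract_lt_one _).le⟩
    · ext i
      rw [latticeShift_apply]
      simp [Int.fract, sub_eq_add_neg]
    · exact Quotient.sound ((orbitSetoid Γ).symm ⟨_, hL (latticeShift_mem _), rfl⟩)

end Criterion

/-! ### Products with a torus. -/

section Product

variable {ι κ : Type} [Fintype ι] [Fintype κ]

/-- The isometry `(x, y) ↦ (γ x, δ y)`. -/
def prodIso (γ : Iso ι) (δ : Iso κ) : Iso (ι ⊕ κ) :=
  -- By the Mazur-Ulam theorem a bijective isometry is affine, so only distances have to be checked.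
  IsometryEquiv.toRealAffineIsometryEquiv
    { toFun := fun z => WithLp.toLp 2 (Sum.elim (γ (WithLp.toLp 2 fun i => z (.inl i)))
        (δ (WithLp.toLp 2 fun i => z (.inr i))))
      invFun := fun z => WithLp.toLp 2 (Sum.elim (γ.symm (WithLp.toLp 2 fun i => z (.inl i)))
        (δ.symm (WithLp.toLp 2 fun i => z (.inr i))))
      left_inv := fun z => by
        ext i
        rcases i with i | i
        · exact congrArg (fun v : Euc ι => v i) (γ.symm_apply_apply _)
        · exact congrArg (fun v : Euc κ => v i) (δ.symm_apply_apply _)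
      right_inv := fun z => by
        ext i
        rcases i with i | i
        · exact congrArg (fun v : Euc ι => v i) (γ.apply_symm_apply _)
        · exact congrArg (fun v : Euc κ => v i) (δ.apply_symm_apply _)
      isometry_toFun := Isometry.of_dist_eq fun z w => by
        have h1 := γ.dist_map (WithLp.toLp 2 fun i => z (.inl i)) (WithLp.toLp 2 fun i => w (.inl i))
        have h2 := δ.dist_map (WithLp.toLp 2 fun i => z (.inr i)) (WithLp.toLp 2 fun i => w (.inr i))
        rw [EuclideanSpace.dist_eq, EuclideanSpace.dist_eq, Real.sqrt_inj (by positivity)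
          (by positivity)] at h1 h2
        rw [EuclideanSpace.dist_eq, EuclideanSpace.dist_eq, Fintype.sum_sum_type,
          Fintype.sum_sum_type]
        simp only [Sum.elim_inl, Sum.elim_inr]
        rw [h1, h2] }

theorem prodIso_apply (γ : Iso ι) (δ : Iso κ) (z : Euc (ι ⊕ κ)) :
    prodIso γ δ z = WithLp.toLp 2 (Sum.elim (γ (WithLp.toLp 2 fun i => z (.inl i)))
        (δ (WithLp.toLp 2 fun i => z (.inr i)))) := rfl

@[simp] theorem prodIso_inl (γ : Iso ι) (δ : Iso κ) (z : Euc (ι ⊕ κ)) (i : ι) :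
    prodIso γ δ z (.inl i) = γ (WithLp.toLp 2 fun i => z (.inl i)) i := rfl

@[simp] theorem prodIso_inr (γ : Iso ι) (δ : Iso κ) (z : Euc (ι ⊕ κ)) (i : κ) :
    prodIso γ δ z (.inr i) = δ (WithLp.toLp 2 fun i => z (.inr i)) i := rfl

/-- The embedding `γ ↦ (γ, 1)`. -/
def prodLeft : Iso ι →* Iso (ι ⊕ κ) where
  toFun γ := prodIso γ 1
  map_one' := iso_ext fun x i => by rcases i with i | i <;> rfl
  map_mul' γ γ' := iso_ext fun x i => by rcases i with i | i <;> rfl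

theorem prodLeft_inl (γ : Iso ι) (z : Euc (ι ⊕ κ)) (i : ι) :
    prodLeft γ z (.inl i) = γ (WithLp.toLp 2 fun i => z (.inl i)) i := rfl

theorem prodLeft_inr (γ : Iso ι) (z : Euc (ι ⊕ κ)) (i : κ) :
    prodLeft γ z (.inr i) = z (.inr i) := rfl

theorem mem_prodGroup {Γ : Subgroup (Iso ι)} {Δ : Subgroup (Iso κ)} {g : Iso (ι ⊕ κ)} :
    g ∈ prodGroup Γ Δ ↔ ∃ γ ∈ Γ, ∃ δ ∈ Δ, g = prodIso γ δ := by
  constructor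
  · rintro ⟨γ, hγ, δ, hδ, h⟩
    refine ⟨γ, hγ, δ, hδ, iso_ext fun z i => ?_⟩
    have := h (WithLp.toLp 2 fun i => z (.inl i)) (WithLp.toLp 2 fun i => z (.inr i))
    have hz : z = WithLp.toLp 2 (Sum.elim (fun i => z (.inl i)) fun i => z (.inr i)) := by
      ext j
      rcases j with j | j <;> rfl
    rw [prodIso_apply, ← this, ← hz]
  · rintro ⟨γ, hγ, δ, hδ, rfl⟩
    exact ⟨γ, hγ, δ, hδ, fun x y => rfl⟩

theorem prodIso_pow (γ : Iso ι) (δ : Iso κ) (n : ℕ) :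
    prodIso γ δ ^ n = prodIso (γ ^ n) (δ ^ n) := by
  induction n with
  | zero => exact iso_ext fun x i => by rcases i with i | i <;> rfl
  | succ n ih =>
    rw [pow_succ, ih, pow_succ, pow_succ]
    exact iso_ext fun x i => by rcases i with i | i <;> rfl

theorem prodIso_eq_one {γ : Iso ι} {δ : Iso κ} (h : prodIso γ δ = 1) : γ = 1 ∧ δ = 1 := by
  constructor
  · refine iso_ext fun x i => ?_
    have := prodIso_inl γ δ (WithLp.toLp 2 (Sum.elim x 0)) i
    rw [h] at this
    exact this.symm
  · refine iso_ext fun x i => ?_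
    have := prodIso_inr γ δ (WithLp.toLp 2 (Sum.elim 0 x)) i
    rw [h] at this
    exact this.symm

theorem latticeTranslations_le_prodGroup {Γ : Subgroup (Iso ι)}
    (hL : latticeTranslations ι ≤ Γ) :
    latticeTranslations (ι ⊕ κ) ≤ prodGroup Γ (latticeTranslations κ) := by
  rintro g ⟨m, hm⟩
  refine mem_prodGroup.mpr ⟨_, hL (latticeShift_mem fun i => m (.inl i)), _,
    latticeShift_mem fun i => m (.inr i), iso_ext fun x i => ?_⟩
  rw [hm]
  rcases i with i | i <;> simp

theorem isBieberbach_prodGroup {Γ : Subgroup (Iso ι)} (hL : latticeTranslations ι ≤ Γ)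
    (hQ : ∀ g ∈ Γ, PreservesQuarter g) (ht : ∀ g ∈ Γ, IsOfFinOrder g → g = 1) :
    IsBieberbach (prodGroup Γ (latticeTranslations κ)) := by
  refine isBieberbach_of_preservesQuarter (latticeTranslations_le_prodGroup hL) ?_ ?_
  · intro g hg x hx i
    obtain ⟨γ, hγ, δ, hδ, rfl⟩ := mem_prodGroup.mp hg
    rcases i with i | i
    · exact hQ γ hγ _ (fun i => hx (.inl i)) i
    · exact preservesQuarter_of_mem_lattice hδ _ (fun i => hx (.inr i)) i
  · intro g hg hf
    obtain ⟨γ, hγ, δ, hδ, rfl⟩ := mem_prodGroup.mp hg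
    obtain ⟨n, hn, h1⟩ := isOfFinOrder_iff_pow_eq_one.mp hf
    rw [prodIso_pow] at h1
    obtain ⟨h2, h3⟩ := prodIso_eq_one h1
    rw [ht γ hγ (isOfFinOrder_iff_pow_eq_one.mpr ⟨n, hn, h2⟩),
      lattice_torsionFree hδ (isOfFinOrder_iff_pow_eq_one.mpr ⟨n, hn, h3⟩)]
    exact map_one prodLeft

/-- The product with the torus group has again the shape "closure of a set of isometries, joined
with the full lattice". Everything proved for groups of that shape therefore covers both M_Γ and M_Γ
× T^k. -/
theorem prodGroup_closure_sup (s : Set (Iso ι)) :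
    prodGroup (Subgroup.closure s ⊔ latticeTranslations ι) (latticeTranslations κ) =
      Subgroup.closure (prodLeft '' s) ⊔ latticeTranslations (ι ⊕ κ) := by
  apply le_antisymm
  · intro g hg
    obtain ⟨γ, hγ, δ, hδ, rfl⟩ := mem_prodGroup.mp hg
    have h1 : prodIso γ δ = prodLeft γ * prodIso 1 δ :=
      iso_ext fun x i => by rcases i with i | i <;> rfl
    have h2 : prodIso (1 : Iso ι) δ ∈ latticeTranslations (ι ⊕ κ) := by
      obtain ⟨m, hm⟩ := hδ
      refine ⟨Sum.elim 0 m, fun x i => ?_⟩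
      rcases i with i | i
      · simp
      · simp [hm]
    have h3 : (Subgroup.closure s ⊔ latticeTranslations ι).map (prodLeft (κ := κ)) ≤
        Subgroup.closure (prodLeft '' s) ⊔ latticeTranslations (ι ⊕ κ) := by
      rw [Subgroup.map_sup, MonoidHom.map_closure]
      refine sup_le_sup le_rfl ?_
      rintro _ ⟨l, ⟨m, hm⟩, rfl⟩
      refine ⟨Sum.elim m 0, fun x i => ?_⟩
      rcases i with i | i
      · simp [prodLeft_inl, hm]
      · simp [prodLeft_inr]
    rw [h1]
    exact mul_mem (h3 ⟨γ, hγ, rfl⟩) ((le_sup_right : latticeTranslations (ι ⊕ κ) ≤ _) h2)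
  · refine sup_le ?_ (latticeTranslations_le_prodGroup le_sup_right)
    rw [Subgroup.closure_le]
    rintro _ ⟨γ, hγ, rfl⟩
    exact mem_prodGroup.mpr ⟨γ, (le_sup_left : Subgroup.closure s ≤ _)
      (Subgroup.subset_closure hγ), 1, one_mem _, rfl⟩

end Product

/-! ### Weighted averages along a direction. -/

section DirectionalAverage

open MeasureTheory intervalIntegral

variable {E F : Type} [NormedAddCommGroup E] [NormedSpace ℝ E]
  [NormedAddCommGroup F] [NormedSpace ℝ F]

/-- The weighted average of `f` along the segments in the direction `v`. -/
def dirAvg (φ : ℝ → ℝ) (v : E) (f : E → F) (x : E) : F :=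
  ∫ s in (0 : ℝ)..1, φ s • f (x + s • v)

theorem continuous_dirAvg_integrand {φ : ℝ → ℝ} (hφ : Continuous φ) (v : E) {f : E → F}
    (hf : Continuous f) (x : E) : Continuous fun s : ℝ => φ s • f (x + s • v) := by fun_prop

theorem dirAvg_clm [CompleteSpace F] {G : Type} [NormedAddCommGroup G] [NormedSpace ℝ G]
    [CompleteSpace G] (T : F →L[ℝ] G) {φ : ℝ → ℝ} (hφ : Continuous φ) (v : E) {f : E → F}
    (hf : Continuous f) (x : E) : dirAvg φ v (fun y => T (f y)) x = T (dirAvg φ v f x) := by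
  have h := T.intervalIntegral_comp_comm
    ((continuous_dirAvg_integrand hφ v hf x).intervalIntegrable (μ := volume) 0 1)
  simpa only [map_smul, dirAvg] using h

theorem dirAvg_translate {φ : ℝ → ℝ} (v u : E) {f : E → F} (h : ∀ x, f (x + u) = f x) (x : E) :
    dirAvg φ v f (x + u) = dirAvg φ v f x := by
  simp only [dirAvg, add_right_comm x u, h]

/-- Moving the base point along `v` only shifts the window of integration over one full period. -/
theorem dirAvg_one_translate {v : E} {f : E → F} (h : ∀ x, f (x + v) = f x) (t : ℝ) (x : E) :
    dirAvg 1 v f (x + t • v) = dirAvg 1 v f x := by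
  have hper : Function.Periodic (fun s : ℝ => f (x + s • v)) 1 := fun s => by
    simp only [add_smul, one_smul, ← add_assoc, h]
  have h1 := hper.intervalIntegral_add_eq t 0
  have h2 : ∀ s : ℝ, f (x + t • v + s • v) = f (x + (s + t) • v) := fun s => by
    rw [add_smul, add_assoc, add_comm (t • v)]
  simp only [dirAvg, Pi.one_apply, one_smul, h2]
  rw [integral_comp_add_right fun s => f (x + s • v)]
  simpa [add_comm] using h1

/-- Integration by parts along the segments in the direction `v`. -/
theorem dirAvg_fderiv [CompleteSpace F] (v : E) {f : E → F} (hf : ContDiff ℝ (⊤ : ℕ∞) f) (x : E) :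
    dirAvg (fun s => 1 - s) v (fun y => fderiv ℝ f y v) x = dirAvg 1 v f x - f x := by
  have hd : ∀ s : ℝ, HasDerivAt (fun s : ℝ => f (x + s • v)) (fderiv ℝ f (x + s • v) v) s := by
    intro s
    have h1 : HasFDerivAt f (fderiv ℝ f (x + s • v)) (x + s • v) :=
      (hf.differentiable (by simp) _).hasFDerivAt
    have h2 : HasDerivAt (fun s : ℝ => x + s • v) v s := by
      simpa using ((hasDerivAt_id s).smul_const v).const_add x
    exact h1.comp_hasDerivAt s h2
  have hw : ∀ s : ℝ, HasDerivAt (fun s : ℝ => 1 - s) (-1) s := fun s => by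
    simpa using (hasDerivAt_id s).const_sub 1
  have hc : Continuous fun s : ℝ => fderiv ℝ f (x + s • v) v := by
    have := hf.continuous_fderiv (by simp)
    fun_prop
  have hc0 : Continuous fun s : ℝ => f (x + s • v) := by
    have := hf.continuous
    fun_prop
  -- The weight `1 - s` vanishes at 1 and equals 1 at 0, so the boundary term is `-f x`.
  have h := integral_smul_deriv_eq_deriv_smul (a := 0) (b := 1) (fun s _ => hw s)
    (fun s _ => hd s) intervalIntegrable_const (hc.intervalIntegrable _ _)
  rw [dirAvg, h]
  simp only [dirAvg, neg_smul, one_smul, Pi.one_apply, intervalIntegral.integral_neg]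
  simp
  abel

variable [FiniteDimensional ℝ E]

theorem hasFDerivAt_dirAvg {φ : ℝ → ℝ} (hφ : Continuous φ) (v : E) {f : E → F}
    (hf : ContDiff ℝ 1 f) (x : E) :
    HasFDerivAt (dirAvg φ v f) (dirAvg φ v (fderiv ℝ f) x) x := by
  have hf' : Continuous (fderiv ℝ f) := hf.continuous_fderiv (by simp)
  -- Compactness of ball times interval gives the uniform bound needed to differentiate under the
  -- integral.
  have hK : IsCompact (Metric.closedBall x 1 ×ˢ Set.Icc (0 : ℝ) 1) :=
    (isCompact_closedBall x 1).prod isCompact_Icc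
  obtain ⟨C, hC⟩ := hK.exists_bound_of_continuousOn
    (f := fun q : E × ℝ => φ q.2 • fderiv ℝ f (q.1 + q.2 • v)) (by fun_prop)
  refine hasFDerivAt_integral_of_dominated_of_fderiv_le (bound := fun _ => C)
    (F' := fun y s => φ s • fderiv ℝ f (y + s • v))
    (Metric.closedBall_mem_nhds x one_pos) ?_ ?_ ?_ ?_ ?_ ?_
  · exact .of_forall fun y =>
      (continuous_dirAvg_integrand hφ v hf.continuous y).aestronglyMeasurable
  · exact (continuous_dirAvg_integrand hφ v hf.continuous x).intervalIntegrable _ _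
  · exact (continuous_dirAvg_integrand hφ v hf' x).aestronglyMeasurable
  · refine .of_forall fun s hs y hy => hC (y, s) ⟨hy, ?_⟩
    rw [Set.uIoc_of_le zero_le_one] at hs
    exact ⟨hs.1.le, hs.2⟩
  · exact intervalIntegrable_const
  · refine .of_forall fun s _ y _ => ?_
    have h1 : HasFDerivAt f (fderiv ℝ f (y + s • v)) (y + s • v) :=
      (hf.differentiable (by simp) _).hasFDerivAt
    exact ((hasFDerivAt_comp_add_right (s • v)).mpr h1).const_smul (φ s)

/-- Differentiation commutes with averaging, so the induction passes from `f` to its derivative. The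
target changes to a space of linear maps, which is why `F` is quantified inside. -/
theorem contDiff_nat_dirAvg {φ : ℝ → ℝ} (hφ : Continuous φ) (v : E) (n : ℕ) :
    ∀ {F : Type} [NormedAddCommGroup F] [NormedSpace ℝ F] {f : E → F},
      ContDiff ℝ (⊤ : ℕ∞) f → ContDiff ℝ n (dirAvg φ v f) := by
  induction n with
  | zero =>
    intro F _ _ f hf
    have h : Differentiable ℝ (dirAvg φ v f) := fun x =>
      (hasFDerivAt_dirAvg hφ v (hf.of_le (by exact_mod_cast le_top)) x).differentiableAt
    exact contDiff_zero.mpr h.continuous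
  | succ n ih =>
    intro F _ _ f hf
    have h := hasFDerivAt_dirAvg hφ v (hf.of_le (m := 1) (by exact_mod_cast le_top))
    have h' : fderiv ℝ (dirAvg φ v f) = dirAvg φ v (fderiv ℝ f) := funext fun x => (h x).fderiv
    push_cast
    refine contDiff_succ_iff_fderiv.mpr ⟨fun x => (h x).differentiableAt, by simp, ?_⟩
    rw [h']
    exact ih (hf.fderiv_right (by simp))

theorem contDiff_dirAvg {φ : ℝ → ℝ} (hφ : Continuous φ) (v : E) {f : E → F}
    (hf : ContDiff ℝ (⊤ : ℕ∞) f) : ContDiff ℝ (⊤ : ℕ∞) (dirAvg φ v f) :=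
  contDiff_infty.mpr fun n => contDiff_nat_dirAvg hφ v n hf

end DirectionalAverage

/-! ### Cartan's formula and the homotopy between a closed form and its average. -/

section ExteriorDerivative

variable {E F : Type} [NormedAddCommGroup E] [NormedSpace ℝ E]
  [NormedAddCommGroup F] [NormedSpace ℝ F] {p : ℕ}

/-- Contraction with a vector, as a continuous linear map. -/
def contract (v : E) : (E [⋀^Fin (p + 1)]→L[ℝ] F) →L[ℝ] E [⋀^Fin p]→L[ℝ] F :=
  (ContinuousLinearMap.apply ℝ _ v).comp
    ContinuousAlternatingMap.curryLeftLI.toContinuousLinearMap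

theorem extDeriv_eq_clm (ω : E → E [⋀^Fin p]→L[ℝ] F) (x : E) :
    extDeriv ω x = ContinuousAlternatingMap.alternatizeUncurryFinCLM ℝ E F (fderiv ℝ ω x) := rfl

theorem extDeriv_const (c : E [⋀^Fin p]→L[ℝ] F) : extDeriv (fun _ : E => c) = 0 := by
  funext x
  rw [extDeriv_eq_clm, fderiv_fun_const, Pi.zero_apply, map_zero, Pi.zero_apply]

theorem hasFDerivAt_clm_comp {G H : Type} [NormedAddCommGroup G] [NormedSpace ℝ G]
    [NormedAddCommGroup H] [NormedSpace ℝ H] (T : G →L[ℝ] H) {f : E → G} {f' : E →L[ℝ] G} {x : E}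
    (h : HasFDerivAt f f' x) : HasFDerivAt (fun y => T (f y)) (T.comp f') x :=
  T.hasFDerivAt.comp x h

theorem fderiv_clm_comp {G H : Type} [NormedAddCommGroup G] [NormedSpace ℝ G]
    [NormedAddCommGroup H] [NormedSpace ℝ H] (T : G →L[ℝ] H) {f : E → G} {x : E}
    (h : DifferentiableAt ℝ f x) (v : E) :
    fderiv ℝ (fun y => T (f y)) x v = T (fderiv ℝ f x v) := by
  rw [(hasFDerivAt_clm_comp T h.hasFDerivAt).fderiv]
  rfl

/-- Contraction of an exterior derivative: expansion along the first argument. -/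
theorem curryLeft_alternatizeUncurryFin (D : E →L[ℝ] E [⋀^Fin (p + 1)]→L[ℝ] F) (v : E) :
    (ContinuousAlternatingMap.alternatizeUncurryFin D).curryLeft v =
      D v - ContinuousAlternatingMap.alternatizeUncurryFin ((contract v).comp D) := by
  ext w
  rw [ContinuousAlternatingMap.curryLeft_apply_apply,
    ContinuousAlternatingMap.alternatizeUncurryFin_apply, Fin.sum_univ_succ,
    ContinuousAlternatingMap.sub_apply, ContinuousAlternatingMap.alternatizeUncurryFin_apply,
    sub_eq_add_neg, ← Finset.sum_neg_distrib]
  congr 1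
  · simp [Fin.removeNth_zero]
  · refine Finset.sum_congr rfl fun i _ => ?_
    simp only [Fin.val_succ, pow_succ, mul_neg, mul_one, neg_smul, Matrix.cons_val_succ]
    have h : i.succ.removeNth (Matrix.vecCons v w) = Matrix.vecCons v (i.removeNth w) := by
      funext k
      cases k using Fin.cases <;> simp [Fin.removeNth]
    rw [h]
    rfl

/-- Cartan's formula for the constant field `v`, for which the Lie derivative is the directional
derivative. -/
theorem extDeriv_contract {ω : E → E [⋀^Fin (p + 1)]→L[ℝ] F} {x : E}
    (h : DifferentiableAt ℝ ω x) (v : E) :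
    extDeriv (fun y => contract v (ω y)) x =
      fderiv ℝ ω x v - (extDeriv ω x).curryLeft v := by
  have h1 : fderiv ℝ (fun y => contract v (ω y)) x = (contract v).comp (fderiv ℝ ω x) :=
    ContinuousLinearMap.ext fun u => fderiv_clm_comp (contract v) h u
  rw [extDeriv, h1, extDeriv, curryLeft_alternatizeUncurryFin, sub_sub_cancel]

/-- The exterior derivative is a fixed linear map applied to the full derivative, and both
operations commute with the integral. -/
theorem extDeriv_dirAvg [FiniteDimensional ℝ E] [CompleteSpace F] {φ : ℝ → ℝ} (hφ : Continuous φ)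
    (v : E) {ω : E → E [⋀^Fin p]→L[ℝ] F} (hω : ContDiff ℝ (⊤ : ℕ∞) ω) (x : E) :
    extDeriv (dirAvg φ v ω) x = dirAvg φ v (extDeriv ω) x := by
  rw [extDeriv_eq_clm, (hasFDerivAt_dirAvg hφ v (hω.of_le (by exact_mod_cast le_top)) x).fderiv,
    ← dirAvg_clm _ hφ v (hω.continuous_fderiv (by simp))]
  rfl

/-- A closed form differs from its average in a direction by an exact form. -/
theorem closed_eq_dirAvg_add_extDeriv [FiniteDimensional ℝ E] [CompleteSpace F] (v : E)
    {ω : E → E [⋀^Fin (p + 1)]→L[ℝ] F} (hω : ContDiff ℝ (⊤ : ℕ∞) ω) (hc : extDeriv ω = 0) :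
    ω = dirAvg 1 v ω + extDeriv (dirAvg (fun s => s - 1) v fun y => contract v (ω y)) := by
  funext x
  have h1 : ContDiff ℝ (⊤ : ℕ∞) fun y => contract v (ω y) := (contract (F := F) (p := p) v).contDiff.comp hω
  have h2 : extDeriv (fun y => contract v (ω y)) = fun y => fderiv ℝ ω y v := funext fun y => by
    -- For closed `ω` the contraction with `v` has exterior derivative ∂_v ω. Averaging it with
    -- weight `s - 1` gives `ω - dirAvg 1 v ω`, by the integration by parts above.
    rw [extDeriv_contract (hω.differentiable (by simp) y), hc]
    exact sub_zero _
  have h3 := dirAvg_fderiv v hω x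
  have h4 : dirAvg (fun s => s - 1) v (fun y => fderiv ℝ ω y v) x =
      -dirAvg (fun s => 1 - s) v (fun y => fderiv ℝ ω y v) x := by
    simp only [dirAvg, ← intervalIntegral.integral_neg, ← neg_smul, neg_sub]
  rw [Pi.add_apply, extDeriv_dirAvg (by fun_prop) v h1, h2, h4, h3]
  abel

end ExteriorDerivative

/-! ### Closed and exact forms on the torus. -/

section Periodic

variable {ι : Type} [Fintype ι]

/-- Invariance under the translations by `ℤ^ι`. -/
def IsPeriodic {F : Type} (f : Euc ι → F) : Prop := ∀ (m : ι → ℤ) x, f (latticeShift m x) = f x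

theorem latticeShift_eq_add (m : ι → ℤ) (x : Euc ι) :
    latticeShift m x = x + WithLp.toLp 2 fun i => (m i : ℝ) := by
  ext i
  simp

theorem IsPeriodic.add_single [DecidableEq ι] {F : Type} {f : Euc ι → F} (h : IsPeriodic f)
    (i : ι) (x : Euc ι) : f (x + EuclideanSpace.single i 1) = f x := by
  rw [← h (Pi.single i 1) x, latticeShift_eq_add]
  congr 2
  ext j
  by_cases hj : j = i
  · subst hj; simp
  · simp [hj]

theorem eq_of_translation_invariant [DecidableEq ι] {F : Type} {f : Euc ι → F}
    (h : ∀ i (t : ℝ) x, f (x + t • EuclideanSpace.single i 1) = f x) (x y : Euc ι) :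
    f x = f y := by
  have key : ∀ (s : Finset ι) (c : ι → ℝ) z,
      f (z + ∑ i ∈ s, c i • EuclideanSpace.single i (1 : ℝ)) = f z := by
    intro s c
    induction s using Finset.induction_on with
    | empty => intro z; simp
    | insert i s hi ih =>
      intro z
      rw [Finset.sum_insert hi, ← add_assoc, ih, h]
  have hx : ∀ z : Euc ι, f z = f 0 := by
    intro z
    have h1 : z = 0 + ∑ i, z i • EuclideanSpace.single i (1 : ℝ) := by
      have := (EuclideanSpace.basisFun ι ℝ).sum_repr z
      simpa using this.symm
    rw [h1, key]
  rw [hx x, hx y]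

theorem isPeriodic_dirAvg {F : Type} [NormedAddCommGroup F] [NormedSpace ℝ F] {φ : ℝ → ℝ}
    (v : Euc ι) {f : Euc ι → F} (h : IsPeriodic f) : IsPeriodic (dirAvg φ v f) := by
  intro m x
  rw [latticeShift_eq_add]
  exact dirAvg_translate v _ (fun y => by rw [← latticeShift_eq_add, h]) x

variable {F : Type} [NormedAddCommGroup F] [NormedSpace ℝ F] {p : ℕ}

theorem extDeriv_add_of_contDiff {E : Type} [NormedAddCommGroup E] [NormedSpace ℝ E]
    {ω η : E → E [⋀^Fin p]→L[ℝ] F}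
    (h : ContDiff ℝ (⊤ : ℕ∞) ω) (h' : ContDiff ℝ (⊤ : ℕ∞) η) :
    extDeriv (ω + η) = extDeriv ω + extDeriv η :=
  funext fun x => extDeriv_add (h.differentiable (by simp) x) (h'.differentiable (by simp) x)

/-- On a torus, every closed form of positive degree is the sum of a constant form and an
exact form. -/
theorem closed_eq_const_add_exact [CompleteSpace F]
    {ω : Euc ι → Euc ι [⋀^Fin (p + 1)]→L[ℝ] F}
    (hω : ContDiff ℝ (⊤ : ℕ∞) ω) (hp : IsPeriodic ω) (hc : extDeriv ω = 0) :
    ∃ (c : Euc ι [⋀^Fin (p + 1)]→L[ℝ] F) (η : Euc ι → Euc ι [⋀^Fin p]→L[ℝ] F),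
      ContDiff ℝ (⊤ : ℕ∞) η ∧ IsPeriodic η ∧ ω = (fun _ => c) + extDeriv η := by
  classical
  -- The coordinate directions are treated one at a time: averaging along a new one preserves
  -- periodicity, closedness and the invariance already obtained, and changes the form by an exact
  -- form with periodic primitive. Invariance in all directions means a constant form.
  have key : ∀ s : Finset ι, ∃ (ω' : Euc ι → Euc ι [⋀^Fin (p + 1)]→L[ℝ] F)
      (η : Euc ι → Euc ι [⋀^Fin p]→L[ℝ] F), ContDiff ℝ (⊤ : ℕ∞) ω' ∧ IsPeriodic ω' ∧
      extDeriv ω' = 0 ∧ (∀ i ∈ s, ∀ (t : ℝ) x, ω' (x + t • EuclideanSpace.single i 1) = ω' x) ∧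
      ContDiff ℝ (⊤ : ℕ∞) η ∧ IsPeriodic η ∧ ω = ω' + extDeriv η := by
    intro s
    induction s using Finset.induction_on with
    | empty =>
      refine ⟨ω, fun _ => 0, hω, hp, hc, by simp, contDiff_const, fun _ _ => rfl, ?_⟩
      rw [extDeriv_const, add_zero]
    | insert i s hi ih =>
      obtain ⟨ω', η, h1, h2, h3, h4, h5, h6, h7⟩ := ih
      set v : Euc ι := EuclideanSpace.single i 1 with hv
      have h8 : ContDiff ℝ (⊤ : ℕ∞) fun y => contract v (ω' y) :=
        (contract (F := F) (p := p) v).contDiff.comp h1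
      have h9 := contDiff_dirAvg (φ := fun s => s - 1) (by fun_prop) v h8
      have h10 := contDiff_dirAvg (φ := 1) continuous_one v h1
      have h11 := closed_eq_dirAvg_add_extDeriv v h1 h3
      refine ⟨dirAvg 1 v ω', dirAvg (fun s => s - 1) v (fun y => contract v (ω' y)) + η,
        h10, isPeriodic_dirAvg v h2, ?_, ?_, h9.add h5, ?_, ?_⟩
      · funext x
        rw [extDeriv_dirAvg continuous_one v h1, h3]
        simp [dirAvg]
      · intro j hj t x
        rcases Finset.mem_insert.mp hj with rfl | hj
        · exact dirAvg_one_translate (h2.add_single j) t x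
        · exact dirAvg_translate v _ (h4 j hj t) x
      · have h12 : IsPeriodic fun y => contract v (ω' y) := fun m x => congrArg (contract v) (h2 m x)
        intro m x
        rw [Pi.add_apply, Pi.add_apply, isPeriodic_dirAvg v h12, h6]
      · rw [extDeriv_add_of_contDiff h9 h5, ← add_assoc, ← h11, ← h7]
  obtain ⟨ω', η, -, -, -, h4, h5, h6, h7⟩ := key Finset.univ
  refine ⟨ω' 0, η, h5, h6, ?_⟩
  rw [h7]
  congr 1
  exact funext fun x => eq_of_translation_invariant (fun i => h4 i (Finset.mem_univ i)) x 0

/-- On a torus, a constant form which is exact vanishes. -/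
theorem const_eq_zero_of_exact [CompleteSpace F] {c : Euc ι [⋀^Fin (p + 1)]→L[ℝ] F}
    {η : Euc ι → Euc ι [⋀^Fin p]→L[ℝ] F} (hη : ContDiff ℝ (⊤ : ℕ∞) η) (hp : IsPeriodic η)
    (h : extDeriv η = fun _ => c) : c = 0 := by
  classical
  -- Averaging the primitive along every direction does not change its derivative `c`, as `c` is
  -- constant. In the end the primitive is itself constant, so its derivative is 0.
  have key : ∀ s : Finset ι, ∃ η : Euc ι → Euc ι [⋀^Fin p]→L[ℝ] F, ContDiff ℝ (⊤ : ℕ∞) η ∧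
      IsPeriodic η ∧ (∀ i ∈ s, ∀ (t : ℝ) x, η (x + t • EuclideanSpace.single i 1) = η x) ∧
      extDeriv η = fun _ => c := by
    intro s
    induction s using Finset.induction_on with
    | empty => exact ⟨η, hη, hp, by simp, h⟩
    | insert i s hi ih =>
      obtain ⟨η, h1, h2, h3, h4⟩ := ih
      set v : Euc ι := EuclideanSpace.single i 1 with hv
      refine ⟨dirAvg 1 v η, contDiff_dirAvg continuous_one v h1, isPeriodic_dirAvg v h2, ?_, ?_⟩
      · intro j hj t x
        rcases Finset.mem_insert.mp hj with rfl | hj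
        · exact dirAvg_one_translate (h2.add_single j) t x
        · exact dirAvg_translate v _ (h3 j hj t) x
      · funext x
        rw [extDeriv_dirAvg continuous_one v h1, h4]
        simp [dirAvg]
  obtain ⟨η, -, -, h3, h4⟩ := key Finset.univ
  have h5 : η = fun _ => η 0 :=
    funext fun x => eq_of_translation_invariant (fun i => h3 i (Finset.mem_univ i)) x 0
  rw [h5, extDeriv_const] at h4
  exact (congrFun h4 0).symm

theorem closed_zeroForm_eq_const {ω : Euc ι → Euc ι [⋀^Fin 0]→L[ℝ] F}
    (hω : ContDiff ℝ (⊤ : ℕ∞) ω) (hc : extDeriv ω = 0) : ω = fun _ => ω 0 := by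
  refine funext fun x => is_const_of_fderiv_eq_zero (𝕜 := ℝ) (hω.differentiable (by simp)) ?_ x 0
  intro y
  ext v w
  have h := congrFun hc y
  have h1 : extDeriv ω y (fun _ => v) = 0 := by rw [h]; rfl
  rw [extDeriv, ContinuousAlternatingMap.alternatizeUncurryFin_apply] at h1
  simp only [Fin.sum_univ_succ, Fin.sum_univ_zero, Fin.val_zero, pow_zero, one_smul,
    add_zero] at h1
  rw [Subsingleton.elim w (Fin.removeNth 0 fun _ => v)]
  exact h1

end Periodic

/-! ### Pull-backs and averaging over the holonomy group. -/

section Pullback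

variable {ι : Type} [Fintype ι] {𝕜 : Type} [NormedField 𝕜] [NormedAlgebra ℝ 𝕜] {p : ℕ}

theorem pullback_one (ω : Euc ι → Euc ι [⋀^Fin p]→L[ℝ] 𝕜) : pullback 1 ω = ω := rfl

theorem pullback_mul (g h : Iso ι) (ω : Euc ι → Euc ι [⋀^Fin p]→L[ℝ] 𝕜) :
    pullback (g * h) ω = pullback h (pullback g ω) := rfl

theorem pullback_add (g : Iso ι) (ω η : Euc ι → Euc ι [⋀^Fin p]→L[ℝ] 𝕜) :
    pullback g (ω + η) = pullback g ω + pullback g η := rfl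

theorem pullback_const (g : Iso ι) (c : Euc ι [⋀^Fin p]→L[ℝ] 𝕜) :
    pullback g (fun _ => c) = fun _ => c.compContinuousLinearMap
      (g.linearIsometryEquiv : Euc ι →L[ℝ] Euc ι) := rfl

theorem contDiff_pullback (g : Iso ι) {ω : Euc ι → Euc ι [⋀^Fin p]→L[ℝ] 𝕜}
    (hω : ContDiff ℝ (⊤ : ℕ∞) ω) : ContDiff ℝ (⊤ : ℕ∞) (pullback g ω) :=
  (ContinuousAlternatingMap.compContinuousLinearMapCLM (𝕜 := ℝ) (F := 𝕜) (ι := Fin p)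
    (g.linearIsometryEquiv : Euc ι →L[ℝ] Euc ι)).contDiff.comp
      (hω.comp g.toContinuousAffineEquiv.toContinuousAffineMap.contDiff)

theorem hasFDerivAt_iso (g : Iso ι) (x : Euc ι) :
    HasFDerivAt g (g.linearIsometryEquiv : Euc ι →L[ℝ] Euc ι) x :=
  g.toContinuousAffineEquiv.toContinuousAffineMap.hasFDerivAt

theorem extDeriv_pullback_iso (g : Iso ι) {ω : Euc ι → Euc ι [⋀^Fin p]→L[ℝ] 𝕜}
    (hω : ContDiff ℝ (⊤ : ℕ∞) ω) : extDeriv (pullback g ω) = pullback g (extDeriv ω) := by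
  funext x
  have hg : ContDiff ℝ 2 g := g.toContinuousAffineEquiv.toContinuousAffineMap.contDiff
  have h := extDeriv_pullback (𝕜 := ℝ) (r := 2) (ω := ω) (f := g) (x := x)
    (hω.differentiable (by simp) _) hg.contDiffAt
    (by simp [minSmoothness_of_isRCLikeNormedField])
  have h1 : fderiv ℝ g = fun _ => (g.linearIsometryEquiv : Euc ι →L[ℝ] Euc ι) :=
    funext fun y => (hasFDerivAt_iso g y).fderiv
  rw [h1] at h
  exact h

theorem isPeriodic_of_pullback {ω : Euc ι → Euc ι [⋀^Fin p]→L[ℝ] 𝕜}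
    (h : ∀ g ∈ latticeTranslations ι, pullback g ω = ω) : IsPeriodic ω := fun m x =>
  congrFun (h _ (latticeShift_mem m)) x

theorem IsPeriodic.pullback_eq {ω : Euc ι → Euc ι [⋀^Fin p]→L[ℝ] 𝕜} (h : IsPeriodic ω)
    {g : Iso ι} (hg : g ∈ latticeTranslations ι) : pullback g ω = ω := by
  obtain ⟨m, rfl⟩ := eq_latticeShift_of_mem hg
  exact funext fun x => h m x

end Pullback

section CosetSum

variable {ι : Type} [Fintype ι] {𝕜 : Type} [NormedField 𝕜] [NormedAlgebra ℝ 𝕜] {p : ℕ}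

/-- The lattice `ℤ^ι` as a subgroup of `Γ`. -/
abbrev latticeIn (Γ : Subgroup (Iso ι)) : Subgroup Γ := (latticeTranslations ι).subgroupOf Γ

variable (Γ : Subgroup (Iso ι))

/-- Two representatives of a left coset differ by a lattice element on the right. After inversion
this element is the first to act on the periodic form `ω`, and acts trivially; hence the inverses in
`cosetSum`. -/
theorem pullback_out {ω : Euc ι → Euc ι [⋀^Fin p]→L[ℝ] 𝕜} (hp : IsPeriodic ω) (g : Γ) :
    pullback (((g : Γ ⧸ latticeIn Γ).out : Γ)⁻¹ : Iso ι) ω = pullback (g : Iso ι)⁻¹ ω := by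
  obtain ⟨l, hl⟩ := QuotientGroup.mk_out_eq_mul (latticeIn Γ) g
  have h : (((l : Γ) : Iso ι)⁻¹) ∈ latticeTranslations ι :=
    inv_mem (Subgroup.mem_subgroupOf.mp l.2)
  rw [hl, Subgroup.coe_mul, mul_inv_rev, pullback_mul, hp.pullback_eq h]

variable [Fintype (Γ ⧸ latticeIn Γ)]

/-- The sum of the pull-backs of a form under representatives of the cosets of `ℤ^ι` in `Γ`. -/
def cosetSum (ω : Euc ι → Euc ι [⋀^Fin p]→L[ℝ] 𝕜) : Euc ι → Euc ι [⋀^Fin p]→L[ℝ] 𝕜 :=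
  ∑ q : Γ ⧸ latticeIn Γ, pullback ((q.out : Γ)⁻¹ : Iso ι) ω

theorem contDiff_cosetSum {ω : Euc ι → Euc ι [⋀^Fin p]→L[ℝ] 𝕜}
    (hω : ContDiff ℝ (⊤ : ℕ∞) ω) : ContDiff ℝ (⊤ : ℕ∞) (cosetSum Γ ω) := by
  have h := ContDiff.sum (s := (Finset.univ : Finset (Γ ⧸ latticeIn Γ)))
    fun q _ => contDiff_pullback ((q.out : Γ)⁻¹ : Iso ι) hω
  convert h using 1
  funext x
  rw [cosetSum, Finset.sum_apply]

theorem cosetSum_add (ω η : Euc ι → Euc ι [⋀^Fin p]→L[ℝ] 𝕜) :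
    cosetSum Γ (ω + η) = cosetSum Γ ω + cosetSum Γ η := by
  simp only [cosetSum, pullback_add, Finset.sum_add_distrib]

theorem cosetSum_const (c : Euc ι [⋀^Fin p]→L[ℝ] 𝕜) :
    ∃ c', cosetSum Γ (fun _ => c) = fun _ => c' := by
  refine ⟨cosetSum Γ (fun _ => c) 0, funext fun x => ?_⟩
  simp only [cosetSum, Finset.sum_apply, pullback_const]

theorem extDeriv_sum {α : Type} (s : Finset α) {ω : α → Euc ι → Euc ι [⋀^Fin p]→L[ℝ] 𝕜}
    (hω : ∀ a, ContDiff ℝ (⊤ : ℕ∞) (ω a)) :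
    extDeriv (∑ a ∈ s, ω a) = ∑ a ∈ s, extDeriv (ω a) := by
  classical
  induction s using Finset.induction_on with
  | empty => exact extDeriv_const 0
  | insert a s ha ih =>
    have h : ContDiff ℝ (⊤ : ℕ∞) (∑ b ∈ s, ω b) := by
      have h := ContDiff.sum (s := s) fun b _ => hω b
      convert h using 1
      funext x
      rw [Finset.sum_apply]
    rw [Finset.sum_insert ha, Finset.sum_insert ha, extDeriv_add_of_contDiff (hω a) h, ih]

theorem extDeriv_cosetSum {ω : Euc ι → Euc ι [⋀^Fin p]→L[ℝ] 𝕜} (hω : ContDiff ℝ (⊤ : ℕ∞) ω) :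
    extDeriv (cosetSum Γ ω) = cosetSum Γ (extDeriv ω) := by
  rw [cosetSum, extDeriv_sum _ fun q => contDiff_pullback _ hω]
  simp only [extDeriv_pullback_iso _ hω, cosetSum]

theorem pullback_sum {α : Type} (s : Finset α) (g : Iso ι)
    (ω : α → Euc ι → Euc ι [⋀^Fin p]→L[ℝ] 𝕜) :
    pullback g (∑ a ∈ s, ω a) = ∑ a ∈ s, pullback g (ω a) := by
  classical
  induction s using Finset.induction_on with
  | empty => rfl
  | insert a s ha ih => rw [Finset.sum_insert ha, Finset.sum_insert ha, pullback_add, ih]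

/-- Pulling back by `g` permutes the summands, through left multiplication of the cosets by `g⁻¹`.
-/
theorem pullback_cosetSum {ω : Euc ι → Euc ι [⋀^Fin p]→L[ℝ] 𝕜} (hp : IsPeriodic ω)
    {g : Iso ι} (hg : g ∈ Γ) : pullback g (cosetSum Γ ω) = cosetSum Γ ω := by
  rw [cosetSum, pullback_sum]
  refine Fintype.sum_equiv (MulAction.toPerm (β := Γ ⧸ latticeIn Γ) (⟨g, hg⟩⁻¹ : Γ)) _ _ fun q => ?_
  have hq : MulAction.toPerm (β := Γ ⧸ latticeIn Γ) (⟨g, hg⟩⁻¹ : Γ) q =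
      ((⟨g, hg⟩⁻¹ * q.out : Γ) : Γ ⧸ latticeIn Γ) := by
    conv_lhs => rw [← q.out_eq']
    rfl
  rw [hq, pullback_out Γ hp, ← pullback_mul]
  congr 1

theorem cosetSum_of_invariant {ω : Euc ι → Euc ι [⋀^Fin p]→L[ℝ] 𝕜}
    (h : ∀ g ∈ Γ, pullback g ω = ω) : cosetSum Γ ω = Nat.card (Γ ⧸ latticeIn Γ) • ω := by
  have h1 : ∀ q : Γ ⧸ latticeIn Γ, pullback ((q.out : Γ)⁻¹ : Iso ι) ω = ω := fun q =>
    h _ (inv_mem q.out.2)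
  simp only [cosetSum, h1, Finset.sum_const, Finset.card_univ, Nat.card_eq_fintype_card]

end CosetSum

/-! ### De Rham cohomology as invariant constant forms. -/

section InvariantForms

variable {ι : Type} [Fintype ι] (Γ : Subgroup (Iso ι))

/-- The alternating forms with constant coefficients which are invariant under the linear parts of
the elements of `Γ`. -/
def invForms (𝕜 : Type) [NormedField 𝕜] [NormedAlgebra ℝ 𝕜] (p : ℕ) :
    Submodule 𝕜 (Euc ι [⋀^Fin p]→L[ℝ] 𝕜) where
  carrier := {c | ∀ g ∈ Γ, c.compContinuousLinearMap
    (g.linearIsometryEquiv : Euc ι →L[ℝ] Euc ι) = c}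
  zero_mem' := fun _ _ => rfl
  add_mem' := by
    intro a b ha hb g hg
    conv_rhs => rw [← ha g hg, ← hb g hg]
    rfl
  smul_mem' := by
    intro r a ha g hg
    conv_rhs => rw [← ha g hg]
    rfl

variable {𝕜 : Type} [NormedField 𝕜] [NormedAlgebra ℝ 𝕜] {p : ℕ}

theorem const_mem_smoothForms {c : Euc ι [⋀^Fin p]→L[ℝ] 𝕜} :
    ((fun _ => c : Euc ι → Euc ι [⋀^Fin p]→L[ℝ] 𝕜) : Forms ι 𝕜 p) ∈ smoothForms Γ 𝕜 p ↔
      c ∈ invForms Γ 𝕜 p :=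
  ⟨fun h g hg => congrFun (h.2 g hg) 0, fun h => ⟨contDiff_const, fun g hg => funext fun _ => h g hg⟩⟩

/-- The invariant constant forms as closed forms. -/
def invToClosed : invForms Γ 𝕜 p →ₗ[𝕜] closedForms Γ 𝕜 p where
  toFun c := ⟨fun _ => c.1, (const_mem_smoothForms Γ).mpr c.2, extDeriv_const _⟩
  map_add' _ _ := rfl
  map_smul' _ _ := rfl

/-- The de Rham class of an invariant constant form. -/
def invToDeRham : invForms Γ 𝕜 p →ₗ[𝕜] DeRham Γ 𝕜 p :=
  (((exactForms Γ 𝕜 p).submoduleOf (closedForms Γ 𝕜 p)).mkQ).comp (invToClosed Γ)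

variable {Γ}

theorem isPeriodic_of_mem_smoothForms (hL : latticeTranslations ι ≤ Γ)
    {ω : Euc ι → Euc ι [⋀^Fin p]→L[ℝ] 𝕜} (h : (ω : Forms ι 𝕜 p) ∈ smoothForms Γ 𝕜 p) :
    IsPeriodic ω :=
  isPeriodic_of_pullback fun g hg => h.2 g (hL hg)

/-- An exact form on M_Γ is in particular exact on the covering torus, where a nonzero constant form
is never exact. -/
theorem invToDeRham_injective [CompleteSpace 𝕜] (hL : latticeTranslations ι ≤ Γ) :
    Function.Injective (invToDeRham Γ : invForms Γ 𝕜 p →ₗ[𝕜] DeRham Γ 𝕜 p) := by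
  rw [injective_iff_map_eq_zero]
  intro c hc
  have h : ((fun _ => c.1 : Euc ι → Euc ι [⋀^Fin p]→L[ℝ] 𝕜) : Forms ι 𝕜 p) ∈
      exactForms Γ 𝕜 p :=
    (Submodule.Quotient.mk_eq_zero ((exactForms Γ 𝕜 p).submoduleOf (closedForms Γ 𝕜 p))).mp hc
  ext1
  cases p with
  | zero => exact congrFun ((Submodule.mem_bot (R := 𝕜) (M := Forms ι 𝕜 0)).mp h) 0
  | succ p =>
    obtain ⟨η, hη, h'⟩ := h
    exact const_eq_zero_of_exact hη.1 (isPeriodic_of_mem_smoothForms hL hη) h'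

/-- Every closed form on `M_Γ` of positive degree is the sum of an invariant constant form and
an exact form. -/
theorem exists_eq_invForm_add_exact [CompleteSpace 𝕜] [Fintype (Γ ⧸ latticeIn Γ)]
    (hL : latticeTranslations ι ≤ Γ) {ω : Euc ι → Euc ι [⋀^Fin (p + 1)]→L[ℝ] 𝕜}
    (hs : ContDiff ℝ (⊤ : ℕ∞) ω) (hω : ∀ g ∈ Γ, pullback g ω = ω) (hc : extDeriv ω = 0) :
    ∃ c ∈ invForms Γ 𝕜 (p + 1), ∃ η : Euc ι → Euc ι [⋀^Fin p]→L[ℝ] 𝕜,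
      ContDiff ℝ (⊤ : ℕ∞) η ∧ (∀ g ∈ Γ, pullback g η = η) ∧ ω = (fun _ => c) + extDeriv η := by
  obtain ⟨c, η, h1, h2, h3⟩ :=
    closed_eq_const_add_exact hs (isPeriodic_of_pullback fun g hg => hω g (hL hg)) hc
  set N := Nat.card (Γ ⧸ latticeIn Γ) with hN
  have hN0 : (N : ℝ) ≠ 0 := by exact_mod_cast Nat.card_pos.ne'
  obtain ⟨c', hc'⟩ := cosetSum_const Γ c
  -- The torus decomposition of `ω` need not be invariant; summing it over the `N` cosets makes the
  -- primitive invariant and multiplies `ω` by `N`.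
  have h4 : N • ω = (fun _ => c') + extDeriv (cosetSum Γ η) := by
    rw [hN, ← cosetSum_of_invariant Γ hω, h3, cosetSum_add, hc', extDeriv_cosetSum Γ h1]
  have hη : ContDiff ℝ (⊤ : ℕ∞) ((N : ℝ)⁻¹ • cosetSum Γ η) :=
    contDiff_const.smul (contDiff_cosetSum Γ h1)
  have hη' : ∀ g ∈ Γ, pullback g ((N : ℝ)⁻¹ • cosetSum Γ η) = (N : ℝ)⁻¹ • cosetSum Γ η := by
    intro g hg
    conv_rhs => rw [← pullback_cosetSum Γ h2 hg]
    rfl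
  have h5 : ω = (fun _ => (N : ℝ)⁻¹ • c') + extDeriv ((N : ℝ)⁻¹ • cosetSum Γ η) := by
    have h6 : extDeriv ((N : ℝ)⁻¹ • cosetSum Γ η) = (N : ℝ)⁻¹ • extDeriv (cosetSum Γ η) :=
      funext fun x => extDeriv_smul _ _
    have h7 : ω = (N : ℝ)⁻¹ • (N • ω) := by
      rw [← Nat.cast_smul_eq_nsmul ℝ, smul_smul, inv_mul_cancel₀ hN0, one_smul]
    rw [h6, h7, h4, smul_add]
    rfl
  refine ⟨(N : ℝ)⁻¹ • c', fun g hg => ?_, _, hη, hη', h5⟩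
  -- Both `ω` and the exact part are invariant, hence so is their difference, the constant form.
  have h9 := hω g hg
  rw [h5, pullback_add, pullback_const, ← extDeriv_pullback_iso g hη, hη' g hg] at h9
  exact congrFun (add_right_cancel h9) 0

theorem invToDeRham_surjective [CompleteSpace 𝕜] (hL : latticeTranslations ι ≤ Γ)
    [Fintype (Γ ⧸ latticeIn Γ)] :
    Function.Surjective (invToDeRham Γ : invForms Γ 𝕜 p →ₗ[𝕜] DeRham Γ 𝕜 p) := by
  intro q
  obtain ⟨⟨ω, hω, hc⟩, rfl⟩ := Submodule.mkQ_surjective _ q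
  cases p with
  | zero =>
    have h1 := closed_zeroForm_eq_const hω.1 hc
    have h2 : ω 0 ∈ invForms Γ 𝕜 0 := by
      rw [← const_mem_smoothForms, ← h1]
      exact hω
    exact ⟨⟨ω 0, h2⟩, congrArg (((exactForms Γ 𝕜 0).submoduleOf (closedForms Γ 𝕜 0)).mkQ)
      (Subtype.ext h1.symm)⟩
  | succ p =>
    obtain ⟨c, hc', η, h1, h2, h3⟩ := exists_eq_invForm_add_exact hL hω.1 hω.2 hc
    refine ⟨⟨c, hc'⟩, ((Submodule.Quotient.eq _).mpr ?_)⟩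
    -- Equality of classes asks for a primitive of `c - ω`, whereas `η` is one of `ω - c`.
    refine (exactForms Γ 𝕜 (p + 1)).neg_mem_iff.mp ⟨η, ⟨h1, h2⟩, ?_⟩
    exact (eq_sub_of_add_eq' h3.symm).trans (neg_sub (fun _ => c) ω).symm

/-- The de Rham cohomology of `M_Γ` is represented by the invariant constant forms. -/
def deRhamEquiv [CompleteSpace 𝕜] (hL : latticeTranslations ι ≤ Γ) [Fintype (Γ ⧸ latticeIn Γ)]
    (p : ℕ) : invForms Γ 𝕜 p ≃ₗ[𝕜] DeRham Γ 𝕜 p :=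
  LinearEquiv.ofBijective (invToDeRham Γ) ⟨invToDeRham_injective hL, invToDeRham_surjective hL⟩

theorem betti_eq_finrank (hL : latticeTranslations ι ≤ Γ) [Fintype (Γ ⧸ latticeIn Γ)] (p : ℕ) :
    betti Γ p = Module.finrank ℝ (invForms Γ ℝ p) :=
  (deRhamEquiv hL p).finrank_eq.symm

end InvariantForms

/-! ### The Weitzenböck formula of the flat metric. -/

section Weitzenbock

variable {ι : Type} [Fintype ι] [DecidableEq ι] {p : ℕ}

/-- The (geometer's) Laplacian `-∑ ∂²/∂x_i²` acting on the coefficients. -/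
def coeffLaplacian {F : Type} [NormedAddCommGroup F] [NormedSpace ℝ F] (f : Euc ι → F)
    (x : Euc ι) : F :=
  -∑ i, fderiv ℝ (fun y => fderiv ℝ f y (EuclideanSpace.single i 1)) x (EuclideanSpace.single i 1)

theorem fderiv_fderiv_apply {E F : Type} [NormedAddCommGroup E] [NormedSpace ℝ E]
    [NormedAddCommGroup F] [NormedSpace ℝ F] {f : E → F} (hf : ContDiff ℝ (⊤ : ℕ∞) f)
    (x u v : E) : fderiv ℝ (fun y => fderiv ℝ f y v) x u = fderiv ℝ (fderiv ℝ f) x u v :=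
  fderiv_clm_comp (ContinuousLinearMap.apply ℝ F v)
    ((hf.fderiv_right (m := (⊤ : ℕ∞)) (by simp)).differentiable (by simp) x) u

/-- The derivative of `y ↦ fderiv ℝ f y v` is `u ↦ D²f u v`; symmetry of the second derivative turns
it into `D²f v`. -/
theorem hasFDerivAt_fderiv_apply {E F : Type} [NormedAddCommGroup E] [NormedSpace ℝ E]
    [NormedAddCommGroup F] [NormedSpace ℝ F] {f : E → F} (hf : ContDiff ℝ (⊤ : ℕ∞) f)
    (x v : E) : HasFDerivAt (fun y => fderiv ℝ f y v) (fderiv ℝ (fderiv ℝ f) x v) x := by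
  have h0 : ContDiff ℝ (⊤ : ℕ∞) (fderiv ℝ f) := hf.fderiv_right (by simp)
  have hs : IsSymmSndFDerivAt ℝ f x := hf.contDiffAt.isSymmSndFDerivAt (by
    rw [minSmoothness_of_isRCLikeNormedField]
    exact WithTop.coe_le_coe.2 (le_top (a := (2 : ℕ∞))))
  have h := (h0.differentiable (by simp) x).hasFDerivAt.clm_apply (hasFDerivAt_const v x)
  convert h using 1
  ext1 u
  simp [hs v u]

theorem fderiv_extDeriv {E F : Type} [NormedAddCommGroup E] [NormedSpace ℝ E]
    [NormedAddCommGroup F] [NormedSpace ℝ F] {ω : E → E [⋀^Fin p]→L[ℝ] F}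
    (hf : ContDiff ℝ (⊤ : ℕ∞) ω) (x u : E) :
    fderiv ℝ (extDeriv ω) x u =
      ContinuousAlternatingMap.alternatizeUncurryFin (fderiv ℝ (fderiv ℝ ω) x u) :=
  fderiv_clm_comp (ContinuousAlternatingMap.alternatizeUncurryFinCLM ℝ E F)
    ((hf.fderiv_right (m := (⊤ : ℕ∞)) (by simp)).differentiable (by simp) x) u

theorem curryLeft_alternatizeUncurryFin_zero {E F : Type} [NormedAddCommGroup E] [NormedSpace ℝ E]
    [NormedAddCommGroup F] [NormedSpace ℝ F] (D : E →L[ℝ] E [⋀^Fin 0]→L[ℝ] F) (v : E) :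
    (ContinuousAlternatingMap.alternatizeUncurryFin D).curryLeft v = D v := by
  ext w
  rw [ContinuousAlternatingMap.curryLeft_apply_apply,
    ContinuousAlternatingMap.alternatizeUncurryFin_apply]
  simp only [Fin.sum_univ_succ, Fin.sum_univ_zero, Fin.val_zero, pow_zero, one_smul,
    add_zero, Matrix.cons_val_zero]
  rw [Subsingleton.elim (Fin.removeNth 0 _) w]

theorem fderiv_codiff {ω : Euc ι → Euc ι [⋀^Fin (p + 1)]→L[ℝ] ℂ}
    (hω : ContDiff ℝ (⊤ : ℕ∞) ω) (x : Euc ι) :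
    fderiv ℝ (codiff ω) x = -∑ i, (contract (EuclideanSpace.single i 1)).comp
      (fderiv ℝ (fderiv ℝ ω) x (EuclideanSpace.single i 1)) := by
  have h1 : ∀ i : ι, HasFDerivAt (fun y => contract (F := ℂ) (p := p) (EuclideanSpace.single i 1)
      (fderiv ℝ ω y (EuclideanSpace.single i 1))) ((contract (EuclideanSpace.single i 1)).comp
      (fderiv ℝ (fderiv ℝ ω) x (EuclideanSpace.single i 1))) x := fun i =>
    hasFDerivAt_clm_comp (contract (F := ℂ) (p := p) (EuclideanSpace.single i 1))
      (hasFDerivAt_fderiv_apply hω x _)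
  have h4 : HasFDerivAt (codiff ω) _ x := (HasFDerivAt.fun_sum fun i _ => h1 i).neg
  exact h4.fderiv

/-- The Weitzenböck formula of the flat metric. -/
theorem hodgeLaplacian_eq {ω : Euc ι → Euc ι [⋀^Fin p]→L[ℝ] ℂ}
    (hω : ContDiff ℝ (⊤ : ℕ∞) ω) (x : Euc ι) : hodgeLaplacian ω x = coeffLaplacian ω x := by
  cases p with
  | zero =>
    simp only [hodgeLaplacian, codiff, coeffLaplacian, fderiv_extDeriv hω,
      curryLeft_alternatizeUncurryFin_zero, fderiv_fderiv_apply hω]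
  | succ p =>
    simp only [hodgeLaplacian, coeffLaplacian, fderiv_fderiv_apply hω]
    rw [extDeriv_eq_clm, fderiv_codiff hω, map_neg, map_sum]
    -- Expanding δd along the first argument produces the coefficientwise Laplacian and an
    -- alternated sum of contracted second derivatives; the latter is exactly what dδ cancels.
    simp only [codiff, fderiv_extDeriv hω, curryLeft_alternatizeUncurryFin,
      Finset.sum_sub_distrib, ContinuousAlternatingMap.alternatizeUncurryFinCLM_apply]
    abel

theorem hodgeLaplacian_const (c : Euc ι [⋀^Fin p]→L[ℝ] ℂ) (x : Euc ι) :
    hodgeLaplacian (fun _ => c) x = 0 := by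
  rw [hodgeLaplacian_eq (ω := fun _ => c) contDiff_const]
  simp [coeffLaplacian]

/-- Applied to evaluation on fixed vectors, this reduces statements on forms to scalar functions. -/
theorem coeffLaplacian_clm {F G : Type} [NormedAddCommGroup F] [NormedSpace ℝ F]
    [NormedAddCommGroup G] [NormedSpace ℝ G] (T : F →L[ℝ] G) {f : Euc ι → F}
    (hf : ContDiff ℝ (⊤ : ℕ∞) f) (x : Euc ι) :
    coeffLaplacian (fun y => T (f y)) x = T (coeffLaplacian f x) := by
  have h1 : ∀ i : ι, (fun y => fderiv ℝ (fun y => T (f y)) y (EuclideanSpace.single i 1)) =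
      fun y => T (fderiv ℝ f y (EuclideanSpace.single i 1)) := fun i => funext fun y =>
    fderiv_clm_comp T (hf.differentiable (by simp) y) _
  have h2 : ∀ i : ι, DifferentiableAt ℝ
      (fun y => fderiv ℝ f y (EuclideanSpace.single i (1 : ℝ))) x := fun i =>
    ((ContinuousLinearMap.apply ℝ F (EuclideanSpace.single i (1 : ℝ))).contDiff.comp
      (hf.fderiv_right (m := (⊤ : ℕ∞)) (by simp))).differentiable (by simp) x
  simp only [coeffLaplacian, h1, map_neg, map_sum]
  congr 1
  exact Finset.sum_congr rfl fun i _ => fderiv_clm_comp T (h2 i) _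

end Weitzenbock

/-! ### Fourier analysis on the torus. -/

section Torus

open MeasureTheory

-- Haar measure is normalized to total mass 1, so that a constant is its own mean value and the
-- coefficients below agree with `UnitAddTorus.mFourierCoeff`.
local instance haarMeasureSpaceUnitAddCircle : MeasureSpace UnitAddCircle :=
  ⟨AddCircle.haarAddCircle⟩

local instance isAddHaarMeasure_unitAddCircle :
    Measure.IsAddHaarMeasure (volume : Measure UnitAddCircle) :=
  inferInstanceAs (Measure.IsAddHaarMeasure AddCircle.haarAddCircle)

local instance isProbabilityMeasure_unitAddCircle :
    IsProbabilityMeasure (volume : Measure UnitAddCircle) :=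
  inferInstanceAs (IsProbabilityMeasure AddCircle.haarAddCircle)

variable {ι : Type} [Fintype ι]

/-- The projection of `ℝ^ι` onto the torus. -/
def torusProj (x : Euc ι) : UnitAddTorus ι := fun i => (x i : UnitAddCircle)

/-- The function on the torus defined by a periodic function. -/
def descend {F : Type} (f : Euc ι → F) (t : UnitAddTorus ι) : F :=
  f (WithLp.toLp 2 fun i => (AddCircle.equivIco 1 0 (t i) : ℝ))

theorem descend_torusProj {F : Type} {f : Euc ι → F} (h : IsPeriodic f) (x : Euc ι) :
    descend f (torusProj x) = f x := by
  rw [descend, ← h (fun i => -⌊x i⌋) x]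
  congr 1
  ext i
  rw [latticeShift_apply]
  simp only [torusProj]
  rw [AddCircle.coe_equivIco_mk_apply]
  simp [Int.fract, sub_eq_add_neg]

theorem isOpenQuotientMap_torusProj : IsOpenQuotientMap (torusProj : Euc ι → UnitAddTorus ι) := by
  have h1 : IsOpenQuotientMap (Pi.map fun (_ : ι) (x : ℝ) => (x : UnitAddCircle)) :=
    .piMap fun _ => QuotientAddGroup.isOpenQuotientMap_mk
  exact h1.comp (EuclideanSpace.equiv ι ℝ).toHomeomorph.isOpenQuotientMap

theorem torusProj_add (x y : Euc ι) : torusProj (x + y) = torusProj x + torusProj y := by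
  funext i
  exact QuotientAddGroup.mk_add _ _ _

theorem continuous_descend {F : Type} [TopologicalSpace F] {f : Euc ι → F} (hp : IsPeriodic f)
    (hf : Continuous f) : Continuous (descend f) := by
  refine (isOpenQuotientMap_torusProj.continuous_comp_iff).mp ?_
  rwa [show descend f ∘ torusProj = f from funext (descend_torusProj hp)]

/-- The mean value of a periodic function. -/
def torusMean (f : Euc ι → ℂ) : ℂ := ∫ t : UnitAddTorus ι, descend f t

theorem integrable_descend {f : Euc ι → ℂ} (hp : IsPeriodic f) (hf : Continuous f) :
    Integrable (descend f) (volume : Measure (UnitAddTorus ι)) :=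
  (continuous_descend hp hf).integrable_of_hasCompactSupport (HasCompactSupport.of_compactSpace _)

theorem torusMean_add {f g : Euc ι → ℂ} (hp : IsPeriodic f) (hf : Continuous f)
    (hp' : IsPeriodic g) (hg : Continuous g) :
    torusMean (fun x => f x + g x) = torusMean f + torusMean g :=
  integral_add (integrable_descend hp hf) (integrable_descend hp' hg)

theorem torusMean_const_mul (c : ℂ) (f : Euc ι → ℂ) :
    torusMean (fun x => c * f x) = c * torusMean f :=
  integral_const_mul c _

theorem torusMean_sum {α : Type} (s : Finset α) {f : α → Euc ι → ℂ} (hp : ∀ a, IsPeriodic (f a))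
    (hf : ∀ a, Continuous (f a)) :
    torusMean (fun x => ∑ a ∈ s, f a x) = ∑ a ∈ s, torusMean (f a) :=
  integral_finsetSum s fun a _ => integrable_descend (hp a) (hf a)

theorem torusMean_const (c : ℂ) : torusMean (fun _ : Euc ι => c) = c := by
  simp [torusMean, descend]

theorem IsPeriodic.fderiv_apply {F : Type} [NormedAddCommGroup F] [NormedSpace ℝ F]
    {f : Euc ι → F} (hp : IsPeriodic f) (v : Euc ι) : IsPeriodic fun x => fderiv ℝ f x v := by
  intro m x
  have h : (fun y => f (y + WithLp.toLp 2 fun i => (m i : ℝ))) = f := funext fun y => by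
    rw [← latticeShift_eq_add, hp]
  beta_reduce
  rw [latticeShift_eq_add, ← fderiv_comp_add_right, h]

/-- The mean value of a partial derivative of a periodic function vanishes. -/
theorem torusMean_fderiv [DecidableEq ι] {f : Euc ι → ℂ} (hp : IsPeriodic f)
    (hf : ContDiff ℝ 1 f) (i : ι) :
    torusMean (fun x => fderiv ℝ f x (EuclideanSpace.single i 1)) = 0 := by
  set v : Euc ι := EuclideanSpace.single i 1 with hv
  set f' : Euc ι → ℂ := fun x => fderiv ℝ f x v with hf'
  have hc : Continuous f' := by
    have := hf.continuous_fderiv (by simp)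
    fun_prop
  have hp' : IsPeriodic f' := hp.fderiv_apply v
  have hcd := continuous_descend hp' hc
  -- The integral of the derivative along a closed orbit in direction `v` vanishes. Averaging over
  -- all starting points and exchanging the integrals gives the mean itself, by translation
  -- invariance.
  have h1 : ∀ t : UnitAddTorus ι,
      ∫ s in (0 : ℝ)..1, descend f' (t + torusProj (s • v)) = 0 := by
    intro t
    obtain ⟨x, rfl⟩ := isOpenQuotientMap_torusProj.surjective t
    have hd : ∀ s ∈ Set.uIcc (0 : ℝ) 1,
        HasDerivAt (fun s : ℝ => f (x + s • v)) (f' (x + s • v)) s := by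
      intro s _
      have h2 : HasDerivAt (fun s : ℝ => x + s • v) v s := by
        simpa using ((hasDerivAt_id s).smul_const v).const_add x
      exact (hf.differentiable (by simp) (x + s • v)).hasFDerivAt.comp_hasDerivAt s h2
    have h3 := intervalIntegral.integral_eq_sub_of_hasDerivAt hd
      ((by fun_prop : Continuous fun s : ℝ => f' (x + s • v)).intervalIntegrable _ _)
    simp only [← torusProj_add, descend_torusProj hp', h3]
    rw [one_smul, hp.add_single, zero_smul, add_zero, sub_self]
  have hpc : Continuous (torusProj : Euc ι → UnitAddTorus ι) :=
    isOpenQuotientMap_torusProj.continuous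
  have h2 : ∫ t : UnitAddTorus ι, ∫ s in (0 : ℝ)..1, descend f' (t + torusProj (s • v)) =
      ∫ s in (0 : ℝ)..1, ∫ t : UnitAddTorus ι, descend f' (t + torusProj (s • v)) := by
    simp only [intervalIntegral.integral_of_le zero_le_one]
    refine integral_integral_swap ?_
    obtain ⟨C, hC⟩ := isCompact_univ.exists_bound_of_continuousOn hcd.continuousOn
    refine Integrable.of_bound (C := C) ?_ (.of_forall fun q => hC _ (Set.mem_univ _))
    exact (hcd.comp (by fun_prop : Continuous fun q : UnitAddTorus ι × ℝ =>
      q.1 + torusProj (q.2 • v))).aestronglyMeasurable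
  simp only [h1, integral_zero] at h2
  have h3 : ∀ s : ℝ, ∫ t : UnitAddTorus ι, descend f' (t + torusProj (s • v)) = torusMean f' :=
    fun s => integral_add_right_eq_self (descend f') (torusProj (s • v))
  simp only [h3] at h2
  simpa using h2.symm

/-- The character `x ↦ exp(2πi ⟨m, x⟩)` of `ℝ^ι`. -/
def expChar (m : ι → ℤ) (x : Euc ι) : ℂ :=
  Complex.exp (2 * Real.pi * Complex.I * ((∑ i, m i * x i : ℝ) : ℂ))

theorem mFourier_torusProj (m : ι → ℤ) (x : Euc ι) :
    UnitAddTorus.mFourier m (torusProj x) = expChar m x := by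
  simp only [UnitAddTorus.mFourier, ContinuousMap.coe_mk, torusProj, fourier_coe_apply, expChar,
    ← Complex.exp_sum]
  congr 1
  push_cast
  rw [Finset.mul_sum]
  exact Finset.sum_congr rfl fun i _ => by ring

theorem expChar_zero : expChar (0 : ι → ℤ) = fun _ => 1 := by
  funext x
  simp [expChar]

theorem expChar_add (m k : ι → ℤ) (x : Euc ι) :
    expChar (m + k) x = expChar m x * expChar k x := by
  rw [expChar, expChar, expChar, ← Complex.exp_add, ← mul_add]
  congr 2
  push_cast
  simp only [Pi.add_apply, Int.cast_add, add_mul, Finset.sum_add_distrib]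

theorem isPeriodic_expChar (m : ι → ℤ) : IsPeriodic (expChar m) := by
  intro k x
  have h : ∀ y : Euc ι, torusProj (latticeShift k y) = torusProj y := fun y => funext fun i => by
    simp only [torusProj, latticeShift_apply]
    rw [← zsmul_one, AddCircle.coe_add, AddCircle.coe_zsmul, AddCircle.coe_period, smul_zero,
      add_zero]
  rw [← mFourier_torusProj, h, mFourier_torusProj]

/-- The linear form `x ↦ 2πi ⟨m, x⟩`. -/
def charForm (m : ι → ℤ) : Euc ι →L[ℝ] ℂ :=
  ∑ i, (2 * Real.pi * Complex.I * m i) • Complex.ofRealCLM.comp (EuclideanSpace.proj i)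

theorem charForm_apply (m : ι → ℤ) (x : Euc ι) :
    charForm m x = ∑ i, 2 * Real.pi * Complex.I * m i * (x i : ℂ) := by
  simp [charForm]

theorem expChar_eq_exp_charForm (m : ι → ℤ) : expChar m = fun x => Complex.exp (charForm m x) := by
  funext x
  rw [expChar, charForm_apply]
  congr 1
  push_cast
  rw [Finset.mul_sum]
  exact Finset.sum_congr rfl fun i _ => by ring

theorem contDiff_expChar (m : ι → ℤ) : ContDiff ℝ (⊤ : ℕ∞) (expChar m) := by
  rw [expChar_eq_exp_charForm]
  exact (charForm m).contDiff.cexp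

theorem fderiv_expChar [DecidableEq ι] (m : ι → ℤ) (x : Euc ι) (i : ι) :
    fderiv ℝ (expChar m) x (EuclideanSpace.single i 1) =
      (2 * Real.pi * Complex.I * m i) * expChar m x := by
  rw [expChar_eq_exp_charForm, (charForm m).hasFDerivAt.cexp.fderiv]
  simp only [FunLike.coe_smul, Pi.smul_apply, smul_eq_mul]
  rw [mul_comm, charForm_apply]
  congr 1
  simp [apply_ite]

/-- A partial derivative of the character is a nonzero multiple of it, and has mean 0. -/
theorem torusMean_expChar {m : ι → ℤ} (hm : m ≠ 0) : torusMean (expChar m) = 0 := by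
  classical
  obtain ⟨i, hi⟩ := Function.ne_iff.mp hm
  have h := torusMean_fderiv (isPeriodic_expChar m)
    ((contDiff_expChar m).of_le (by exact_mod_cast le_top)) i
  simp only [fderiv_expChar, torusMean_const_mul] at h
  refine (mul_eq_zero.mp h).resolve_left ?_
  have hi' : (m i : ℂ) ≠ 0 := by exact_mod_cast hi
  have := Complex.two_pi_I_ne_zero
  exact mul_ne_zero this hi'

/-- The Fourier coefficients of a periodic function. -/
def torusCoeff (f : Euc ι → ℂ) (m : ι → ℤ) : ℂ := torusMean fun x => expChar (-m) x * f x

theorem IsPeriodic.mul {f g : Euc ι → ℂ} (hf : IsPeriodic f) (hg : IsPeriodic g) :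
    IsPeriodic fun x => f x * g x := fun m x => by
  have h1 := hf m x
  have h2 := hg m x
  simp only [h1, h2]

/-- Integration by parts: the derivative of the product of `f` with the character of `-m` has mean
0. -/
theorem torusCoeff_fderiv [DecidableEq ι] {f : Euc ι → ℂ} (hp : IsPeriodic f)
    (hf : ContDiff ℝ 1 f) (m : ι → ℤ) (i : ι) :
    torusCoeff (fun x => fderiv ℝ f x (EuclideanSpace.single i 1)) m =
      2 * Real.pi * Complex.I * m i * torusCoeff f m := by
  have he : ContDiff ℝ 1 (expChar (-m)) :=
    (contDiff_expChar (-m)).of_le (by exact_mod_cast le_top)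
  have h1 := torusMean_fderiv ((isPeriodic_expChar (-m)).mul hp) (he.mul hf) i
  have h2 : (fun x => fderiv ℝ (fun x => expChar (-m) x * f x) x (EuclideanSpace.single i 1)) =
      fun x => expChar (-m) x * fderiv ℝ f x (EuclideanSpace.single i 1) +
        -(2 * Real.pi * Complex.I * m i) * (expChar (-m) x * f x) := by
    funext x
    rw [fderiv_fun_mul (he.differentiable (by simp) x) (hf.differentiable (by simp) x)]
    simp only [add_apply, FunLike.coe_smul, Pi.smul_apply, smul_eq_mul, fderiv_expChar]
    simp only [Pi.neg_apply, Int.cast_neg]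
    ring
  have hc : Continuous fun x => fderiv ℝ f x (EuclideanSpace.single i 1) := by
    have := hf.continuous_fderiv (by simp)
    fun_prop
  rw [h2, torusMean_add
    (f := fun x => expChar (-m) x * fderiv ℝ f x (EuclideanSpace.single i 1))
    (g := fun x => -(2 * Real.pi * Complex.I * m i) * (expChar (-m) x * f x)) ((isPeriodic_expChar _).mul (hp.fderiv_apply _)) (he.continuous.mul hc)
    (fun k x => by simp only [isPeriodic_expChar (-m) k x, hp k x])
    (continuous_const.mul (he.continuous.mul hf.continuous)), torusMean_const_mul] at h1
  rw [torusCoeff, torusCoeff]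
  linear_combination h1

theorem torusCoeff_coeffLaplacian [DecidableEq ι] {f : Euc ι → ℂ} (hp : IsPeriodic f)
    (hf : ContDiff ℝ (⊤ : ℕ∞) f) (m : ι → ℤ) :
    torusCoeff (coeffLaplacian f) m = (4 * Real.pi ^ 2 * ∑ i, (m i : ℝ) ^ 2 : ℝ) * torusCoeff f m := by
  have hd : ∀ i : ι, ContDiff ℝ (⊤ : ℕ∞) fun x => fderiv ℝ f x (EuclideanSpace.single i 1) :=
    fun i => (hf.fderiv_right (m := (⊤ : ℕ∞)) (by simp)).clm_apply contDiff_const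
  have hdd : ∀ i : ι, ContDiff ℝ (⊤ : ℕ∞) fun x => fderiv ℝ
      (fun y => fderiv ℝ f y (EuclideanSpace.single i 1)) x (EuclideanSpace.single i 1) :=
    fun i => ((hd i).fderiv_right (m := (⊤ : ℕ∞)) (by simp)).clm_apply contDiff_const
  have h1 : ∀ i : ι, torusCoeff (fun x => fderiv ℝ
      (fun y => fderiv ℝ f y (EuclideanSpace.single i 1)) x (EuclideanSpace.single i 1)) m =
      (2 * Real.pi * Complex.I * m i) ^ 2 * torusCoeff f m := by
    intro i
    rw [torusCoeff_fderiv (hp.fderiv_apply _) ((hd i).of_le (by exact_mod_cast le_top)),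
      torusCoeff_fderiv hp (hf.of_le (by exact_mod_cast le_top))]
    ring
  have h2 : torusCoeff (coeffLaplacian f) m = ∑ i, -torusCoeff (fun x => fderiv ℝ
      (fun y => fderiv ℝ f y (EuclideanSpace.single i 1)) x (EuclideanSpace.single i 1)) m := by
    rw [Finset.sum_neg_distrib]
    simp only [torusCoeff]
    rw [← torusMean_sum _ (fun i => (isPeriodic_expChar _).mul ((hp.fderiv_apply _).fderiv_apply _))
      (fun i => (contDiff_expChar _).continuous.mul (hdd i).continuous), ← neg_one_mul (torusMean _),
      ← torusMean_const_mul]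
    congr 1
    funext x
    rw [coeffLaplacian, ← Finset.mul_sum]
    ring
  simp only [h2, h1]
  push_cast
  rw [Finset.mul_sum, Finset.sum_mul]
  refine Finset.sum_congr rfl fun i _ => ?_
  rw [mul_pow, mul_pow, Complex.I_sq]
  ring

/-- A smooth periodic eigenfunction of the Laplacian is a trigonometric polynomial. -/
theorem eigenfunction_eq_sum [DecidableEq ι] {f : Euc ι → ℂ} (hp : IsPeriodic f)
    (hf : ContDiff ℝ (⊤ : ℕ∞) f) {lam : ℝ} (hl : ∀ x, coeffLaplacian f x = (lam : ℂ) * f x)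
    {S : Finset (ι → ℤ)} (hS : ∀ m : ι → ℤ, 4 * Real.pi ^ 2 * ∑ i, (m i : ℝ) ^ 2 = lam → m ∈ S)
    (x : Euc ι) : f x = ∑ m ∈ S, torusCoeff f m * expChar m x := by
  have h0 : ∀ m ∉ S, torusCoeff f m = 0 := by
    -- Comparing coefficients in the eigenvalue equation gives (lam − 4π²|m|²) · `torusCoeff f m` =
    -- 0.
    intro m hm
    have h1 := torusCoeff_coeffLaplacian hp hf m
    have h2 : torusCoeff (coeffLaplacian f) m = lam * torusCoeff f m := by
      rw [torusCoeff, torusCoeff, ← torusMean_const_mul]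
      congr 1
      funext x
      rw [hl]
      ring
    rw [h2] at h1
    have h3 : ((lam - 4 * Real.pi ^ 2 * ∑ i, (m i : ℝ) ^ 2 : ℝ) : ℂ) * torusCoeff f m = 0 := by
      push_cast at h1 ⊢
      linear_combination h1
    refine (mul_eq_zero.mp h3).resolve_left fun h4 => hm (hS m ?_)
    have := Complex.ofReal_eq_zero.mp h4
    linarith
  let F : C(UnitAddTorus ι, ℂ) := ⟨descend f, continuous_descend hp hf.continuous⟩
  have hF : ∀ m, UnitAddTorus.mFourierCoeff F m = torusCoeff f m := by
    intro m
    rw [UnitAddTorus.mFourierCoeff, torusCoeff, torusMean]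
    refine integral_congr_ae (.of_forall fun t => ?_)
    obtain ⟨y, rfl⟩ := isOpenQuotientMap_torusProj.surjective t
    rw [descend_torusProj ((isPeriodic_expChar _).mul hp)]
    simp only [F, ContinuousMap.coe_mk, descend_torusProj hp, mFourier_torusProj, smul_eq_mul]
  -- Only finitely many coefficients are nonzero, so the Fourier series converges pointwise to `f`
  -- and is a finite sum.
  have hsum : Summable (UnitAddTorus.mFourierCoeff F) :=
    summable_of_ne_finset_zero (s := S) fun m hm => by rw [hF, h0 m hm]
  have h := UnitAddTorus.hasSum_mFourier_series_apply_of_summable hsum (torusProj x)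
  have h' := h.unique (hasSum_sum_of_ne_finset_zero (s := S) fun m hm => by
    rw [hF, h0 m hm, zero_smul])
  simp only [hF] at h'
  simpa only [F, ContinuousMap.coe_mk, descend_torusProj hp, mFourier_torusProj, smul_eq_mul]
    using h'

/-- Orthogonality of characters. -/
theorem torusCoeff_sum_expChar [DecidableEq ι] (S : Finset (ι → ℤ)) (c : (ι → ℤ) → ℂ)
    (k : ι → ℤ) :
    torusCoeff (fun x => ∑ m ∈ S, c m * expChar m x) k = if k ∈ S then c k else 0 := by
  have h1 : (fun x : Euc ι => expChar (-k) x * ∑ m ∈ S, c m * expChar m x) =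
      fun x => ∑ m ∈ S, c m * expChar (-k + m) x := funext fun x => by
    rw [Finset.mul_sum]
    exact Finset.sum_congr rfl fun m _ => by rw [expChar_add]; ring
  rw [torusCoeff, h1, torusMean_sum S (f := fun m x => c m * expChar (-k + m) x)
    (fun m n x => congrArg (c m * ·) (isPeriodic_expChar (-k + m) n x))
    fun m => continuous_const.mul (contDiff_expChar _).continuous]
  have h2 : ∀ m, torusMean (fun x : Euc ι => c m * expChar (-k + m) x) =
      if k = m then c m else 0 := by
    intro m
    rw [torusMean_const_mul]
    split_ifs with h
    · rw [h, neg_add_cancel, expChar_zero, torusMean_const, mul_one]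
    · rw [torusMean_expChar fun h' => h (neg_add_eq_zero.mp h'), mul_zero]
  simp only [h2, Finset.sum_ite_eq]

end Torus

/-! ### Harmonic forms, and passage between real and complex coefficients. -/

section Harmonic

variable {ι : Type} [Fintype ι] [DecidableEq ι] {Γ : Subgroup (Iso ι)} {p : ℕ}

/-- Periodic harmonic forms are constant. -/
theorem harmonic_eq_const {ω : Euc ι → Euc ι [⋀^Fin p]→L[ℝ] ℂ} (hω : ContDiff ℝ (⊤ : ℕ∞) ω)
    (hp : IsPeriodic ω) (h : ∀ x, hodgeLaplacian ω x = 0) : ω = fun _ => ω 0 := by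
  funext x
  ext v
  let T : (Euc ι [⋀^Fin p]→L[ℝ] ℂ) →L[ℝ] ℂ := ContinuousAlternatingMap.apply ℝ (Euc ι) ℂ v
  have h1 : ∀ y, T (ω y) = torusCoeff (fun y => T (ω y)) 0 := by
    intro y
    -- Each component is an eigenfunction for 0, and `m = 0` is the only frequency with |m|² = 0.
    have h2 := eigenfunction_eq_sum (f := fun y => T (ω y)) (lam := 0) (S := {0})
      (fun m z => congrArg T (hp m z)) (T.contDiff.comp hω)
      (fun z => by
        rw [coeffLaplacian_clm T hω, ← hodgeLaplacian_eq hω, h, map_zero, Complex.ofReal_zero,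
          zero_mul])
      (fun m hm => by
        have h3 : ∑ i, (m i : ℝ) ^ 2 = 0 :=
          (mul_eq_zero.mp hm).resolve_left (by positivity)
        rw [Finset.sum_eq_zero_iff_of_nonneg fun i _ => sq_nonneg _] at h3
        rw [Finset.mem_singleton]
        funext i
        simpa using h3 i (Finset.mem_univ i)) y
    rw [h2, Finset.sum_singleton, expChar_zero, mul_one]
  exact (h1 x).trans (h1 0).symm

theorem hodgeLaplacian_eq_zero_of_mem {ω : Euc ι → Euc ι [⋀^Fin p]→L[ℝ] ℂ}
    (h : (ω : Forms ι ℂ p) ∈ eigenforms Γ p 0) (x : Euc ι) : hodgeLaplacian ω x = 0 := by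
  have h1 : hodgeLaplacian ω x = ((0 : ℝ) : ℂ) • ω x := h.2 x
  rw [h1, Complex.ofReal_zero]
  exact zero_smul ℂ (ω x)

theorem const_mem_eigenforms {c : Euc ι [⋀^Fin p]→L[ℝ] ℂ} (hc : c ∈ invForms Γ ℂ p) :
    ((fun _ => c : Euc ι → Euc ι [⋀^Fin p]→L[ℝ] ℂ) : Forms ι ℂ p) ∈ eigenforms Γ p 0 := by
  refine ⟨(const_mem_smoothForms Γ).mpr hc, fun x => (hodgeLaplacian_const c x).trans ?_⟩
  change 0 = ((0 : ℝ) : ℂ) • c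
  rw [Complex.ofReal_zero]
  exact (zero_smul ℂ c).symm

/-- The harmonic forms on `M_Γ` are the invariant constant forms. -/
def harmonicEquiv (hL : latticeTranslations ι ≤ Γ) (p : ℕ) :
    invForms Γ ℂ p ≃ₗ[ℂ] eigenforms Γ p 0 where
  toFun c := ⟨fun _ => c.1, const_mem_eigenforms c.2⟩
  map_add' _ _ := rfl
  map_smul' _ _ := rfl
  invFun ω := ⟨ω.1 0, by
    rw [← const_mem_smoothForms, ← harmonic_eq_const ω.2.1.1
      (isPeriodic_of_mem_smoothForms hL ω.2.1) (hodgeLaplacian_eq_zero_of_mem ω.2)]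
    exact ω.2.1⟩
  left_inv _ := rfl
  right_inv ω := Subtype.ext (harmonic_eq_const ω.2.1.1
    (isPeriodic_of_mem_smoothForms hL ω.2.1) (hodgeLaplacian_eq_zero_of_mem ω.2)).symm

theorem multiplicity_zero (hL : latticeTranslations ι ≤ Γ) (p : ℕ) :
    multiplicity Γ p 0 = Module.rank ℂ (invForms Γ ℂ p) :=
  (harmonicEquiv hL p).rank_eq.symm

end Harmonic

section RealAndComplex

variable {ι : Type} [Fintype ι] (Γ : Subgroup (Iso ι)) (p : ℕ)

/-- A complex invariant form is a pair of real ones. -/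
def invFormsComplexEquiv : invForms Γ ℂ p ≃ₗ[ℝ] invForms Γ ℝ p × invForms Γ ℝ p where
  toFun c := (⟨Complex.reCLM.compContinuousAlternatingMap c.1, fun g hg =>
      congrArg (Complex.reCLM.compContinuousAlternatingMap) (c.2 g hg)⟩,
    ⟨Complex.imCLM.compContinuousAlternatingMap c.1, fun g hg =>
      congrArg (Complex.imCLM.compContinuousAlternatingMap) (c.2 g hg)⟩)
  map_add' _ _ := rfl
  map_smul' r c := by
    ext v
    · exact Complex.re_ofReal_mul r _
    · exact Complex.im_ofReal_mul r _
  invFun c := ⟨Complex.ofRealCLM.compContinuousAlternatingMap c.1.1 +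
      Complex.I • Complex.ofRealCLM.compContinuousAlternatingMap c.2.1, fun g hg => by
    conv_rhs => rw [← c.1.2 g hg, ← c.2.2 g hg]
    rfl⟩
  left_inv c := by
    ext v
    change ((c.1 v).re : ℂ) + Complex.I * ((c.1 v).im : ℂ) = c.1 v
    rw [mul_comm, Complex.re_add_im]
  right_inv c := by
    ext v
    · change (((c.1.1 v : ℝ) : ℂ) + Complex.I * ((c.2.1 v : ℝ) : ℂ)).re = c.1.1 v
      simp
    · change (((c.1.1 v : ℝ) : ℂ) + Complex.I * ((c.2.1 v : ℝ) : ℂ)).im = c.2.1 v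
      simp

/-- The Betti numbers are real dimensions while the count by eigenvectors needs ℂ; comparing real
dimensions, both sides double. -/
theorem finrank_invForms_complex [Module.Finite ℝ (invForms Γ ℝ p)] :
    Module.finrank ℂ (invForms Γ ℂ p) = Module.finrank ℝ (invForms Γ ℝ p) := by
  have h1 := (invFormsComplexEquiv Γ p).finrank_eq
  have h2 := h1.symm.trans (finrank_real_of_complex (invForms Γ ℂ p))
  rw [Module.finrank_prod] at h2
  omega

end RealAndComplex

/-! ### Alternating forms in coordinates and their complexification. -/

section Alternating

open Module

variable {R M N I : Type*} [CommRing R] [AddCommGroup M] [Module R M] [AddCommGroup N] [Module R N]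
  [LinearOrder I] {p : ℕ}

/-- Alternating maps are given by their values on the increasing families of basis vectors. -/
def alternatingEquiv (b : Basis I R M) :
    (M [⋀^Fin p]→ₗ[R] N) ≃ₗ[R] (Set.powersetCard I p → N) :=
  exteriorPower.alternatingMapLinearEquiv.trans ((b.exteriorPower p).constr R).symm

theorem alternatingEquiv_apply (b : Basis I R M) (f : M [⋀^Fin p]→ₗ[R] N)
    (s : Set.powersetCard I p) :
    alternatingEquiv b f s = f (b ∘ Set.powersetCard.ofFinEmbEquiv.symm s) := by
  rw [alternatingEquiv, LinearEquiv.trans_apply, Basis.constr_symm_apply,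
    exteriorPower.basis_apply, exteriorPower.ιMulti_family,
    exteriorPower.alternatingMapLinearEquiv_apply_ιMulti]

end Alternating

section Restriction

open Module

variable {ι : Type} [Fintype ι] {p : ℕ}

/-- The inclusion of `ℝ^ι` in `ℂ^ι`. -/
def toComplexVec : Euc ι →ₗ[ℝ] (ι → ℂ) where
  toFun x i := (x i : ℂ)
  map_add' x y := by ext i; simp
  map_smul' r x := by ext i; simp

@[simp] theorem toComplexVec_apply (x : Euc ι) (i : ι) : toComplexVec x i = (x i : ℂ) := rfl

/-- Expanded in the canonical basis, the map is a polynomial in the coordinates of its arguments. -/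
theorem continuous_multilinear (f : MultilinearMap ℝ (fun _ : Fin p => Euc ι) ℂ) :
    Continuous f := by
  classical
  have h : ∀ v : Fin p → Euc ι, f v = ∑ σ : Fin p → ι,
      (∏ k, v k (σ k)) • f fun k => EuclideanSpace.single (σ k) 1 := by
    intro v
    have h1 : v = fun k => ∑ i, v k i • EuclideanSpace.single i (1 : ℝ) := funext fun k => by
      have := (EuclideanSpace.basisFun ι ℝ).sum_repr (v k)
      simpa using this.symm
    conv_lhs => rw [h1]
    rw [MultilinearMap.map_sum]
    exact Finset.sum_congr rfl fun σ _ => f.map_smul_univ _ _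
  have h' : (f : (Fin p → Euc ι) → ℂ) = fun v => ∑ σ : Fin p → ι,
      (∏ k, v k (σ k)) • f fun k => EuclideanSpace.single (σ k) 1 := funext h
  rw [h']
  fun_prop

/-- The restriction to `ℝ^ι` of a complex alternating form on `ℂ^ι`. -/
def restrictReal : ((ι → ℂ) [⋀^Fin p]→ₗ[ℂ] ℂ) →ₗ[ℂ] Euc ι [⋀^Fin p]→L[ℝ] ℂ where
  toFun ω :=
    { toMultilinearMap :=
        (ω.toMultilinearMap.restrictScalars ℝ).compLinearMap fun _ => toComplexVec
      cont := continuous_multilinear _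
      map_eq_zero_of_eq' := fun _ _ _ h hij =>
        ω.map_eq_zero_of_eq _ (congrArg toComplexVec h) hij }
  map_add' _ _ := rfl
  map_smul' _ _ := rfl

theorem restrictReal_apply (ω : (ι → ℂ) [⋀^Fin p]→ₗ[ℂ] ℂ) (v : Fin p → Euc ι) :
    restrictReal ω v = ω fun k => toComplexVec (v k) := rfl

theorem toComplexVec_single [DecidableEq ι] (i : ι) :
    toComplexVec (EuclideanSpace.single i 1) = Pi.basisFun ℂ ι i := by
  ext j
  by_cases h : j = i
  · subst h; simp
  · simp [h]

/-- Forms on either side are freely determined by their values on the increasing families of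
canonical basis vectors, and these vectors correspond to each other under the inclusion of ℝ^ι in
ℂ^ι. -/
theorem restrictReal_bijective :
    Function.Bijective (restrictReal : ((ι → ℂ) [⋀^Fin p]→ₗ[ℂ] ℂ) →ₗ[ℂ] _) := by
  classical
  constructor
  · rw [injective_iff_map_eq_zero]
    intro ω h
    refine (Pi.basisFun ℂ ι).ext_alternating fun v _ => ?_
    have h1 := congrArg (fun c => c fun k => EuclideanSpace.single (v k) (1 : ℝ)) h
    simp only [restrictReal_apply, toComplexVec_single] at h1
    exact h1
  · intro c
    let : LinearOrder ι := linearOrderOfSTO WellOrderingRel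
    let e := (EuclideanSpace.basisFun ι ℝ).toBasis
    refine ⟨(alternatingEquiv (Pi.basisFun ℂ ι)).symm (alternatingEquiv e c.toAlternatingMap), ?_⟩
    apply ContinuousAlternatingMap.toAlternatingMap_injective
    apply (alternatingEquiv e).injective
    funext s
    rw [alternatingEquiv_apply]
    set a := alternatingEquiv e c.toAlternatingMap with ha
    conv_rhs => rw [← (alternatingEquiv (p := p) (N := ℂ) (Pi.basisFun ℂ ι)).apply_symm_apply a]
    rw [alternatingEquiv_apply]
    have h1 : ∀ i, toComplexVec (e i) = Pi.basisFun ℂ ι i := fun i => by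
      rw [← toComplexVec_single]
      simp [e]
    change _ = _
    simp only [Function.comp_def, ← h1]
    rfl

end Restriction

/-! ### Counting invariant forms by simultaneous eigenvectors. -/

section Generators

variable {ι : Type} [Fintype ι] {𝕜 : Type} [NormedField 𝕜] [NormedAlgebra ℝ 𝕜] {p : ℕ}

theorem pullback_closure_sup_iff {s : Set (Iso ι)} {ω : Euc ι → Euc ι [⋀^Fin p]→L[ℝ] 𝕜} :
    (∀ g ∈ Subgroup.closure s ⊔ latticeTranslations ι, pullback g ω = ω) ↔
      (∀ g ∈ s, pullback g ω = ω) ∧ IsPeriodic ω := by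
  constructor
  · exact fun h => ⟨fun g hg => h g ((le_sup_left : Subgroup.closure s ≤ _)
      (Subgroup.subset_closure hg)),
      isPeriodic_of_pullback fun g hg => h g ((le_sup_right : latticeTranslations ι ≤ _) hg)⟩
  · rintro ⟨h1, h2⟩
    -- The isometries preserving `ω` form a subgroup, so it suffices to test generators.
    let H : Subgroup (Iso ι) :=
      { carrier := {g | pullback g ω = ω}
        one_mem' := rfl
        mul_mem' := fun {g h} (hg : _ = _) (hh : _ = _) =>
          show _ = _ by rw [pullback_mul, hg, hh]
        inv_mem' := fun {g} (hg : _ = _) => show _ = _ by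
          conv_lhs => rw [← hg, ← pullback_mul, mul_inv_cancel, pullback_one] }
    have h3 : Subgroup.closure s ⊔ latticeTranslations ι ≤ H :=
      sup_le ((Subgroup.closure_le H).mpr h1) fun g hg => h2.pullback_eq hg
    exact fun g hg => h3 hg

theorem mem_invForms_closure_sup_iff {s : Set (Iso ι)} {c : Euc ι [⋀^Fin p]→L[ℝ] 𝕜} :
    c ∈ invForms (Subgroup.closure s ⊔ latticeTranslations ι) 𝕜 p ↔
      ∀ g ∈ s, c.compContinuousLinearMap (g.linearIsometryEquiv : Euc ι →L[ℝ] Euc ι) = c := by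
  have h := pullback_closure_sup_iff (s := s) (ω := fun _ => c)
  have h1 : IsPeriodic fun _ : Euc ι => c := fun _ _ => rfl
  constructor
  · exact fun hc g hg => congrFun ((h.mp fun g hg => funext fun _ => hc g hg).1 g hg) 0
  · exact fun hc g hg => congrFun (h.mpr ⟨fun g hg => funext fun _ => hc g hg, h1⟩ g hg) 0

end Generators

section Support

/-- The dimension of the space of functions supported in a subset of a finite set. -/
theorem finrank_supported {J : Type*} [Finite J] (P : J → Prop) (W : Submodule ℂ (J → ℂ))
    (hW : ∀ f, f ∈ W ↔ ∀ s, ¬ P s → f s = 0) : Module.finrank ℂ W = Nat.card {s // P s} := by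
  classical
  have := Fintype.ofFinite J
  let e : W ≃ₗ[ℂ] ({s // P s} → ℂ) :=
    { toFun := fun f s => f.1 s.1
      map_add' := fun _ _ => rfl
      map_smul' := fun _ _ => rfl
      invFun := fun g => ⟨fun s => if h : P s then g ⟨s, h⟩ else 0, (hW _).mpr fun s hs => by
        simp [hs]⟩
      left_inv := fun f => by
        ext s
        by_cases h : P s
        · simp [h]
        · simp [h, (hW _).mp f.2 s h]
      right_inv := fun g => by
        ext s
        simp [s.2] }
  rw [e.finrank_eq, Module.finrank_fintype_fun_eq_card, Nat.card_eq_fintype_card]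

end Support

section Diagonal

open Module

variable {ι : Type} [Fintype ι] {I : Type} {p : ℕ}

/-- The complexified linear part of `a` is diagonal in the basis `u`, with eigenvalues `χ`. -/
def Diagonalizes (a : Iso ι) (u : Basis I ℂ (ι → ℂ)) (χ : I → ℂ) : Prop :=
  ∃ T : (ι → ℂ) →ₗ[ℂ] (ι → ℂ),
    (∀ x, T (toComplexVec x) = toComplexVec (a.linearIsometryEquiv x)) ∧ ∀ i, T (u i) = χ i • u i

/-- Complex alternating forms on `ℝ^ι` in the coordinates given by a basis of `ℂ^ι`. -/
def formCoord [LinearOrder I] (u : Basis I ℂ (ι → ℂ)) :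
    (Euc ι [⋀^Fin p]→L[ℝ] ℂ) ≃ₗ[ℂ] (Set.powersetCard I p → ℂ) :=
  (LinearEquiv.ofBijective restrictReal restrictReal_bijective).symm.trans (alternatingEquiv u)

theorem formCoord_restrictReal [LinearOrder I] (u : Basis I ℂ (ι → ℂ))
    (ω : (ι → ℂ) [⋀^Fin p]→ₗ[ℂ] ℂ) : formCoord u (restrictReal ω) = alternatingEquiv u ω := by
  rw [formCoord, LinearEquiv.trans_apply]
  congr 1
  exact (LinearEquiv.ofBijective restrictReal restrictReal_bijective).symm_apply_apply ω

/-- The coefficient indexed by `S` is the value of the form on the eigenvectors in `S`; by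
multilinearity the eigenvalues come out as a product. -/
theorem Diagonalizes.formCoord_comp [LinearOrder I] {a : Iso ι} {u : Basis I ℂ (ι → ℂ)}
    {χ : I → ℂ} (h : Diagonalizes a u χ) (c : Euc ι [⋀^Fin p]→L[ℝ] ℂ)
    (S : Set.powersetCard I p) :
    formCoord u (c.compContinuousLinearMap (a.linearIsometryEquiv : Euc ι →L[ℝ] Euc ι)) S =
      (∏ i ∈ S.1, χ i) * formCoord u c S := by
  obtain ⟨T, hT, hu⟩ := h
  obtain ⟨ω, rfl⟩ := restrictReal_bijective.surjective c
  have h1 : (restrictReal ω).compContinuousLinearMap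
      (a.linearIsometryEquiv : Euc ι →L[ℝ] Euc ι) = restrictReal (ω.compLinearMap T) := by
    ext v
    change ω (fun k => toComplexVec (a.linearIsometryEquiv (v k))) =
      ω fun k => T (toComplexVec (v k))
    simp only [hT]
  rw [h1, formCoord_restrictReal, formCoord_restrictReal, alternatingEquiv_apply,
    alternatingEquiv_apply]
  change ω (fun k => T (u _)) = _
  simp only [hu]
  have h2 := ω.toMultilinearMap.map_smul_univ
    (fun k => χ (Set.powersetCard.ofFinEmbEquiv.symm S k))
    (fun k => u (Set.powersetCard.ofFinEmbEquiv.symm S k))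
  refine h2.trans ?_
  rw [smul_eq_mul]
  congr 1
  rw [Set.powersetCard.ofFinEmbEquiv_symm_apply]
  have h3 : S.1 = Finset.univ.map (S.1.orderEmbOfFin S.2).toEmbedding := by
    rw [← Finset.coe_inj, Finset.coe_map, Finset.coe_univ, Set.image_univ]
    exact (S.1.range_orderEmbOfFin S.2).symm
  conv_rhs => rw [h3, Finset.prod_map]
  rfl

/-- The dimension of the space of invariant forms is the number of sets of eigenvectors whose
characters multiply to `1`. -/
theorem finrank_invForms_eq_card [Finite I] {a b : Iso ι} {u : Basis I ℂ (ι → ℂ)} {χ ψ : I → ℂ}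
    (ha : Diagonalizes a u χ) (hb : Diagonalizes b u ψ) (p : ℕ) :
    finrank ℂ (invForms (Subgroup.closure {a, b} ⊔ latticeTranslations ι) ℂ p) =
      Nat.card {S : Finset I // S.card = p ∧ ∏ i ∈ S, χ i = 1 ∧ ∏ i ∈ S, ψ i = 1} := by
  classical
  let : LinearOrder I := linearOrderOfSTO WellOrderingRel
  set V := invForms (Subgroup.closure {a, b} ⊔ latticeTranslations ι) ℂ p with hV
  let P : Set.powersetCard I p → Prop := fun S => ∏ i ∈ S.1, χ i = 1 ∧ ∏ i ∈ S.1, ψ i = 1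
  -- In coordinates, invariance means that each coefficient equals its multiple by either eigenvalue
  -- product, so it vanishes unless both products are 1.
  have hW : ∀ f, f ∈ V.map (formCoord (p := p) u).toLinearMap ↔ ∀ S, ¬ P S → f S = 0 := by
    intro f
    obtain ⟨c, rfl⟩ := (formCoord (p := p) u).surjective f
    have h1 : formCoord u c ∈ V.map (formCoord (p := p) u).toLinearMap ↔ c ∈ V :=
      ⟨fun ⟨c', hc', h⟩ => (formCoord u).injective h ▸ hc', fun h => ⟨c, h, rfl⟩⟩
    rw [h1, hV, mem_invForms_closure_sup_iff]
    simp only [Set.mem_insert_iff, Set.mem_singleton_iff, forall_eq_or_imp, forall_eq]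
    rw [← (formCoord (p := p) u).injective.eq_iff, ← (formCoord (p := p) u).injective.eq_iff,
      funext_iff, funext_iff]
    simp only [ha.formCoord_comp, hb.formCoord_comp, P]
    rw [← forall_and]
    refine forall_congr' fun S => ?_
    by_cases h0 : formCoord u c S = 0
    · simp [h0]
    · simp [h0]
  have h2 := finrank_supported P _ hW
  rw [← (LinearEquiv.finrank_map_eq (formCoord (p := p) u) V)]
  refine h2.trans (Nat.card_congr ?_)
  exact
    { toFun := fun S => ⟨S.1.1, S.1.2, S.2⟩
      invFun := fun S => ⟨⟨S.1, S.2.1⟩, S.2.2⟩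
      left_inv := fun _ => rfl
      right_inv := fun _ => rfl }

/-- The basis of `ℂ^(ι ⊕ κ)` made of a basis of `ℂ^ι` and the canonical basis of `ℂ^κ`. -/
def sumBasis (κ : Type) [Fintype κ] (u : Basis I ℂ (ι → ℂ)) : Basis (I ⊕ κ) ℂ (ι ⊕ κ → ℂ) :=
  (u.prod (Pi.basisFun ℂ κ)).map (LinearEquiv.sumArrowLequivProdArrow ι κ ℂ ℂ).symm

theorem linearIsometryEquiv_eq_sub (g : Iso ι) (x : Euc ι) :
    g.linearIsometryEquiv x = g x - g 0 := by
  have := g.map_vsub x 0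
  simpa using this

/-- The torus factor contributes the canonical basis vectors, all with eigenvalue 1. -/
theorem Diagonalizes.prodLeft {κ : Type} [Fintype κ] {a : Iso ι} {u : Basis I ℂ (ι → ℂ)}
    {χ : I → ℂ} (h : Diagonalizes a u χ) :
    Diagonalizes (prodLeft (κ := κ) a) (sumBasis κ u) (Sum.elim χ 1) := by
  obtain ⟨T, hT, hu⟩ := h
  let E := LinearEquiv.sumArrowLequivProdArrow ι κ ℂ ℂ
  refine ⟨E.symm.toLinearMap ∘ₗ (T.prodMap LinearMap.id) ∘ₗ E.toLinearMap, fun x => ?_, ?_⟩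
  · funext i
    rcases i with i | i
    · have h1 : FlatManifold.prodLeft (κ := κ) a 0 (.inl i) = a 0 i := rfl
      have h2 := congrFun (hT (WithLp.toLp 2 fun i => x (.inl i))) i
      rw [toComplexVec_apply, linearIsometryEquiv_eq_sub] at h2 ⊢
      rw [PiLp.sub_apply, prodLeft_inl, h1]
      exact h2
    · rw [toComplexVec_apply, linearIsometryEquiv_eq_sub, PiLp.sub_apply, prodLeft_inr,
        prodLeft_inr]
      simp [E]
  · intro i
    simp only [LinearMap.comp_apply, LinearEquiv.coe_coe, sumBasis, Basis.map_apply, E,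
      LinearEquiv.apply_symm_apply]
    rw [← map_smul]
    congr 1
    rcases i with i | i
    · simp [hu]
    · simp

end Diagonal

/-! ### Combinatorics of the eigenvalue count. -/

section Counting

open Finset

/-- The number of `p`-element sets of indices whose characters multiply to `1`. -/
def goodCard {I : Type} (χ ψ : I → ℂ) (p : ℕ) : ℕ :=
  Nat.card {S : Finset I // S.card = p ∧ ∏ i ∈ S, χ i = 1 ∧ ∏ i ∈ S, ψ i = 1}

open Classical in
theorem goodCard_eq_card_filter {I : Type} [Fintype I] (χ ψ : I → ℂ) (p : ℕ) :
    goodCard χ ψ p = #{S : Finset I | S.card = p ∧ ∏ i ∈ S, χ i = 1 ∧ ∏ i ∈ S, ψ i = 1} := by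
  rw [goodCard, Nat.card_eq_fintype_card, Fintype.card_subtype]

/-- The combinatorial Künneth formula: a subset of `I ⊕ κ` is a pair of subsets, of which the second
does not affect the products and is a free choice of `h - i` elements. -/
theorem goodCard_sum {I κ : Type} [Fintype I] [Fintype κ] (χ ψ : I → ℂ) (h : ℕ) :
    goodCard (Sum.elim χ (1 : κ → ℂ)) (Sum.elim ψ (1 : κ → ℂ)) h =
      ∑ i ∈ range (min h (Fintype.card I) + 1),
        goodCard χ ψ i * Nat.choose (Fintype.card κ) (h - i) := by
  classical
  have hprod : ∀ (χ : I → ℂ) (S : Finset (I ⊕ κ)),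
      ∏ i ∈ S, Sum.elim χ (1 : κ → ℂ) i = ∏ i ∈ S.toLeft, χ i := by
    intro χ S
    conv_lhs => rw [← S.toLeft_disjSum_toRight, prod_disjSum]
    simp
  rw [goodCard_eq_card_filter]
  simp only [hprod]
  rw [card_eq_sum_card_fiberwise (f := fun S : Finset (I ⊕ κ) => S.toLeft.card)
    (t := range (min h (Fintype.card I) + 1))]
  · refine sum_congr rfl fun i hi => ?_
    rw [goodCard_eq_card_filter, ← card_univ (α := κ), ← card_powersetCard, ← card_product]
    have hih : i ≤ h := by
      have := mem_range.mp hi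
      omega
    refine card_nbij' (fun S => (S.toLeft, S.toRight)) (fun q => q.1.disjSum q.2) ?_ ?_ ?_ ?_
    · intro S hS
      simp only [coe_filter, mem_filter, mem_univ, true_and, Set.mem_ofPred_eq] at hS
      have := S.card_toLeft_add_card_toRight
      simp only [mem_coe, mem_product, mem_filter, mem_univ, true_and, mem_powersetCard,
        subset_univ]
      exact ⟨⟨hS.2, hS.1.2⟩, by omega⟩
    · rintro ⟨A, B⟩ hAB
      simp only [mem_coe, mem_product, mem_filter, mem_univ, true_and, mem_powersetCard,
        subset_univ] at hAB
      simp only [coe_filter, mem_filter, mem_univ, true_and, Set.mem_ofPred_eq, card_disjSum,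
        toLeft_disjSum]
      exact ⟨⟨by omega, hAB.1.2⟩, hAB.1.1⟩
    · intro S _
      exact S.toLeft_disjSum_toRight
    · rintro ⟨A, B⟩ _
      simp
  · intro S hS
    simp only [coe_filter, mem_univ, true_and, Set.mem_ofPred_eq] at hS
    have h1 := S.card_toLeft_add_card_toRight
    have h2 := card_le_univ S.toLeft
    simp only [coe_range, Set.mem_Iio]
    omega

theorem I_pow_eq_one_iff (n : ℕ) : Complex.I ^ n = 1 ↔ 4 ∣ n := by
  rw [← orderOf_dvd_iff_pow_eq_one]
  have : orderOf Complex.I = 4 := by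
    refine (orderOf_eq_iff (by norm_num)).mpr ⟨Complex.I_pow_four, fun m hm hm0 => ?_⟩
    interval_cases m
    · exact fun h => by simpa using congrArg Complex.re h
    · rw [Complex.I_sq]; norm_num
    · rw [Complex.I_pow_three]
      exact fun h => by simpa using congrArg Complex.re h
  rw [this]

/-- For characters with values powers of `i` the count only involves integers. -/
theorem goodCard_eq_card_dvd {n : ℕ} (w z : Fin n → ℕ) (p : ℕ) :
    goodCard (fun i => Complex.I ^ w i) (fun i => Complex.I ^ z i) p =
      #{S ∈ powersetCard p (univ : Finset (Fin n)) | 4 ∣ ∑ i ∈ S, w i ∧ 4 ∣ ∑ i ∈ S, z i} := by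
  classical
  rw [goodCard_eq_card_filter]
  congr 1
  ext S
  simp [prod_pow_eq_pow_sum, I_pow_eq_one_iff, mem_powersetCard]

theorem sum_mul_choose_lt {f g : ℕ → ℕ} (hle : ∀ i ≤ 6, g i ≤ f i)
    (hlt : ∀ i, 0 < i → i < 6 → g i < f i) {k h : ℕ} (h0 : 0 < h) (h1 : h < k + 6) :
    ∑ i ∈ range (min h 6 + 1), g i * Nat.choose k (h - i) <
      ∑ i ∈ range (min h 6 + 1), f i * Nat.choose k (h - i) := by
  -- The index `max 1 (h - k)` lies strictly between 0 and 6, is at most `h`, and satisfies `h - i ≤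
  -- k`, so its binomial coefficient is positive.
  refine sum_lt_sum (fun i hi => Nat.mul_le_mul_right _ (hle i ?_)) ⟨max 1 (h - k), ?_, ?_⟩
  · have := mem_range.mp hi
    omega
  · rw [mem_range]
    omega
  · exact Nat.mul_lt_mul_of_pos_right (hlt _ (by omega) (by omega))
      (Nat.choose_pos (by omega))

end Counting

/-! ### Monomial operators and the dimension of fixed spaces. -/

section Twist

variable {X : Type*}

/-- The operator `c ↦ (x ↦ φ x * c (σ x))` on functions. -/
def twist (φ : X → ℂ) (σ : X → X) : Module.End ℂ (X → ℂ) where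
  toFun c x := φ x * c (σ x)
  map_add' _ _ := funext fun _ => mul_add _ _ _
  map_smul' _ _ := funext fun _ => mul_left_comm _ _ _

theorem twist_apply (φ : X → ℂ) (σ : X → X) (c : X → ℂ) (x : X) :
    twist φ σ c x = φ x * c (σ x) := rfl

theorem twist_mul (φ ψ : X → ℂ) (σ τ : X → X) (hψ : ∀ x, ψ (σ x) = ψ x) :
    twist φ σ * twist ψ τ = twist (φ * ψ) (τ ∘ σ) := by
  refine LinearMap.ext fun c => funext fun x => ?_
  simp only [Module.End.mul_apply, twist_apply, hψ, Pi.mul_apply, Function.comp_apply, mul_assoc]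

theorem twist_one_id : twist (1 : X → ℂ) id = 1 :=
  LinearMap.ext fun c => funext fun x => one_mul (c x)

theorem twist_pow (φ : X → ℂ) (σ : X → X) (hφ : ∀ x, φ (σ x) = φ x) (n : ℕ) :
    twist φ σ ^ n = twist (φ ^ n) σ^[n] := by
  induction n with
  | zero => rw [pow_zero, pow_zero, Function.iterate_zero, twist_one_id]
  | succ n ih =>
    rw [pow_succ', ih, twist_mul _ _ _ _ fun x => by simp only [Pi.pow_apply, hφ], pow_succ',
      Function.iterate_succ]

/-- The matrix is monomial, with diagonal entries only at the fixed points of `σ`. -/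
theorem trace_twist [Fintype X] [DecidableEq X] (φ : X → ℂ) (σ : X → X) :
    LinearMap.trace ℂ (X → ℂ) (twist φ σ) = ∑ x, if σ x = x then φ x else 0 := by
  rw [LinearMap.trace_eq_matrix_trace ℂ (Pi.basisFun ℂ X), Matrix.trace]
  refine Finset.sum_congr rfl fun x _ => ?_
  rw [Matrix.diag_apply, LinearMap.toMatrix_apply]
  simp [twist_apply, Pi.single_apply]

end Twist

section FixedPoints

open Finset

variable {V : Type*} [AddCommGroup V] [Module ℂ V] [Module.Finite ℂ V]

/-- The dimension of the space of fixed points of a representation of `ℤ/4 × ℤ/2`. -/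
theorem eight_mul_finrank_fixed {A B : Module.End ℂ V} (hA : A ^ 4 = 1) (hB : B ^ 2 = 1)
    (hAB : A * B = B * A) {W : Submodule ℂ V} (hW : ∀ v, v ∈ W ↔ A v = v ∧ B v = v) :
    (8 : ℂ) * Module.finrank ℂ W =
      ∑ i ∈ range 4, ∑ j ∈ range 2, LinearMap.trace ℂ V (A ^ i * B ^ j) := by
  set P : Module.End ℂ V := ∑ i ∈ range 4, ∑ j ∈ range 2, A ^ i * B ^ j with hP
  have h1 : A * P = P := by
    simp only [hP, sum_range_succ, sum_range_zero, mul_add, ← mul_assoc, ← pow_succ', hA,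
      zero_add, pow_zero, pow_one, one_mul, mul_one]
    simp only [sq]
    abel
  have hBA : ∀ i : ℕ, B * A ^ i = A ^ i * B := fun i =>
    ((show Commute A B from hAB).pow_left i).symm
  have h2 : B * P = P := by
    have hB' : B * B = 1 := by rw [← sq, hB]
    simp only [hP, sum_range_succ, sum_range_zero, mul_add, ← mul_assoc, hBA, ← hAB, zero_add,
      pow_one, pow_zero, mul_one, one_mul]
    simp only [mul_assoc, hB', mul_one]
    abel
  -- The average over the group is a projection onto the fixed vectors, and the trace of a
  -- projection is its rank.
  have h3 : LinearMap.IsProj W ((8 : ℂ)⁻¹ • P) := by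
    constructor
    · intro v
      rw [hW, LinearMap.smul_apply, map_smul, map_smul, ← Module.End.mul_apply,
        ← Module.End.mul_apply, h1, h2]
      exact ⟨rfl, rfl⟩
    · intro v hv
      obtain ⟨hAv, hBv⟩ := (hW v).mp hv
      have hi : ∀ i : ℕ, (A ^ i) v = v := fun i => by
        induction i with
        | zero => rfl
        | succ i ih => rw [pow_succ, Module.End.mul_apply, hAv, ih]
      have hj : ∀ i : ℕ, (B ^ i) v = v := fun i => by
        induction i with
        | zero => rfl
        | succ i ih => rw [pow_succ, Module.End.mul_apply, hBv, ih]
      simp only [hP, LinearMap.smul_apply, LinearMap.sum_apply, Module.End.mul_apply, hi, hj,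
        sum_const, card_range]
      module
  have h4 := h3.trace
  rw [map_smul, smul_eq_mul] at h4
  rw [← h4, mul_inv_cancel_left₀ (by norm_num), hP]
  simp only [map_sum]

end FixedPoints

/-! ### Eigenfunctions of the Laplacian as trigonometric polynomials. -/

section Functions

open Finset

variable {ι : Type} [Fintype ι]

/-- The integral vectors whose characters are eigenfunctions for `lam`. -/
abbrev LatticeSphere (ι : Type) [Fintype ι] (lam : ℝ) : Type :=
  {m : ι → ℤ // 4 * Real.pi ^ 2 * ∑ i, (m i : ℝ) ^ 2 = lam}

theorem finite_latticeSphere (lam : ℝ) : Finite (LatticeSphere ι lam) := by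
  classical
  have h : ∀ m : LatticeSphere ι lam, ∀ i, m.1 i ∈ Set.Icc (-⌈|lam|⌉) ⌈|lam|⌉ := by
    rintro ⟨m, hm⟩ i
    have h1 : (m i : ℝ) ^ 2 ≤ |lam| := by
      have h2 := single_le_sum (f := fun i => (m i : ℝ) ^ 2) (fun i _ => sq_nonneg _) (mem_univ i)
      -- This crude bound suffices for |m i| ≤ (m i)² ≤ |lam|, which confines every coordinate to a
      -- finite interval.
      have h3 : (1 : ℝ) ≤ 4 * Real.pi ^ 2 := by nlinarith [Real.pi_gt_three]
      have h4 : 0 ≤ ∑ i, (m i : ℝ) ^ 2 := sum_nonneg fun i _ => sq_nonneg _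
      have h5 : 4 * Real.pi ^ 2 * ∑ i, (m i : ℝ) ^ 2 = lam := hm
      calc (m i : ℝ) ^ 2 ≤ ∑ i, (m i : ℝ) ^ 2 := h2
        _ ≤ lam := by nlinarith
        _ ≤ |lam| := le_abs_self lam
    have h2 : |m i| ≤ m i ^ 2 := by
      rw [← sq_abs]
      rcases (abs_nonneg (m i)).eq_or_lt with h | h
      · rw [← h]; norm_num
      · nlinarith
    have h3 : |m i| ≤ ⌈|lam|⌉ := by
      have h4 : ((m i ^ 2 : ℤ) : ℝ) ≤ (⌈|lam|⌉ : ℤ) := by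
        push_cast
        exact h1.trans (Int.le_ceil _)
      exact h2.trans (by exact_mod_cast h4)
    exact abs_le.mp h3
  exact Finite.of_injective (fun m i => (⟨m.1 i, h m i⟩ : Set.Icc (-⌈|lam|⌉) ⌈|lam|⌉))
    fun m k hmk => Subtype.ext (funext fun i => congrArg Subtype.val (congrFun hmk i))

/-- The trigonometric polynomial with given coefficients, as a form of degree zero. -/
def trigForm {lam : ℝ} [Fintype (LatticeSphere ι lam)] :
    (LatticeSphere ι lam → ℂ) →ₗ[ℂ] Forms ι ℂ 0 where
  toFun c := fun x => ContinuousAlternatingMap.constOfIsEmpty ℝ (Euc ι) (Fin 0)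
    (∑ m, c m * expChar m.1 x)
  map_add' c d := by
    funext x
    ext v
    change ∑ m, (c m + d m) * expChar m.1 x = _ + _
    simp only [add_mul, sum_add_distrib]
    rfl
  map_smul' r c := by
    funext x
    ext v
    change ∑ m, (r * c m) * expChar m.1 x = r * ∑ m, c m * expChar m.1 x
    rw [mul_sum]
    exact sum_congr rfl fun m _ => mul_assoc _ _ _

theorem sum_expChar_injective {lam : ℝ} [Fintype (LatticeSphere ι lam)]
    {c d : LatticeSphere ι lam → ℂ}
    (h : ∀ x, ∑ m, c m * expChar m.1 x = ∑ m, d m * expChar m.1 x) : c = d := by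
  classical
  have key : ∀ c : LatticeSphere ι lam → ℂ, ∀ k : LatticeSphere ι lam,
      torusCoeff (fun x => ∑ m, c m * expChar m.1 x) k.1 = c k := by
    intro c k
    let S : Finset (ι → ℤ) := univ.map (Function.Embedding.subtype _ : LatticeSphere ι lam ↪ _)
    let c' : (ι → ℤ) → ℂ := fun m => if h : _ then c ⟨m, h⟩ else 0
    have h1 := torusCoeff_sum_expChar S c' k.1
    have h2 : ∀ x, ∑ m ∈ S, c' m * expChar m x = ∑ m, c m * expChar m.1 x := fun x => by
      rw [sum_map]
      refine sum_congr rfl fun m _ => ?_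
      simp only [c', Function.Embedding.subtype_apply]
      rw [dif_pos m.2]
    simp only [h2] at h1
    rw [h1, if_pos (by simp [S])]
    simp only [c']
    rw [dif_pos k.2]
  funext k
  rw [← key c k, ← key d k]
  simp only [h]

theorem trigForm_injective {lam : ℝ} [Fintype (LatticeSphere ι lam)] :
    Function.Injective (trigForm : (LatticeSphere ι lam → ℂ) →ₗ[ℂ] Forms ι ℂ 0) := by
  intro c d h
  exact sum_expChar_injective fun x => congrArg (fun ω => ω ![]) (congrFun h x)

/-- How an isometry with integral linear part acts on the characters of the torus. -/
structure CharAction (a : Iso ι) (σ : (ι → ℤ) → ι → ℤ) (φ : (ι → ℤ) → ℂ) : Prop where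
  sum_sq : ∀ m, ∑ i, (σ m i) ^ 2 = ∑ i, (m i) ^ 2
  injective : Function.Injective σ
  -- The phase stands next to the composed character, so `φ m` is inverse to the phase produced by
  -- `a`. With this convention a polynomial with coefficients `c` is invariant when `φ m * c (σ m) =
  -- c m`.
  expChar : ∀ m x, φ m * expChar m (a x) = expChar (σ m) x

theorem CharAction.mem_sphere {a : Iso ι} {σ : (ι → ℤ) → ι → ℤ} {φ : (ι → ℤ) → ℂ}
    (h : CharAction a σ φ) {lam : ℝ} (m : ι → ℤ)
    (hm : 4 * Real.pi ^ 2 * ∑ i, (m i : ℝ) ^ 2 = lam) :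
    4 * Real.pi ^ 2 * ∑ i, (σ m i : ℝ) ^ 2 = lam := by
  rw [← hm]
  congr 1
  exact_mod_cast h.sum_sq m

/-- The action on coefficients of trigonometric polynomials. -/
def CharAction.op {a : Iso ι} {σ : (ι → ℤ) → ι → ℤ} {φ : (ι → ℤ) → ℂ}
    (h : CharAction a σ φ) (lam : ℝ) : Module.End ℂ (LatticeSphere ι lam → ℂ) :=
  twist (fun m => φ m.1) (Subtype.map σ h.mem_sphere)

theorem CharAction.pullback_eq_iff {a : Iso ι} {σ : (ι → ℤ) → ι → ℤ} {φ : (ι → ℤ) → ℂ}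
    (h : CharAction a σ φ) {lam : ℝ} [Fintype (LatticeSphere ι lam)]
    (c : LatticeSphere ι lam → ℂ) :
    pullback a (trigForm c : Euc ι → Euc ι [⋀^Fin 0]→L[ℝ] ℂ) = trigForm c ↔ h.op lam c = c := by
  have hb : Function.Bijective (Subtype.map σ h.mem_sphere : LatticeSphere ι lam → _) :=
    Finite.injective_iff_bijective.mp (Subtype.map_injective _ h.injective)
  -- After reindexing by `σ`, the operator on coefficients corresponds to the inverse of pull-back
  -- by `a`, which has the same fixed vectors.
  have h1 : ∀ x, ∑ m, h.op lam c m * FlatManifold.expChar m.1 (a x) =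
      ∑ m, c m * FlatManifold.expChar m.1 x := by
    intro x
    refine Fintype.sum_equiv (Equiv.ofBijective _ hb) _ _ fun m => ?_
    change φ m.1 * c _ * _ = c _ * FlatManifold.expChar (σ m.1) x
    rw [← h.expChar]
    change φ m.1 * c (Subtype.map σ h.mem_sphere m) * _ =
      c (Subtype.map σ h.mem_sphere m) * _
    ring
  constructor
  · intro hp
    refine sum_expChar_injective fun y => ?_
    obtain ⟨x, rfl⟩ := a.surjective y
    rw [h1]
    exact (congrArg (fun ω : Euc ι [⋀^Fin 0]→L[ℝ] ℂ => ω ![]) (congrFun hp x)).symm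
  · intro hc
    funext x
    ext v
    change ∑ m, c m * FlatManifold.expChar m.1 (a x) = ∑ m, c m * FlatManifold.expChar m.1 x
    rw [hc] at h1
    exact h1 x

theorem contDiff_trigForm {lam : ℝ} [Fintype (LatticeSphere ι lam)]
    (c : LatticeSphere ι lam → ℂ) :
    ContDiff ℝ (⊤ : ℕ∞) (trigForm c : Euc ι → Euc ι [⋀^Fin 0]→L[ℝ] ℂ) :=
  (ContinuousAlternatingMap.constOfIsEmptyLIE ℝ (Euc ι) ℂ (Fin 0)).contDiff.comp
    (ContDiff.sum fun m _ => contDiff_const.mul (contDiff_expChar m.1))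

theorem isPeriodic_trigForm {lam : ℝ} [Fintype (LatticeSphere ι lam)]
    (c : LatticeSphere ι lam → ℂ) :
    IsPeriodic (trigForm c : Euc ι → Euc ι [⋀^Fin 0]→L[ℝ] ℂ) := by
  intro k x
  change ContinuousAlternatingMap.constOfIsEmpty ℝ (Euc ι) (Fin 0) _ =
    ContinuousAlternatingMap.constOfIsEmpty ℝ (Euc ι) (Fin 0) _
  simp only [isPeriodic_expChar _ k x]

theorem fderiv_sum_expChar [DecidableEq ι] {lam : ℝ} [Fintype (LatticeSphere ι lam)]
    (c : LatticeSphere ι lam → ℂ) (x : Euc ι) (i : ι) :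
    fderiv ℝ (fun y => ∑ m, c m * expChar m.1 y) x (EuclideanSpace.single i 1) =
      ∑ m, c m * (2 * Real.pi * Complex.I * m.1 i) * expChar m.1 x := by
  have hd : ∀ m : LatticeSphere ι lam, DifferentiableAt ℝ (expChar m.1) x := fun m =>
    (contDiff_expChar m.1).differentiable (by simp) x
  rw [fderiv_fun_sum fun m _ => (hd m).const_mul (c m), _root_.sum_apply]
  refine sum_congr rfl fun m _ => ?_
  rw [fderiv_const_mul (hd m), smul_apply, fderiv_expChar, smul_eq_mul]
  ring

theorem hodgeLaplacian_trigForm [DecidableEq ι] {lam : ℝ} [Fintype (LatticeSphere ι lam)]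
    (c : LatticeSphere ι lam → ℂ) (x : Euc ι) :
    hodgeLaplacian (trigForm c : Euc ι → Euc ι [⋀^Fin 0]→L[ℝ] ℂ) x =
      (lam : ℂ) • (trigForm c : Euc ι → Euc ι [⋀^Fin 0]→L[ℝ] ℂ) x := by
  let T : ℂ →L[ℝ] Euc ι [⋀^Fin 0]→L[ℝ] ℂ :=
    (ContinuousAlternatingMap.constOfIsEmptyLIE ℝ (Euc ι) ℂ
      (Fin 0)).toContinuousLinearEquiv.toContinuousLinearMap
  have hf : ContDiff ℝ (⊤ : ℕ∞) fun x => ∑ m, c m * expChar m.1 x :=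
    ContDiff.sum fun m _ => contDiff_const.mul (contDiff_expChar m.1)
  rw [hodgeLaplacian_eq (contDiff_trigForm c)]
  refine (coeffLaplacian_clm T hf x).trans ?_
  have h1 : coeffLaplacian (fun x => ∑ m, c m * expChar m.1 x) x =
      lam * ∑ m, c m * expChar m.1 x := by
    simp only [coeffLaplacian, fderiv_sum_expChar]
    rw [sum_comm, ← sum_neg_distrib, mul_sum]
    refine sum_congr rfl fun m _ => ?_
    rw [← sum_mul]
    have h2 := congrArg (fun r : ℝ => (r : ℂ)) m.2
    rw [← h2]
    push_cast
    simp only [mul_assoc, ← mul_sum]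
    simp only [mul_sum, sum_mul, ← sum_neg_distrib]
    refine sum_congr rfl fun i _ => ?_
    linear_combination (-4 * c m * Real.pi ^ 2 * (m.1 i) ^ 2 * expChar m.1 x) * Complex.I_sq
  rw [h1]
  ext v
  rfl

/-- Periodicity and the eigenvalue equation together say exactly that the function is a
trigonometric polynomial with frequencies on the sphere; only invariance under the remaining
generators is left as a condition. -/
theorem mem_eigenforms_zero_iff [DecidableEq ι] {s : Set (Iso ι)} {lam : ℝ}
    [Fintype (LatticeSphere ι lam)] {ω : Forms ι ℂ 0} :
    ω ∈ eigenforms (Subgroup.closure s ⊔ latticeTranslations ι) 0 lam ↔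
      ∃ c : LatticeSphere ι lam → ℂ, trigForm c = ω ∧
        ∀ g ∈ s, pullback g (ω : Euc ι → Euc ι [⋀^Fin 0]→L[ℝ] ℂ) = ω := by
  constructor
  · rintro ⟨⟨hs, hω⟩, hl⟩
    obtain ⟨hg, hp⟩ := pullback_closure_sup_iff.mp hω
    let T : (Euc ι [⋀^Fin 0]→L[ℝ] ℂ) →L[ℝ] ℂ := ContinuousAlternatingMap.apply ℝ (Euc ι) ℂ ![]
    let f : Euc ι → ℂ := fun x => T (ω x)
    have hpf : IsPeriodic f := fun m x => congrArg T (hp m x)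
    have hsf : ContDiff ℝ (⊤ : ℕ∞) f := T.contDiff.comp hs
    have hlf : ∀ x, coeffLaplacian f x = (lam : ℂ) * f x := fun x => by
      rw [coeffLaplacian_clm T hs, ← hodgeLaplacian_eq hs, hl]
      rfl
    let S : Finset (ι → ℤ) := univ.map (Function.Embedding.subtype _ : LatticeSphere ι lam ↪ _)
    have h1 := eigenfunction_eq_sum hpf hsf hlf (S := S) fun m hm => by simpa [S] using hm
    refine ⟨fun m => torusCoeff f m.1, ?_, hg⟩
    funext x
    ext v
    have h2 : ω x v = f x := congrArg (ω x) (Subsingleton.elim v ![])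
    rw [h2, h1, sum_map]
    rfl
  · rintro ⟨c, rfl, hg⟩
    exact ⟨⟨contDiff_trigForm c, pullback_closure_sup_iff.mpr ⟨hg, isPeriodic_trigForm c⟩⟩,
      hodgeLaplacian_trigForm c⟩

/-- The multiplicity of an eigenvalue on functions, by counting characters of the torus. -/
theorem multiplicity_zeroForms [DecidableEq ι] {a b : Iso ι} {σ τ : (ι → ℤ) → ι → ℤ}
    {φ ψ : (ι → ℤ) → ℂ} (ha : CharAction a σ φ) (hb : CharAction b τ ψ)
    (hφσ : ∀ m, φ (σ m) = φ m) (hφτ : ∀ m, φ (τ m) = φ m) (hψσ : ∀ m, ψ (σ m) = ψ m)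
    (hψτ : ∀ m, ψ (τ m) = ψ m) (hφ : ∀ m, φ m ^ 4 = 1) (hψ : ∀ m, ψ m ^ 2 = 1)
    (hσ : ∀ m, σ^[4] m = m) (hτ : ∀ m, τ^[2] m = m) (hστ : ∀ m, σ (τ m) = τ (σ m)) (lam : ℝ)
    [Fintype (LatticeSphere ι lam)] :
    ∃ d : ℕ, multiplicity (Subgroup.closure {a, b} ⊔ latticeTranslations ι) 0 lam = d ∧
      (8 : ℂ) * d = ∑ i ∈ range 4, ∑ j ∈ range 2, ∑ m : LatticeSphere ι lam,
        if τ^[j] (σ^[i] m.1) = m.1 then φ m.1 ^ i * ψ m.1 ^ j else 0 := by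
  classical
  have hit : ∀ {a : Iso ι} {σ : (ι → ℤ) → ι → ℤ} {φ : (ι → ℤ) → ℂ} (h : CharAction a σ φ) (n : ℕ)
      (m : LatticeSphere ι lam), ((Subtype.map σ h.mem_sphere)^[n] m).1 = σ^[n] m.1 := by
    intro a σ φ h n m
    induction n with
    | zero => rfl
    | succ n ih =>
      rw [Function.iterate_succ_apply', Function.iterate_succ_apply', ← ih]
      rfl
  let W : Submodule ℂ (LatticeSphere ι lam → ℂ) :=
    (eigenforms (Subgroup.closure {a, b} ⊔ latticeTranslations ι) 0 lam).comap trigForm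
  have hW : ∀ c, c ∈ W ↔ ha.op lam c = c ∧ hb.op lam c = c := by
    intro c
    rw [← ha.pullback_eq_iff, ← hb.pullback_eq_iff, Submodule.mem_comap, mem_eigenforms_zero_iff]
    simp only [Set.mem_insert_iff, Set.mem_singleton_iff, forall_eq_or_imp, forall_eq]
    exact ⟨fun ⟨_, _, h⟩ => h, fun h => ⟨c, rfl, h⟩⟩
  have hmap : W.map trigForm =
      eigenforms (Subgroup.closure {a, b} ⊔ latticeTranslations ι) 0 lam := by
    refine Submodule.map_comap_eq_self fun ω hω => ?_
    obtain ⟨c, hc, -⟩ := mem_eigenforms_zero_iff.mp hω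
    exact ⟨c, hc⟩
  refine ⟨Module.finrank ℂ W, ?_, ?_⟩
  · rw [Module.finrank_eq_rank, multiplicity, ← hmap]
    exact (Submodule.equivMapOfInjective trigForm trigForm_injective W).rank_eq.symm
  -- The operators of `a` and `b` define a representation of ℤ/4 × ℤ/2, and each product of powers
  -- is again a monomial operator.
  · rw [eight_mul_finrank_fixed (A := ha.op lam) (B := hb.op lam) ?_ ?_ ?_ hW]
    · refine sum_congr rfl fun i _ => sum_congr rfl fun j _ => ?_
      have hψσ' : ∀ m, ψ (σ^[i] m) = ψ m := fun m => by
        clear * - hψσ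
        induction i with
        | zero => rfl
        | succ i ih => rw [Function.iterate_succ_apply', hψσ, ih]
      rw [CharAction.op, CharAction.op, twist_pow _ _ fun m => hφσ m.1,
        twist_pow _ _ fun m => hψτ m.1, twist_mul, trace_twist]
      · refine sum_congr rfl fun m _ => ?_
        simp only [Function.comp_apply, Subtype.ext_iff, hit ha, hit hb, Pi.mul_apply, Pi.pow_apply]
      · intro m
        simp only [Pi.pow_apply, hit ha, hψσ']
    · rw [CharAction.op, twist_pow _ _ fun m => hφσ m.1, ← twist_one_id]
      congr 1
      · exact funext fun m => hφ m.1
      · exact funext fun m => Subtype.ext ((hit ha 4 m).trans (hσ m.1))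
    · rw [CharAction.op, twist_pow _ _ fun m => hψτ m.1, ← twist_one_id]
      congr 1
      · exact funext fun m => hψ m.1
      · exact funext fun m => Subtype.ext ((hit hb 2 m).trans (hτ m.1))
    · rw [CharAction.op, CharAction.op, twist_mul _ _ _ _ fun m => hψσ m.1,
        twist_mul _ _ _ _ fun m => hφτ m.1, mul_comm]
      congr 1
      exact funext fun m => Subtype.ext (hστ m.1).symm

end Functions

/-! ### The generators in coordinates and their action on characters. -/

section Generators

/-- The generator `B₁ L_{e₅/4}` of `Γ`. -/
def genA : Iso (Fin 6) := rigid B₁ !₂[0, 0, 0, 0, 1 / 4, 0]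

/-- The generator `B₂ L_{e₆/2}` of `Γ`. -/
def genB : Iso (Fin 6) := rigid B₂ !₂[0, 0, 0, 0, 0, 1 / 2]

/-- The generator `B₁' L_{e₆/4}` of `Γ'`. -/
def genA' : Iso (Fin 6) := rigid B₁' !₂[0, 0, 0, 0, 0, 1 / 4]

/-- The generator `B₂' L_{(e₄+e₅)/2}` of `Γ'`. -/
def genB' : Iso (Fin 6) := rigid B₂' !₂[0, 0, 0, 1 / 2, 1 / 2, 0]

theorem genA_apply (x : Euc (Fin 6)) :
    genA x = !₂[x 1, -x 0, x 3, -x 2, x 4 + 1 / 4, x 5] := by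
  ext i
  rw [genA, rigid_apply]
  fin_cases i <;> simp [B₁, Fin.sum_univ_six]

theorem genB_apply (x : Euc (Fin 6)) :
    genB x = !₂[-x 0, -x 1, x 2, x 3, x 4, x 5 + 1 / 2] := by
  ext i
  rw [genB, rigid_apply]
  fin_cases i <;> simp [B₂, Matrix.diagonal_apply]

theorem genA'_apply (x : Euc (Fin 6)) :
    genA' x = !₂[x 1, -x 0, x 2, -x 3, -x 4, x 5 + 1 / 4] := by
  ext i
  rw [genA', rigid_apply]
  fin_cases i <;> simp [B₁', Fin.sum_univ_six]

theorem genB'_apply (x : Euc (Fin 6)) :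
    genB' x = !₂[-x 0, -x 1, -x 2, x 3 + 1 / 2, -x 4 - 1 / 2, x 5] := by
  ext i
  rw [genB', rigid_apply]
  fin_cases i <;> simp [B₂', Matrix.diagonal_apply, sub_eq_add_neg, add_comm]

end Generators

section Characters

open Finset

theorem I_zpow_congr {m n : ℤ} (h : 4 ∣ m - n) : Complex.I ^ m = Complex.I ^ n := by
  obtain ⟨k, hk⟩ := h
  rw [show m = n + 4 * k by omega, zpow_add₀ Complex.I_ne_zero, zpow_mul,
    show Complex.I ^ (4 : ℤ) = 1 from Complex.I_pow_four, one_zpow, mul_one]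

/-- A translation by quarters contributes the phase exp(2πi q/4), the `q`-th power of `Complex.I`;
moved to the other side its exponent is `-q`. -/
theorem charAction_of_sum {ι : Type} [Fintype ι] {a : Iso ι} {σ : (ι → ℤ) → ι → ℤ}
    {q : (ι → ℤ) → ℤ} (h1 : ∀ m, ∑ i, (σ m i) ^ 2 = ∑ i, (m i) ^ 2)
    (h2 : Function.Injective σ)
    (h3 : ∀ m x, ∑ i, m i * a x i = ∑ i, σ m i * x i + (q m : ℝ) / 4) :
    CharAction a σ fun m => Complex.I ^ (-q m) := by
  refine ⟨h1, h2, fun m x => ?_⟩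
  rw [expChar, expChar, h3]
  have h4 : Complex.I ^ (-q m) = Complex.exp (((-q m : ℤ) : ℂ) * (Real.pi / 2 * Complex.I)) := by
    rw [Complex.exp_int_mul, Complex.exp_pi_div_two_mul_I]
  rw [h4, ← Complex.exp_add]
  congr 1
  push_cast
  ring

variable {k : ℕ}

/-- The action of `genA` on characters. -/
def dualA (m : Fin 6 ⊕ Fin k → ℤ) : Fin 6 ⊕ Fin k → ℤ :=
  Sum.elim ![-m (.inl 1), m (.inl 0), -m (.inl 3), m (.inl 2), m (.inl 4), m (.inl 5)]
    fun j => m (.inr j)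

/-- The action of `genB` on characters. -/
def dualB (m : Fin 6 ⊕ Fin k → ℤ) : Fin 6 ⊕ Fin k → ℤ :=
  Sum.elim ![-m (.inl 0), -m (.inl 1), m (.inl 2), m (.inl 3), m (.inl 4), m (.inl 5)]
    fun j => m (.inr j)

/-- The action of `genA'` on characters. -/
def dualA' (m : Fin 6 ⊕ Fin k → ℤ) : Fin 6 ⊕ Fin k → ℤ :=
  Sum.elim ![-m (.inl 1), m (.inl 0), m (.inl 2), -m (.inl 3), -m (.inl 4), m (.inl 5)]
    fun j => m (.inr j)

/-- The action of `genB'` on characters. -/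
def dualB' (m : Fin 6 ⊕ Fin k → ℤ) : Fin 6 ⊕ Fin k → ℤ :=
  Sum.elim ![-m (.inl 0), -m (.inl 1), -m (.inl 2), m (.inl 3), -m (.inl 4), m (.inl 5)]
    fun j => m (.inr j)

theorem sum_fin_six_ext {m n : Fin 6 ⊕ Fin k → ℤ} : m = n ↔
    (m (.inl 0) = n (.inl 0) ∧ m (.inl 1) = n (.inl 1) ∧ m (.inl 2) = n (.inl 2) ∧
      m (.inl 3) = n (.inl 3) ∧ m (.inl 4) = n (.inl 4) ∧ m (.inl 5) = n (.inl 5)) ∧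
      ∀ j, m (.inr j) = n (.inr j) := by
  rw [funext_iff, Sum.forall]
  simp [Fin.forall_fin_succ]

@[simp] theorem dualA_inl (m : Fin 6 ⊕ Fin k → ℤ) (i : Fin 6) : dualA m (.inl i) =
    ![-m (.inl 1), m (.inl 0), -m (.inl 3), m (.inl 2), m (.inl 4), m (.inl 5)] i := rfl
@[simp] theorem dualB_inl (m : Fin 6 ⊕ Fin k → ℤ) (i : Fin 6) : dualB m (.inl i) =
    ![-m (.inl 0), -m (.inl 1), m (.inl 2), m (.inl 3), m (.inl 4), m (.inl 5)] i := rfl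
@[simp] theorem dualA'_inl (m : Fin 6 ⊕ Fin k → ℤ) (i : Fin 6) : dualA' m (.inl i) =
    ![-m (.inl 1), m (.inl 0), m (.inl 2), -m (.inl 3), -m (.inl 4), m (.inl 5)] i := rfl
@[simp] theorem dualB'_inl (m : Fin 6 ⊕ Fin k → ℤ) (i : Fin 6) : dualB' m (.inl i) =
    ![-m (.inl 0), -m (.inl 1), -m (.inl 2), m (.inl 3), -m (.inl 4), m (.inl 5)] i := rfl
@[simp] theorem dualA_inr (m : Fin 6 ⊕ Fin k → ℤ) (j) : dualA m (.inr j) = m (.inr j) := rfl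
@[simp] theorem dualB_inr (m : Fin 6 ⊕ Fin k → ℤ) (j) : dualB m (.inr j) = m (.inr j) := rfl
@[simp] theorem dualA'_inr (m : Fin 6 ⊕ Fin k → ℤ) (j) : dualA' m (.inr j) = m (.inr j) := rfl
@[simp] theorem dualB'_inr (m : Fin 6 ⊕ Fin k → ℤ) (j) : dualB' m (.inr j) = m (.inr j) := rfl

theorem dualA_iterate_four (m : Fin 6 ⊕ Fin k → ℤ) : dualA^[4] m = m := by
  rw [sum_fin_six_ext]
  simp [Function.iterate_succ_apply']

theorem dualB_iterate_two (m : Fin 6 ⊕ Fin k → ℤ) : dualB^[2] m = m := by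
  rw [sum_fin_six_ext]
  simp [Function.iterate_succ_apply']

theorem dualA'_iterate_four (m : Fin 6 ⊕ Fin k → ℤ) : dualA'^[4] m = m := by
  rw [sum_fin_six_ext]
  simp [Function.iterate_succ_apply']

theorem dualB'_iterate_two (m : Fin 6 ⊕ Fin k → ℤ) : dualB'^[2] m = m := by
  rw [sum_fin_six_ext]
  simp [Function.iterate_succ_apply']

theorem charAction_genA : CharAction (prodLeft (κ := Fin k) genA) dualA
    fun m => Complex.I ^ (-m (.inl 4)) := by
  refine charAction_of_sum (q := fun m => m (Sum.inl 4)) (fun m => ?_) ?_ fun m x => ?_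
  · simp [Fin.sum_univ_six]
    ring
  -- A map with an iterate equal to the identity is injective.
  · exact (show Function.Injective dualA^[4] from
      (funext dualA_iterate_four : dualA^[4] = id) ▸ Function.injective_id).of_comp (f := dualA^[3])
  · simp [Fin.sum_univ_six, prodLeft_inl, prodLeft_inr, genA_apply]
    ring

theorem charAction_genB : CharAction (prodLeft (κ := Fin k) genB) dualB
    fun m => Complex.I ^ (-(2 * m (.inl 5))) := by
  refine charAction_of_sum (q := fun m => 2 * m (Sum.inl 5)) (fun m => ?_) ?_ fun m x => ?_
  · simp [Fin.sum_univ_six]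
  · exact (show Function.Injective dualB^[2] from
      (funext dualB_iterate_two : dualB^[2] = id) ▸ Function.injective_id).of_comp (f := dualB)
  · simp [Fin.sum_univ_six, prodLeft_inl, prodLeft_inr, genB_apply]
    ring

theorem charAction_genA' : CharAction (prodLeft (κ := Fin k) genA') dualA'
    fun m => Complex.I ^ (-m (.inl 5)) := by
  refine charAction_of_sum (q := fun m => m (Sum.inl 5)) (fun m => ?_) ?_ fun m x => ?_
  · simp [Fin.sum_univ_six]
    ring
  · exact (show Function.Injective dualA'^[4] from
      (funext dualA'_iterate_four : dualA'^[4] = id) ▸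
        Function.injective_id).of_comp (f := dualA'^[3])
  · simp [Fin.sum_univ_six, prodLeft_inl, prodLeft_inr, genA'_apply]
    ring

theorem charAction_genB' : CharAction (prodLeft (κ := Fin k) genB') dualB'
    fun m => Complex.I ^ (-(2 * m (.inl 3) - 2 * m (.inl 4))) := by
  -- The translation acts before the sign change, so coordinate 4 is moved by -1/2 and enters with a
  -- minus sign.
  refine charAction_of_sum (q := fun m => 2 * m (Sum.inl 3) - 2 * m (Sum.inl 4)) (fun m => ?_) ?_
    fun m x => ?_
  · simp [Fin.sum_univ_six]
  · exact (show Function.Injective dualB'^[2] from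
      (funext dualB'_iterate_two : dualB'^[2] = id) ▸ Function.injective_id).of_comp (f := dualB')
  · simp [Fin.sum_univ_six, prodLeft_inl, prodLeft_inr, genB'_apply]
    ring

theorem I_zpow_pow_four (m : ℤ) : (Complex.I ^ m) ^ 4 = 1 := by
  rw [← zpow_natCast, ← zpow_mul]
  exact (I_zpow_congr (n := 0) (by omega)).trans (zpow_zero _)

theorem I_zpow_two_mul_sq {m n : ℤ} (h : m = 2 * n) : (Complex.I ^ m) ^ 2 = 1 := by
  rw [← zpow_natCast, ← zpow_mul]
  exact (I_zpow_congr (n := 0) (by omega)).trans (zpow_zero _)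

/-- Permuting coordinates preserves |m|², hence maps each sphere of lattice vectors to itself.
Traces may thus be compared after relabelling coordinates. -/
theorem sum_permute {lam : ℝ} {ι : Type} [Fintype ι] [Fintype (LatticeSphere ι lam)]
    (e : Equiv.Perm ι) (f g : (ι → ℤ) → ℂ) (h : ∀ m, f m = g (fun i => m (e i))) :
    ∑ m : LatticeSphere ι lam, f m.1 = ∑ m : LatticeSphere ι lam, g m.1 := by
  refine Fintype.sum_equiv ((e.symm.arrowCongr (Equiv.refl ℤ)).subtypeEquiv fun m => ?_) _ _
    fun m => ?_
  · have : ∑ i, (m (e i) : ℝ) ^ 2 = ∑ i, (m i : ℝ) ^ 2 := Equiv.sum_comp e fun i => (m i : ℝ) ^ 2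
    simp [this]
  · exact h m.1

end Characters

/-! ### Matching the eight traces of the two groups. -/

section Isospectral

open Finset

variable {k : ℕ}

theorem ite_zero_congr {P Q : Prop} [Decidable P] [Decidable Q] {x y : ℂ} (h : P ↔ Q)
    (hxy : P → x = y) : (if P then x else 0) = if Q then y else 0 := by
  by_cases hP : P
  · rw [if_pos hP, if_pos (h.mp hP), hxy hP]
  · rw [if_neg hP, if_neg fun hQ => hP (h.mpr hQ)]

theorem I_zpow_pow_mul_congr {p q p' q' : ℤ} {i j i' j' : ℕ}
    (h : 4 ∣ p * i + q * j - (p' * i' + q' * j')) :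
    (Complex.I ^ p) ^ i * (Complex.I ^ q) ^ j = (Complex.I ^ p') ^ i' * (Complex.I ^ q') ^ j' := by
  simp only [← zpow_natCast, ← zpow_mul, ← zpow_add₀ Complex.I_ne_zero]
  exact I_zpow_congr h

/-- A permutation of the coordinates of `ℝ^6`, extended to `ℝ^6 × ℝ^k`. -/
def permLeft (e : Equiv.Perm (Fin 6)) : Equiv.Perm (Fin 6 ⊕ Fin k) :=
  Equiv.sumCongr e (Equiv.refl _)

@[simp] theorem permLeft_inl (e : Equiv.Perm (Fin 6)) (i : Fin 6) :
    permLeft (k := k) e (.inl i) = .inl (e i) := rfl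

@[simp] theorem permLeft_inr (e : Equiv.Perm (Fin 6)) (j : Fin k) :
    permLeft (k := k) e (.inr j) = .inr j := rfl

/-- The contribution of an integral vector to the trace of `A ^ i * B ^ j` for `Γ`. -/
def traceTerm (i j : ℕ) (m : Fin 6 ⊕ Fin k → ℤ) : ℂ :=
  if dualB^[j] (dualA^[i] m) = m then
    (Complex.I ^ (-m (.inl 4))) ^ i * (Complex.I ^ (-(2 * m (.inl 5)))) ^ j else 0

/-- The contribution of an integral vector to the trace of `A ^ i * B ^ j` for `Γ'`. -/
def traceTerm' (i j : ℕ) (m : Fin 6 ⊕ Fin k → ℤ) : ℂ :=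
  if dualB'^[j] (dualA'^[i] m) = m then
    (Complex.I ^ (-m (.inl 5))) ^ i *
      (Complex.I ^ (-(2 * m (.inl 3) - 2 * m (.inl 4)))) ^ j else 0

/-- The cyclic permutation `2 ↦ 5 ↦ 4 ↦ 2`. -/
def cycleCoord : Equiv.Perm (Fin 6) where
  toFun := ![0, 1, 5, 3, 2, 4]
  invFun := ![0, 1, 4, 3, 5, 2]
  left_inv := by decide
  right_inv := by decide

theorem traceTerm_zero_zero (m : Fin 6 ⊕ Fin k → ℤ) : traceTerm 0 0 m = traceTerm' 0 0 m := by
  simp [traceTerm, traceTerm']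

/-- Both B₂ and B₁'² equal diag(-1,-1,1,1,1,1), with a translation by e₆/2. -/
theorem traceTerm_zero_one (m : Fin 6 ⊕ Fin k → ℤ) :
    traceTerm 0 1 m = traceTerm' 2 0 fun i => m (permLeft (Equiv.refl _) i) := by
  refine ite_zero_congr ?_ fun hm => I_zpow_pow_mul_congr ?_
  · simp [sum_fin_six_ext, Function.iterate_succ_apply']
  · simp [sum_fin_six_ext] at hm
    simp
    lia

/-- B₁² and B₂' each fix two coordinates, one of which carries a half translation. The other half
translation of B₂' lies in a direction that is negated, where a fixed `m` vanishes. -/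
theorem traceTerm_two_zero (m : Fin 6 ⊕ Fin k → ℤ) :
    traceTerm 2 0 m = traceTerm' 0 1 fun i => m (permLeft (Equiv.swap 3 4) i) := by
  refine ite_zero_congr ?_ fun hm => I_zpow_pow_mul_congr ?_
  · simp [sum_fin_six_ext, Function.iterate_succ_apply', Equiv.swap_apply_def]
  · simp [sum_fin_six_ext, Function.iterate_succ_apply'] at hm
    simp [Equiv.swap_apply_def]
    lia

/-- Both elements fix four coordinates, with half translations along two of them. -/
theorem traceTerm_two_one (m : Fin 6 ⊕ Fin k → ℤ) :
    traceTerm 2 1 m = traceTerm' 2 1 fun i => m (permLeft (Equiv.swap 3 4) i) := by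
  refine ite_zero_congr ?_ fun hm => I_zpow_pow_mul_congr ?_
  · simp [sum_fin_six_ext, Function.iterate_succ_apply', Equiv.swap_apply_def]
  · simp [sum_fin_six_ext, Function.iterate_succ_apply'] at hm
    simp [Equiv.swap_apply_def]
    lia

/-- B₁ fixes coordinates 4 and 5 and translates 4 by a quarter; B₁' fixes 2 and 5 and translates 5.
`cycleCoord` makes the two pictures agree. -/
theorem traceTerm_one_zero (m : Fin 6 ⊕ Fin k → ℤ) :
    traceTerm 1 0 m = traceTerm' 1 0 fun i => m (permLeft (cycleCoord) i) := by
  refine ite_zero_congr ?_ fun hm => I_zpow_pow_mul_congr ?_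
  · simp [sum_fin_six_ext, cycleCoord]
    lia
  · simp [sum_fin_six_ext] at hm
    simp [cycleCoord]

theorem traceTerm_three_zero (m : Fin 6 ⊕ Fin k → ℤ) :
    traceTerm 3 0 m = traceTerm' 3 0 fun i => m (permLeft (cycleCoord) i) := by
  refine ite_zero_congr ?_ fun hm => I_zpow_pow_mul_congr ?_
  · simp [sum_fin_six_ext, Function.iterate_succ_apply', cycleCoord]
    lia
  · simp [sum_fin_six_ext, Function.iterate_succ_apply'] at hm
    simp [cycleCoord]

/-- Each element fixes exactly coordinates 4 and 5, with translations 1/4 and 1/2 that are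
interchanged between the two groups. -/
theorem traceTerm_one_one (m : Fin 6 ⊕ Fin k → ℤ) :
    traceTerm 1 1 m = traceTerm' 1 1 fun i => m (permLeft (Equiv.swap 4 5) i) := by
  refine ite_zero_congr ?_ fun hm => I_zpow_pow_mul_congr ?_
  · simp [sum_fin_six_ext, Equiv.swap_apply_def]
    lia
  · simp [sum_fin_six_ext] at hm
    simp [Equiv.swap_apply_def]
    lia

theorem traceTerm_three_one (m : Fin 6 ⊕ Fin k → ℤ) :
    traceTerm 3 1 m = traceTerm' 3 1 fun i => m (permLeft (Equiv.swap 4 5) i) := by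
  refine ite_zero_congr ?_ fun hm => I_zpow_pow_mul_congr ?_
  · simp [sum_fin_six_ext, Function.iterate_succ_apply', Equiv.swap_apply_def]
    lia
  · simp [sum_fin_six_ext, Function.iterate_succ_apply'] at hm
    simp [Equiv.swap_apply_def]
    lia


/-- The exponents (0,1) of one group are matched with (2,0) of the other and conversely; each
remaining pair is matched with itself. -/
theorem sum_traceTerm_eq (lam : ℝ) [Fintype (LatticeSphere (Fin 6 ⊕ Fin k) lam)] :
    ∑ i ∈ range 4, ∑ j ∈ range 2,
        ∑ m : LatticeSphere (Fin 6 ⊕ Fin k) lam, traceTerm i j m.1 =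
      ∑ i ∈ range 4, ∑ j ∈ range 2,
        ∑ m : LatticeSphere (Fin 6 ⊕ Fin k) lam, traceTerm' i j m.1 := by
  have h00 := sum_permute (lam := lam) (Equiv.refl _) _ _ (traceTerm_zero_zero (k := k))
  have h01 := sum_permute (lam := lam) _ _ _ (traceTerm_zero_one (k := k))
  have h20 := sum_permute (lam := lam) _ _ _ (traceTerm_two_zero (k := k))
  have h21 := sum_permute (lam := lam) _ _ _ (traceTerm_two_one (k := k))
  have h10 := sum_permute (lam := lam) _ _ _ (traceTerm_one_zero (k := k))
  have h30 := sum_permute (lam := lam) _ _ _ (traceTerm_three_zero (k := k))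
  have h11 := sum_permute (lam := lam) _ _ _ (traceTerm_one_one (k := k))
  have h31 := sum_permute (lam := lam) _ _ _ (traceTerm_three_one (k := k))
  simp only [sum_range_succ, sum_range_zero, h00, h01, h20, h21, h10, h30, h11, h31]
  ring

theorem isIsospectral_zero : IsIsospectral 0
    (Subgroup.closure {prodLeft (κ := Fin k) genA, prodLeft genB} ⊔ latticeTranslations _)
    (Subgroup.closure {prodLeft (κ := Fin k) genA', prodLeft genB'} ⊔ latticeTranslations _) := by
  intro lam
  have := finite_latticeSphere (ι := Fin 6 ⊕ Fin k) lam
  have := Fintype.ofFinite (LatticeSphere (Fin 6 ⊕ Fin k) lam)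
  obtain ⟨d, hd, h⟩ := multiplicity_zeroForms (charAction_genA (k := k)) charAction_genB
    (fun m => by simp) (fun m => by simp) (fun m => by simp) (fun m => by simp)
    (fun m => I_zpow_pow_four _) (fun m => I_zpow_two_mul_sq (n := -m (.inl 5)) (by ring))
    dualA_iterate_four dualB_iterate_two (fun m => by simp [sum_fin_six_ext]) lam
  obtain ⟨d', hd', h'⟩ := multiplicity_zeroForms (charAction_genA' (k := k)) charAction_genB'
    -- The exponent 2 m₃ − 2 m₄ is even. The dual of `genA'` negates it and that of `genB'` changes
    -- it by 4 m₄, so the phase is unchanged in both cases.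
    (fun m => by simp) (fun m => by simp) (fun m => I_zpow_congr (by simp; lia))
    (fun m => I_zpow_congr (by simp; lia))
    (fun m => I_zpow_pow_four _)
    (fun m => I_zpow_two_mul_sq (n := m (.inl 4) - m (.inl 3)) (by ring))
    dualA'_iterate_four dualB'_iterate_two (fun m => by simp [sum_fin_six_ext]) lam
  have h1 : (8 : ℂ) * d = 8 * d' := (h.trans (sum_traceTerm_eq lam)).trans h'.symm
  have h2 : d = d' := by exact_mod_cast mul_left_cancel₀ (by norm_num) h1
  rw [hd, hd', h2]

end Isospectral

/-! ### Consequences of the normal form: finite holonomy and no torsion. -/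

section NormalForm

variable {ι : Type} [Fintype ι] {a b : Iso ι}

/-- Every element of the group generated by `a`, `b` and the lattice has the form `a ^ i b ^ j l`
with `i < 4`, `j < 2` and `l` in the lattice. -/
def HasNormalForm (a b : Iso ι) : Prop :=
  ∀ g ∈ Subgroup.closure {a, b} ⊔ latticeTranslations ι,
    ∃ i < 4, ∃ j < 2, ∃ l ∈ latticeTranslations ι, g = a ^ i * b ^ j * l

theorem HasNormalForm.finite_quotient (h : HasNormalForm a b) :
    Finite (↥(Subgroup.closure {a, b} ⊔ latticeTranslations ι) ⧸
      latticeIn (Subgroup.closure {a, b} ⊔ latticeTranslations ι)) := by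
  set Γ := Subgroup.closure {a, b} ⊔ latticeTranslations ι with hΓ
  have hcl : Subgroup.closure {a, b} ≤ Γ := le_sup_left
  have ha : a ∈ Γ := hcl (Subgroup.subset_closure (by simp))
  have hb : b ∈ Γ := hcl (Subgroup.subset_closure (by simp))
  refine Finite.of_surjective (fun q : Fin 4 × Fin 2 =>
    (((⟨a, ha⟩ : Γ) ^ q.1.1 * (⟨b, hb⟩ : Γ) ^ q.2.1 : Γ) : Γ ⧸ latticeIn Γ)) ?_
  intro q
  obtain ⟨⟨g, hg⟩, rfl⟩ := QuotientGroup.mk_surjective q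
  obtain ⟨i, hi, j, hj, l, hl, rfl⟩ := h g hg
  refine ⟨(⟨i, hi⟩, ⟨j, hj⟩), QuotientGroup.eq.mpr ?_⟩
  rw [latticeIn, Subgroup.mem_subgroupOf]
  simpa [mul_assoc] using hl

theorem HasNormalForm.torsionFree (h : HasNormalForm a b) {s t : ι}
    (has : ∀ x, a x s = x s + 1 / 4) (hbs : ∀ x, b x s = x s) (hbt : ∀ x, b x t = x t + 1 / 2)
    {g : Iso ι} (hg : g ∈ Subgroup.closure {a, b} ⊔ latticeTranslations ι)
    (hfin : IsOfFinOrder g) : g = 1 := by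
  obtain ⟨i, hi, j, hj, l, hl, rfl⟩ := h g hg
  obtain ⟨m, hm⟩ := hl
  have h1 : ∀ x, (a ^ i * b ^ j * l) x s = x s + (m s + i * (1 / 4)) := fun x => by
    rw [iso_mul_apply, iso_mul_apply, pow_apply_coord has,
      pow_apply_coord (c := 0) fun x => by rw [hbs, add_zero], hm]
    ring
  have h2 := coord_translation_eq_zero hfin h1
  -- The total translation along `s` is `m s + i / 4`; it vanishes with `i < 4` only for `i = 0`.
  -- Only then does coordinate `t`, which `a` need not translate, become usable.
  have h3 : (4 * m s + i : ℤ) = 0 := by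
    have : (4 * m s + i : ℝ) = 0 := by linarith
    exact_mod_cast this
  obtain rfl : i = 0 := by omega
  have h4 : ∀ x, (a ^ 0 * b ^ j * l) x t = x t + (m t + j * (1 / 2)) := fun x => by
    rw [pow_zero, one_mul, iso_mul_apply, pow_apply_coord hbt, hm]
    ring
  have h5 := coord_translation_eq_zero hfin h4
  have h6 : (2 * m t + j : ℤ) = 0 := by
    have : (2 * m t + j : ℝ) = 0 := by linarith
    exact_mod_cast this
  obtain rfl : j = 0 := by omega
  rw [pow_zero, pow_zero, one_mul, one_mul] at hfin ⊢
  exact lattice_torsionFree ⟨m, hm⟩ hfin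

theorem HasNormalForm.preservesQuarter (h : HasNormalForm a b) (ha : PreservesQuarter a)
    (hb : PreservesQuarter b) {g : Iso ι}
    (hg : g ∈ Subgroup.closure {a, b} ⊔ latticeTranslations ι) : PreservesQuarter g := by
  obtain ⟨i, -, j, -, l, hl, rfl⟩ := h g hg
  exact ((ha.pow i).mul (hb.pow j)).mul (preservesQuarter_of_mem_lattice hl)

theorem timesLattice_eq (κ : Type) [Fintype κ] (a b : Iso ι) :
    prodGroup (Subgroup.closure {a, b} ⊔ latticeTranslations ι) (latticeTranslations κ) =
      Subgroup.closure {prodLeft a, prodLeft b} ⊔ latticeTranslations (ι ⊕ κ) := by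
  rw [prodGroup_closure_sup, Set.image_pair]

theorem HasNormalForm.prodLeft (κ : Type) [Fintype κ] (h : HasNormalForm a b) :
    HasNormalForm (prodLeft (κ := κ) a) (prodLeft b) := by
  intro g hg
  rw [← timesLattice_eq, mem_prodGroup] at hg
  obtain ⟨γ, hγ, δ, ⟨n, hn⟩, rfl⟩ := hg
  obtain ⟨i, hi, j, hj, l, ⟨m, hm⟩, rfl⟩ := h γ hγ
  refine ⟨i, hi, j, hj, prodIso l δ, ⟨Sum.elim m n, fun x s => ?_⟩, ?_⟩
  · rcases s with s | s
    · exact hm _ s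
    · exact hn _ s
  · rw [← map_pow, ← map_pow, ← map_mul]
    refine iso_ext fun x s => ?_
    rcases s with s | s <;> rfl

end NormalForm

/-! ### Betti numbers and harmonic multiplicities as counts. -/

section Betti

open Module

variable {ι : Type} [Fintype ι] {I : Type} [Finite I] {a b : Iso ι} {u : Basis I ℂ (ι → ℂ)}
  {χ ψ : I → ℂ}

theorem finite_invForms_complex (Γ : Subgroup (Iso ι)) (p : ℕ) :
    Module.Finite ℂ (invForms Γ ℂ p) := by
  classical
  let : LinearOrder ι := linearOrderOfSTO WellOrderingRel
  have : Module.Finite ℂ (Euc ι [⋀^Fin p]→L[ℝ] ℂ) :=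
    Module.Finite.equiv (formCoord (Pi.basisFun ℂ ι)).symm
  infer_instance

/-- Real invariant forms are the real parts of the complex ones. -/
theorem finite_invForms_real (Γ : Subgroup (Iso ι)) (p : ℕ) :
    Module.Finite ℝ (invForms Γ ℝ p) := by
  have := finite_invForms_complex Γ p
  have h : Module.Finite ℝ (invForms Γ ℂ p) := Module.Finite.trans ℂ _
  exact Module.Finite.of_surjective
    ((LinearMap.fst ℝ _ _).comp (invFormsComplexEquiv Γ p).toLinearMap)
    (Prod.fst_surjective.comp (invFormsComplexEquiv Γ p).surjective)

theorem finrank_invForms_real_eq_goodCard (ha : Diagonalizes a u χ) (hb : Diagonalizes b u ψ)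
    (p : ℕ) : finrank ℝ (invForms (Subgroup.closure {a, b} ⊔ latticeTranslations ι) ℝ p) =
      goodCard χ ψ p := by
  have := finite_invForms_real (Subgroup.closure {a, b} ⊔ latticeTranslations ι) p
  rw [← finrank_invForms_complex, finrank_invForms_eq_card ha hb, goodCard]

theorem betti_eq_goodCard (h : HasNormalForm a b) (ha : Diagonalizes a u χ)
    (hb : Diagonalizes b u ψ) (p : ℕ) :
    betti (Subgroup.closure {a, b} ⊔ latticeTranslations ι) p = goodCard χ ψ p := by
  have := h.finite_quotient
  have := Fintype.ofFinite (↥(Subgroup.closure {a, b} ⊔ latticeTranslations ι) ⧸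
    latticeIn (Subgroup.closure {a, b} ⊔ latticeTranslations ι))
  rw [betti_eq_finrank le_sup_right, finrank_invForms_real_eq_goodCard ha hb]

theorem HasNormalForm.finite_deRham (h : HasNormalForm a b) (p : ℕ) :
    Module.Finite ℝ (DeRham (Subgroup.closure {a, b} ⊔ latticeTranslations ι) ℝ p) := by
  have := h.finite_quotient
  have := Fintype.ofFinite (↥(Subgroup.closure {a, b} ⊔ latticeTranslations ι) ⧸
    latticeIn (Subgroup.closure {a, b} ⊔ latticeTranslations ι))
  have := finite_invForms_real (Subgroup.closure {a, b} ⊔ latticeTranslations ι) p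
  exact Module.Finite.equiv (deRhamEquiv le_sup_right p)

theorem multiplicity_eq_goodCard [DecidableEq ι] (ha : Diagonalizes a u χ)
    (hb : Diagonalizes b u ψ) (p : ℕ) :
    multiplicity (Subgroup.closure {a, b} ⊔ latticeTranslations ι) p 0 =
      (goodCard χ ψ p : ℕ) := by
  have := finite_invForms_complex (Subgroup.closure {a, b} ⊔ latticeTranslations ι) p
  rw [multiplicity_zero le_sup_right, ← finrank_eq_rank, finrank_invForms_eq_card ha hb, goodCard]

end Betti

/-! ### Relations between the generators. -/

section GeneratorRelations

theorem hasNormalForm_gen : HasNormalForm genA genB := by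
  refine fun g => exists_normal_form (fun l hl => ?_) (fun l hl => ?_)
    ⟨1, one_mem _, ?_⟩ (show genA ^ 4 ∈ latticeTranslations _ from
      ⟨![0, 0, 0, 0, 1, 0], fun x i => ?_⟩)
    (show genB ^ 2 ∈ latticeTranslations _ from ⟨![0, 0, 0, 0, 0, 1], fun x i => ?_⟩)
  · obtain ⟨m, rfl⟩ := eq_latticeShift_of_mem hl
    -- Moving a translation by `m` past `genA` applies the inverse of B₁ to `m`.
    refine ⟨_, latticeShift_mem ![-m 1, m 0, -m 3, m 2, m 4, m 5], iso_ext fun x i => ?_⟩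
    rw [iso_mul_apply, iso_mul_apply, latticeShift_apply, genA_apply, genA_apply]
    fin_cases i <;> simp <;> ring
  · obtain ⟨m, rfl⟩ := eq_latticeShift_of_mem hl
    refine ⟨_, latticeShift_mem ![-m 0, -m 1, m 2, m 3, m 4, m 5], iso_ext fun x i => ?_⟩
    rw [iso_mul_apply, iso_mul_apply, latticeShift_apply, genB_apply, genB_apply]
    fin_cases i <;> simp <;> ring
  · refine iso_ext fun x i => ?_
    simp only [mul_one]
    simp only [iso_mul_apply, genA_apply, genB_apply]
    fin_cases i <;> simp
  · simp only [pow_succ, pow_zero, one_mul, iso_mul_apply, genA_apply]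
    fin_cases i <;> simp
    ring
  · simp only [pow_succ, pow_zero, one_mul, iso_mul_apply, genB_apply]
    fin_cases i <;> simp
    ring

theorem hasNormalForm_gen' : HasNormalForm genA' genB' := by
  refine fun g => exists_normal_form (fun l hl => ?_) (fun l hl => ?_)
    -- Unlike in the first group the generators do not commute: B₁' negates e₄ and e₅, along which
    -- `genB'` makes half translations, and the defect is −(e₄ + e₅).
    ⟨_, latticeShift_mem ![0, 0, 0, -1, -1, 0], ?_⟩
    (show genA' ^ 4 ∈ latticeTranslations _ from ⟨![0, 0, 0, 0, 0, 1], fun x i => ?_⟩)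
    -- The square is e₄ alone, because B₂' negates e₅ and the half translations along it cancel.
    (show genB' ^ 2 ∈ latticeTranslations _ from ⟨![0, 0, 0, 1, 0, 0], fun x i => ?_⟩)
  · obtain ⟨m, rfl⟩ := eq_latticeShift_of_mem hl
    refine ⟨_, latticeShift_mem ![-m 1, m 0, m 2, -m 3, -m 4, m 5], iso_ext fun x i => ?_⟩
    rw [iso_mul_apply, iso_mul_apply, latticeShift_apply, genA'_apply, genA'_apply]
    fin_cases i <;> simp <;> ring
  · obtain ⟨m, rfl⟩ := eq_latticeShift_of_mem hl
    refine ⟨_, latticeShift_mem ![-m 0, -m 1, -m 2, m 3, -m 4, m 5], iso_ext fun x i => ?_⟩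
    rw [iso_mul_apply, iso_mul_apply, latticeShift_apply, genB'_apply, genB'_apply]
    fin_cases i <;> simp <;> ring
  · refine iso_ext fun x i => ?_
    simp only [iso_mul_apply, genA'_apply, genB'_apply]
    fin_cases i <;> simp <;> ring
  · simp only [pow_succ, pow_zero, one_mul, iso_mul_apply, genA'_apply]
    fin_cases i <;> simp
    ring
  · simp only [pow_succ, pow_zero, one_mul, iso_mul_apply, genB'_apply]
    fin_cases i <;> simp
    ring

theorem preservesQuarter_genA : PreservesQuarter genA := by
  intro x hx i
  choose m hm using hx
  refine ⟨![m 1, -m 0, m 3, -m 2, m 4 + 1, m 5] i, ?_⟩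
  rw [genA_apply]
  fin_cases i <;> simp [← hm]
  all_goals ring

theorem preservesQuarter_genB : PreservesQuarter genB := by
  intro x hx i
  choose m hm using hx
  refine ⟨![-m 0, -m 1, m 2, m 3, m 4, m 5 + 2] i, ?_⟩
  rw [genB_apply]
  fin_cases i <;> simp [← hm]
  all_goals ring

theorem preservesQuarter_genA' : PreservesQuarter genA' := by
  intro x hx i
  choose m hm using hx
  refine ⟨![m 1, -m 0, m 2, -m 3, -m 4, m 5 + 1] i, ?_⟩
  rw [genA'_apply]
  fin_cases i <;> simp [← hm]
  all_goals ring

theorem preservesQuarter_genB' : PreservesQuarter genB' := by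
  intro x hx i
  choose m hm using hx
  refine ⟨![-m 0, -m 1, -m 2, m 3 + 2, -m 4 - 2, m 5] i, ?_⟩
  rw [genB'_apply]
  fin_cases i <;> simp [← hm]
  all_goals ring

theorem preservesQuarter_of_mem_Γ₀ : ∀ g ∈ Γ₀, PreservesQuarter g := fun _ =>
  hasNormalForm_gen.preservesQuarter preservesQuarter_genA preservesQuarter_genB

theorem preservesQuarter_of_mem_Γ₀' : ∀ g ∈ Γ₀', PreservesQuarter g := fun _ =>
  hasNormalForm_gen'.preservesQuarter preservesQuarter_genA' preservesQuarter_genB'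

theorem torsionFree_Γ₀ : ∀ g ∈ Γ₀, IsOfFinOrder g → g = 1 := fun _ =>
  hasNormalForm_gen.torsionFree (s := 4) (t := 5) (fun x => by simp [genA_apply])
    (fun x => by simp [genB_apply]) (fun x => by simp [genB_apply])

theorem torsionFree_Γ₀' : ∀ g ∈ Γ₀', IsOfFinOrder g → g = 1 := fun _ =>
  hasNormalForm_gen'.torsionFree (s := 5) (t := 3) (fun x => by simp [genA'_apply])
    (fun x => by simp [genB'_apply]) (fun x => by simp [genB'_apply])

end GeneratorRelations

/-! ### Simultaneous eigenvectors of the linear parts. -/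

section Eigenbases

open Module

/-- The change of coordinates to eigenvectors of `B₁` and `B₂`. -/
def eigenCoord : (Fin 6 → ℂ) ≃ₗ[ℂ] (Fin 6 → ℂ) where
  -- The rotation block has eigenvectors (1, i) and (1, −i) with eigenvalues i and −i = i³.
  toFun c := ![c 0 + c 1, Complex.I * (c 0 - c 1), c 2 + c 3, Complex.I * (c 2 - c 3), c 4, c 5]
  map_add' c d := by
    ext i
    fin_cases i <;> simp <;> ring
  map_smul' r c := by
    ext i
    fin_cases i <;> simp <;> ring
  invFun y := ![(y 0 - Complex.I * y 1) / 2, (y 0 + Complex.I * y 1) / 2,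
    (y 2 - Complex.I * y 3) / 2, (y 2 + Complex.I * y 3) / 2, y 4, y 5]
  left_inv c := by
    ext i
    fin_cases i <;> simp <;> grind [Complex.I_mul_I]
  right_inv y := by
    ext i
    fin_cases i <;> simp <;> grind [Complex.I_mul_I]

/-- The change of coordinates to eigenvectors of `B₁'` and `B₂'`. -/
def eigenCoord' : (Fin 6 → ℂ) ≃ₗ[ℂ] (Fin 6 → ℂ) where
  toFun c := ![c 0 + c 1, Complex.I * (c 0 - c 1), c 2, c 3, c 4, c 5]
  map_add' c d := by
    ext i
    fin_cases i <;> simp <;> ring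
  map_smul' r c := by
    ext i
    fin_cases i <;> simp <;> ring
  invFun y := ![(y 0 - Complex.I * y 1) / 2, (y 0 + Complex.I * y 1) / 2, y 2, y 3, y 4, y 5]
  left_inv c := by
    ext i
    fin_cases i <;> simp <;> grind [Complex.I_mul_I]
  right_inv y := by
    ext i
    fin_cases i <;> simp <;> grind [Complex.I_mul_I]

/-- A basis of eigenvectors of `B₁` and `B₂`. -/
def eigenBasis : Basis (Fin 6) ℂ (Fin 6 → ℂ) := (Pi.basisFun ℂ (Fin 6)).map eigenCoord

/-- A basis of eigenvectors of `B₁'` and `B₂'`. -/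
def eigenBasis' : Basis (Fin 6) ℂ (Fin 6 → ℂ) := (Pi.basisFun ℂ (Fin 6)).map eigenCoord'

theorem eigenBasis_apply (i : Fin 6) : eigenBasis i = eigenCoord (Pi.single i 1) := by
  simp [eigenBasis]

theorem eigenBasis'_apply (i : Fin 6) : eigenBasis' i = eigenCoord' (Pi.single i 1) := by
  simp [eigenBasis']

theorem diagonalizes_genA :
    Diagonalizes genA eigenBasis fun i => Complex.I ^ ((![1, 3, 1, 3, 0, 0] : Fin 6 → ℕ) i) := by
  refine ⟨
    { toFun := fun x => ![x 1, -x 0, x 3, -x 2, x 4, x 5]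
      map_add' := fun x y => by ext i; fin_cases i <;> simp <;> ring
      map_smul' := fun r x => by ext i; fin_cases i <;> simp }, fun x => ?_, fun i => ?_⟩
  · ext i
    rw [toComplexVec_apply, linearIsometryEquiv_eq_sub, PiLp.sub_apply, genA_apply, genA_apply]
    fin_cases i <;> simp
  · rw [eigenBasis_apply]
    ext j
    fin_cases i <;> fin_cases j <;> simp [eigenCoord]

theorem diagonalizes_genB :
    Diagonalizes genB eigenBasis fun i => Complex.I ^ ((![2, 2, 0, 0, 0, 0] : Fin 6 → ℕ) i) := by
  refine ⟨
    { toFun := fun x => ![-x 0, -x 1, x 2, x 3, x 4, x 5]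
      map_add' := fun x y => by ext i; fin_cases i <;> simp <;> ring
      map_smul' := fun r x => by ext i; fin_cases i <;> simp }, fun x => ?_, fun i => ?_⟩
  · ext i
    rw [toComplexVec_apply, linearIsometryEquiv_eq_sub, PiLp.sub_apply, genB_apply, genB_apply]
    fin_cases i <;> simp
  · rw [eigenBasis_apply]
    ext j
    fin_cases i <;> fin_cases j <;> simp [eigenCoord]

theorem diagonalizes_genA' :
    Diagonalizes genA' eigenBasis' fun i => Complex.I ^ ((![1, 3, 0, 2, 2, 0] : Fin 6 → ℕ) i) := by
  refine ⟨
    { toFun := fun x => ![x 1, -x 0, x 2, -x 3, -x 4, x 5]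
      map_add' := fun x y => by ext i; fin_cases i <;> simp <;> ring
      map_smul' := fun r x => by ext i; fin_cases i <;> simp }, fun x => ?_, fun i => ?_⟩
  · ext i
    rw [toComplexVec_apply, linearIsometryEquiv_eq_sub, PiLp.sub_apply, genA'_apply, genA'_apply]
    fin_cases i <;> simp
  · rw [eigenBasis'_apply]
    ext j
    fin_cases i <;> fin_cases j <;> simp [eigenCoord']

theorem diagonalizes_genB' :
    Diagonalizes genB' eigenBasis' fun i => Complex.I ^ ((![2, 2, 2, 0, 2, 0] : Fin 6 → ℕ) i) := by
  refine ⟨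
    { toFun := fun x => ![-x 0, -x 1, -x 2, x 3, -x 4, x 5]
      map_add' := fun x y => by ext i; fin_cases i <;> simp <;> ring
      map_smul' := fun r x => by ext i; fin_cases i <;> simp }, fun x => ?_, fun i => ?_⟩
  · ext i
    rw [toComplexVec_apply, linearIsometryEquiv_eq_sub, PiLp.sub_apply, genB'_apply, genB'_apply]
    fin_cases i <;> simp
  · rw [eigenBasis'_apply]
    ext j
    fin_cases i <;> fin_cases j <;> simp [eigenCoord']

end Eigenbases

/-! ### Comparison of the Betti numbers. -/

section Comparison

/-- The Betti numbers of `M_Γ`. -/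
def bettiCount : ℕ → ℕ :=
  goodCard (fun i => Complex.I ^ ((![1, 3, 1, 3, 0, 0] : Fin 6 → ℕ) i))
    fun i => Complex.I ^ ((![2, 2, 0, 0, 0, 0] : Fin 6 → ℕ) i)

/-- The Betti numbers of `M_Γ'`. -/
def bettiCount' : ℕ → ℕ :=
  goodCard (fun i => Complex.I ^ ((![1, 3, 0, 2, 2, 0] : Fin 6 → ℕ) i))
    fun i => Complex.I ^ ((![2, 2, 2, 0, 2, 0] : Fin 6 → ℕ) i)

/-- A finite check modulo 4. For the first group the good sets are unions of {0,1}, {2,3}, {4} and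
{5}; for the second they are unions of {0,1}, {2,3,4} and {5}. This gives 1,2,3,4,3,2,1 against
1,1,1,2,1,1,1. -/
theorem bettiCount'_le (i : ℕ) (hi : i ≤ 6) : bettiCount' i ≤ bettiCount i := by
  rw [bettiCount, bettiCount', goodCard_eq_card_dvd, goodCard_eq_card_dvd]
  revert i
  decide +kernel

theorem bettiCount'_lt (i : ℕ) (hi0 : 0 < i) (hi : i < 6) : bettiCount' i < bettiCount i := by
  rw [bettiCount, bettiCount', goodCard_eq_card_dvd, goodCard_eq_card_dvd]
  interval_cases i <;> decide +kernel

variable (k : ℕ)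

theorem timesTorus_Γ₀ : timesTorus Γ₀ k =
    Subgroup.closure {prodLeft genA, prodLeft genB} ⊔ latticeTranslations (Fin 6 ⊕ Fin k) :=
  timesLattice_eq (Fin k) genA genB

theorem timesTorus_Γ₀' : timesTorus Γ₀' k =
    Subgroup.closure {prodLeft genA', prodLeft genB'} ⊔ latticeTranslations (Fin 6 ⊕ Fin k) :=
  timesLattice_eq (Fin k) genA' genB'

theorem betti_Γ₀ (p : ℕ) : betti Γ₀ p = bettiCount p :=
  betti_eq_goodCard hasNormalForm_gen diagonalizes_genA diagonalizes_genB p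

theorem betti_Γ₀' (p : ℕ) : betti Γ₀' p = bettiCount' p :=
  betti_eq_goodCard hasNormalForm_gen' diagonalizes_genA' diagonalizes_genB' p

/-- The number computing the Betti numbers of `M × T^k`, as a sum. -/
theorem goodCard_timesTorus (χ ψ : Fin 6 → ℂ) (h : ℕ) :
    goodCard (Sum.elim χ (1 : Fin k → ℂ)) (Sum.elim ψ (1 : Fin k → ℂ)) h =
      ∑ i ∈ Finset.range (min h 6 + 1), goodCard χ ψ i * Nat.choose k (h - i) := by
  rw [goodCard_sum, Fintype.card_fin, Fintype.card_fin]

theorem betti_timesTorus_Γ₀ (h : ℕ) : betti (timesTorus Γ₀ k) h =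
    ∑ i ∈ Finset.range (min h 6 + 1), bettiCount i * Nat.choose k (h - i) := by
  rw [timesTorus_Γ₀, betti_eq_goodCard (hasNormalForm_gen.prodLeft _) diagonalizes_genA.prodLeft
    diagonalizes_genB.prodLeft, goodCard_timesTorus]
  rfl

theorem betti_timesTorus_Γ₀' (h : ℕ) : betti (timesTorus Γ₀' k) h =
    ∑ i ∈ Finset.range (min h 6 + 1), bettiCount' i * Nat.choose k (h - i) := by
  rw [timesTorus_Γ₀', betti_eq_goodCard (hasNormalForm_gen'.prodLeft _)
    diagonalizes_genA'.prodLeft diagonalizes_genB'.prodLeft, goodCard_timesTorus]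
  rfl

/-- Hodge theory at the eigenvalue 0: both numbers count the same sets of eigenvectors. A difference
of Betti numbers thus rules out `p`-isospectrality. -/
theorem multiplicity_timesTorus_Γ₀ (p : ℕ) :
    multiplicity (timesTorus Γ₀ k) p 0 = (betti (timesTorus Γ₀ k) p : ℕ) := by
  rw [timesTorus_Γ₀, betti_eq_goodCard (hasNormalForm_gen.prodLeft _) diagonalizes_genA.prodLeft
    diagonalizes_genB.prodLeft,
    multiplicity_eq_goodCard diagonalizes_genA.prodLeft diagonalizes_genB.prodLeft]

theorem multiplicity_timesTorus_Γ₀' (p : ℕ) :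
    multiplicity (timesTorus Γ₀' k) p 0 = (betti (timesTorus Γ₀' k) p : ℕ) := by
  rw [timesTorus_Γ₀', betti_eq_goodCard (hasNormalForm_gen'.prodLeft _)
    diagonalizes_genA'.prodLeft diagonalizes_genB'.prodLeft,
    multiplicity_eq_goodCard diagonalizes_genA'.prodLeft diagonalizes_genB'.prodLeft]

theorem betti_timesTorus_lt {h : ℕ} (h0 : 0 < h) (h1 : h < k + 6) :
    betti (timesTorus Γ₀' k) h < betti (timesTorus Γ₀ k) h := by
  rw [betti_timesTorus_Γ₀, betti_timesTorus_Γ₀']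
  exact sum_mul_choose_lt bettiCount'_le bettiCount'_lt h0 h1

end Comparison

end FlatManifold

end

theorem mainTheorem6 :
    FlatManifold.IsBieberbach FlatManifold.Γ₀ ∧ FlatManifold.IsBieberbach FlatManifold.Γ₀' ∧
    ∀ n k : ℕ, n = k + 6 →
      FlatManifold.IsBieberbach (FlatManifold.timesTorus FlatManifold.Γ₀ k) ∧
      FlatManifold.IsBieberbach (FlatManifold.timesTorus FlatManifold.Γ₀' k) ∧
      FlatManifold.IsIsospectral 0 (FlatManifold.timesTorus FlatManifold.Γ₀ k)
        (FlatManifold.timesTorus FlatManifold.Γ₀' k) ∧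
      (∀ h : ℕ, Module.Finite ℝ (FlatManifold.DeRham (FlatManifold.timesTorus FlatManifold.Γ₀ k) ℝ h) ∧
        Module.Finite ℝ (FlatManifold.DeRham (FlatManifold.timesTorus FlatManifold.Γ₀' k) ℝ h)) ∧
      (∀ h : ℕ,
        FlatManifold.betti (FlatManifold.timesTorus FlatManifold.Γ₀ k) h =
          ∑ i ∈ Finset.range (min h 6 + 1),
            FlatManifold.betti FlatManifold.Γ₀ i * Nat.choose k (h - i)) ∧
      (∀ h : ℕ,
        FlatManifold.betti (FlatManifold.timesTorus FlatManifold.Γ₀' k) h =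
          ∑ i ∈ Finset.range (min h 6 + 1),
            FlatManifold.betti FlatManifold.Γ₀' i * Nat.choose k (h - i)) ∧
      (∀ h : ℕ, 0 < h → h < n →
        FlatManifold.betti (FlatManifold.timesTorus FlatManifold.Γ₀ k) h >
          FlatManifold.betti (FlatManifold.timesTorus FlatManifold.Γ₀' k) h) ∧
      (∀ p : ℕ, 0 < p → p < n →
        ¬ FlatManifold.IsIsospectral p (FlatManifold.timesTorus FlatManifold.Γ₀ k)
          (FlatManifold.timesTorus FlatManifold.Γ₀' k)) := by
  open FlatManifold in
  refine ⟨isBieberbach_of_preservesQuarter le_sup_right preservesQuarter_of_mem_Γ₀ torsionFree_Γ₀,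
    isBieberbach_of_preservesQuarter le_sup_right preservesQuarter_of_mem_Γ₀' torsionFree_Γ₀',
    fun n k hn => ⟨
      isBieberbach_prodGroup le_sup_right preservesQuarter_of_mem_Γ₀ torsionFree_Γ₀,
      isBieberbach_prodGroup le_sup_right preservesQuarter_of_mem_Γ₀' torsionFree_Γ₀',
      ?_, fun h => ⟨?_, ?_⟩, fun h => ?_, fun h => ?_,
      fun h h0 h1 => betti_timesTorus_lt k h0 (hn ▸ h1), fun p h0 h1 h => ?_⟩⟩
  · rw [timesTorus_Γ₀, timesTorus_Γ₀']
    exact isIsospectral_zero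
  · rw [timesTorus_Γ₀]
    exact (hasNormalForm_gen.prodLeft _).finite_deRham h
  · rw [timesTorus_Γ₀']
    exact (hasNormalForm_gen'.prodLeft _).finite_deRham h
  · simp only [betti_timesTorus_Γ₀, betti_Γ₀]
  · simp only [betti_timesTorus_Γ₀', betti_Γ₀']
  · have h2 := h 0
    rw [multiplicity_timesTorus_Γ₀, multiplicity_timesTorus_Γ₀'] at h2
    exact (betti_timesTorus_lt k h0 (hn ▸ h1)).ne' (by exact_mod_cast h2)
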